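/- Let $(\Omega,\mathcal F,(\mathcal F(t))_{t\ge 0},\tilde{\mathbb P})$ be a filtered probability space ($\tilde{\mathbb P}$ is the risk-neutral measure) carrying a standard $d$-dimensional Brownian motion $B=(B_1,\dots,B_d)$ with respect to the filtration. Let $r\in\mathbb R$ be a constant interest rate and $(\sigma_{ij})_{1\le i\le n,\,1\le j\le d}$ a constant real matrix with $\sigma_i:=\big(\sum_{j}\sigma_{ij}^2\big)^{1/2}>0$ for every $i$. Let $S_1,\dots,S_n$ be positive continuous adapted processes with $$dS_i(t)=S_i(t)\Big[r\,dt+\sum_{j=1}^d\sigma_{ij}\,dB_j(t)\Big]=S_i(t)\big[r\,dt+\sigma_i\,dW_i(t)\big],\qquad W_i=\sum_{j=1}^d\frac{\sigma_{ij}}{\sigma_i}B_j ,$$ and let $\rho_{ij}$ be the instantaneous correlations, $dW_i(t)\,dW_j(t)=\rho_{ij}\,dt$. **Proposition (Pricing LPs with deterministic time-varying weights).** Let $w_1,\dots,w_n:[0,\infty)\to\mathbb R$ be deterministic (Borel measurable) functions of time with $w_i(t)\ge 0$ and $\sum_{i=1}^n w_i(t)=1$ for all $t$. Let $G$ be the payoff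 of a share of the geometric mean market maker liquidity pool with these weights, that is, $$G(t)=G(0)\prod_{i=1}^n e^{\int_0^t w_i(s)\,d\log S_i(s)},$$ where $G(0)$ is $\mathcal F(0)$-measurable and integrable, so that $G(T)=G(t)\prod_{i=1}^n e^{\int_t^T w_i(s)\,d\log S_i(s)}$ almost surely for $0\le t\le T$. Then, for all $0\le t\le T$, $G(T)$ is integrable and the price at time $t$ of the payoff $G(T)$ is $$\tilde{\mathbb E}\big[e^{-r(T-t)}G(T)\,\big|\,\mathcal F(t)\big]=G(t)\,e^{\eta(t,T)}\quad\text{almost surely},$$ where $$\eta(t,T)=\sum_{i=1}^n\frac{\sigma_i^2}{2}\int_t^T\big[w_i^2(s)-w_i(s)\big]\,ds+\frac12\sum_{i\ne j}\sigma_i\sigma_j\rho_{ij}\int_t^T w_i(s)w_j(s)\,ds .$$ -/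

import Mathlib

open MeasureTheory ProbabilityTheory Filter Topology
open scoped NNReal ENNReal

namespace LPPricing

noncomputable section

variable {Ω : Type*} [mΩ : MeasurableSpace Ω]

/-- `B = (B_1, …, B_d)` is a standard `d`-dimensional Brownian motion for the filtration `𝓕`
under `P`: its components are independent adapted real Brownian motions started at `0`, and the
increments of the vector `B` after time `s` are independent of `𝓕 s`. -/
structure IsStandardBrownianMotion (P : Measure Ω) (𝓕 : Filtration ℝ≥0 mΩ) {d : ℕ}
    (B : Fin d → ℝ≥0 → Ω → ℝ) : Prop where
  brownian : ∀ j, IsBrownianReal (B j) P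
  adapted : ∀ j, Adapted 𝓕 (B j)
  indep_components : iIndepFun (fun j ω (t : ℝ≥0) => B j t ω) P
  indep_increments : ∀ s t : ℝ≥0, s ≤ t →
    Indep (MeasurableSpace.comap (fun ω (j : Fin d) => B j t ω - B j s ω) inferInstance) (𝓕 s) P

/-- A simple (elementary predictable) process `∑_{k < num} val_k 𝟙_{(time_k, time_{k+1}]}`, where
`val_k` is bounded and `𝓕 (time_k)`-measurable. -/
structure SimpleProcess (𝓕 : Filtration ℝ≥0 mΩ) where
  num : ℕ
  time : ℕ → ℝ≥0
  time_mono : Monotone time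
  val : ℕ → Ω → ℝ
  val_meas : ∀ k, Measurable[𝓕 (time k)] (val k)
  val_bdd : ∃ C : ℝ, ∀ k ω, |val k ω| ≤ C

namespace SimpleProcess

variable {𝓕 : Filtration ℝ≥0 mΩ}

/-- The value of a simple process at time `u`. -/
def eval (V : SimpleProcess 𝓕) (u : ℝ≥0) (ω : Ω) : ℝ :=
  ∑ k ∈ Finset.range V.num, (Set.Ioc (V.time k) (V.time (k + 1))).indicator (fun _ => V.val k ω) u

/-- The elementary stochastic integral `∫_s^t V dX` of a simple process, for `s ≤ t`: the times
`time_k` are moved into `[s, t]`. -/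
def integral (V : SimpleProcess 𝓕) (X : ℝ≥0 → Ω → ℝ) (s t : ℝ≥0) (ω : Ω) : ℝ :=
  ∑ k ∈ Finset.range V.num,
    V.val k ω * (X (max s (min (V.time (k + 1)) t)) ω - X (max s (min (V.time k) t)) ω)

end SimpleProcess

/-- The simple processes `V m` approximate `H` on `(s, t]`: `∫_s^t |V m - H|² du → 0` in
probability as `m → ∞`. -/
def Approximates (P : Measure Ω) {𝓕 : Filtration ℝ≥0 mΩ} (V : ℕ → SimpleProcess 𝓕)
    (H : ℝ≥0 → Ω → ℝ) (s t : ℝ≥0) : Prop :=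
  ∀ ε : ℝ≥0∞, 0 < ε → Tendsto
    (fun m => P {ω | ε ≤ ∫⁻ u in Set.Ioc (s : ℝ) t,
      ‖(V m).eval u.toNNReal ω - H u.toNNReal ω‖ₑ ^ 2}) atTop (𝓝 0)

/-- `J` is (a version of) the Itô integral `∫_s^t H dX`, `s ≤ t`: `H` can be approximated by simple
processes in the sense of `Approximates`, and for every such approximation the elementary integrals
converge to `J` in probability.

This is the Itô integral when `X` is a Brownian motion of the filtration and, more generally, when
`X` is an Itô process with bounded coefficients. -/
def IsItoIntegral (P : Measure Ω) (𝓕 : Filtration ℝ≥0 mΩ) (H X : ℝ≥0 → Ω → ℝ) (s t : ℝ≥0)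
    (J : Ω → ℝ) : Prop :=
  (∃ V : ℕ → SimpleProcess 𝓕, Approximates P V H s t) ∧
    ∀ V : ℕ → SimpleProcess 𝓕, Approximates P V H s t →
      TendstoInMeasure P (fun m => (V m).integral X s t) atTop J

open scoped Classical in
/-- The Itô integral `∫_s^t H dX` (unique up to almost sure equality), and `0` if the integral does
not exist. -/
def itoIntegral (P : Measure Ω) (𝓕 : Filtration ℝ≥0 mΩ) (H X : ℝ≥0 → Ω → ℝ) (s t : ℝ≥0) :
    Ω → ℝ :=
  if h : ∃ J, IsItoIntegral P 𝓕 H X s t J then h.choose else 0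

/-- A finite partition `0 = pt 0 ≤ pt 1 ≤ … ≤ pt num = t` of `[0, t]`. -/
structure TimePartition (t : ℝ≥0) where
  num : ℕ
  pt : ℕ → ℝ≥0
  pt_mono : Monotone pt
  pt_zero : pt 0 = 0
  pt_num : pt num = t

/-- The length of the longest interval of a partition. -/
def TimePartition.mesh {t : ℝ≥0} (π : TimePartition t) : ℝ≥0 :=
  (Finset.range π.num).sup fun k => π.pt (k + 1) - π.pt k

/-- `d⟨X, Y⟩ = c dt` for a constant `c` (informally `dX dY = c dt`): along all partitions of `[0, t]`
with mesh tending to `0`, the sums of products of increments converge in probability to `c t`. -/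
def HasCovariationRate (P : Measure Ω) (X Y : ℝ≥0 → Ω → ℝ) (c : ℝ) : Prop :=
  ∀ (t : ℝ≥0) (π : ℕ → TimePartition t), Tendsto (fun m => (π m).mesh) atTop (𝓝 0) →
    TendstoInMeasure P
      (fun m ω => ∑ k ∈ Finset.range (π m).num,
        (X ((π m).pt (k + 1)) ω - X ((π m).pt k) ω) * (Y ((π m).pt (k + 1)) ω - Y ((π m).pt k) ω))
      atTop (fun _ => c * t)

/-- The volatility `σ_i = √(∑_j σ_{ij}²)` of asset `i`. -/
def vol {n d : ℕ} (σ : Matrix (Fin n) (Fin d) ℝ) (i : Fin n) : ℝ :=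
  √(∑ j, σ i j ^ 2)

/-- The Brownian motion `W_i = ∑_j (σ_{ij} / σ_i) B_j` driving asset `i`. -/
def drivingBM {n d : ℕ} (σ : Matrix (Fin n) (Fin d) ℝ) (B : Fin d → ℝ≥0 → Ω → ℝ) (i : Fin n)
    (t : ℝ≥0) (ω : Ω) : ℝ :=
  ∑ j, σ i j / vol σ i * B j t ω

/-- The prices `S_1, …, S_n` are positive continuous adapted processes that solve
`dS_i = S_i (r dt + ∑_j σ_{ij} dB_j)`. -/
structure IsMarketModel (P : Measure Ω) (𝓕 : Filtration ℝ≥0 mΩ) {n d : ℕ}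
    (B : Fin d → ℝ≥0 → Ω → ℝ) (r : ℝ) (σ : Matrix (Fin n) (Fin d) ℝ)
    (S : Fin n → ℝ≥0 → Ω → ℝ) : Prop where
  adapted : ∀ i, Adapted 𝓕 (S i)
  continuous : ∀ i, ∀ᵐ ω ∂P, Continuous fun t => S i t ω
  pos : ∀ i t ω, 0 < S i t ω
  sde : ∀ i t, ∃ J : Fin d → Ω → ℝ, (∀ j, IsItoIntegral P 𝓕 (S i) (B j) 0 t (J j)) ∧
    ∀ᵐ ω ∂P, S i t ω =
      S i 0 ω + (∫ u in (0 : ℝ)..t, r * S i u.toNNReal ω) + ∑ j, σ i j * J j ω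

/-- The stochastic integral `∫_s^t w(u) d log S(u)` for a deterministic weight `w`. -/
def logReturn (P : Measure Ω) (𝓕 : Filtration ℝ≥0 mΩ) (w : ℝ≥0 → ℝ) (S : ℝ≥0 → Ω → ℝ)
    (s t : ℝ≥0) : Ω → ℝ :=
  itoIntegral P 𝓕 (fun u _ => w u) (fun u ω => Real.log (S u ω)) s t

/-- The payoff `G(t) = G(0) ∏_i exp (∫_0^t w_i d log S_i)` of a share of a geometric mean market
maker pool with time-varying weights `w_i` and initial value `G(0)`. -/
def lpPayoff (P : Measure Ω) (𝓕 : Filtration ℝ≥0 mΩ) {n : ℕ} (G₀ : Ω → ℝ) (w : Fin n → ℝ≥0 → ℝ)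
    (S : Fin n → ℝ≥0 → Ω → ℝ) (t : ℝ≥0) (ω : Ω) : ℝ :=
  G₀ ω * ∏ i, Real.exp (logReturn P 𝓕 (w i) (S i) 0 t ω)

/-- `η(t, T) = ∑_i (σ_i² / 2) ∫_t^T (w_i² - w_i) du
  + ½ ∑_{i ≠ j} σ_i σ_j ρ_{ij} ∫_t^T w_i w_j du`. -/
def eta {n : ℕ} (v : Fin n → ℝ) (ρ : Fin n → Fin n → ℝ) (w : Fin n → ℝ≥0 → ℝ) (t T : ℝ≥0) : ℝ :=
  ∑ i, v i ^ 2 / 2 * (∫ u in (t : ℝ)..T, (w i u.toNNReal ^ 2 - w i u.toNNReal)) +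
    1 / 2 * ∑ i, ∑ j ∈ Finset.univ.filter (fun j => j ≠ i),
      v i * v j * ρ i j * ∫ u in (t : ℝ)..T, w i u.toNNReal * w j u.toNNReal

end

end LPPricing

open LPPricing

/-!
The product `∏ i, exp (∫ w_i d log S_i)` is the exponential of the total log return
`R(s, t) = ∑ i, ∫_s^t w_i d log S_i`, which is additive in the interval. With deterministic weights,
`R(s, t)` is Gaussian and independent of `𝓕 s`. Hence `G(T) = G(t) exp R(t, T)` with `G(t)` known at
time `t`, the conditional expectation only replaces `exp R(t, T)` by the mean of a lognormal
variable (`condExp_mul_exp_of_gaussian`), and `η(t, T)` is what remains of `mean + variance / 2`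
after discounting, because the weights sum to `1` (`integral_drift_add_half_variance_eq`).
Applied to `[0, t]` and the initial value `G(0)`, the same argument gives the integrability of the
payoff.

Itô calculus is developed only as far as the argument needs it.

* The price equation is turned into `d log S_i = (r - σ_i² / 2) dt + ∑ j, σ_{ij} dB_j` without a
  general Itô formula. On a fine uniform partition the relative increments of `S_i` are
  `r Δt + ∑ j, σ_{ij} ΔB_j` up to the error of freezing the integrand `S_i` on each interval. These
  errors, their sum as well as their sum of squares, vanish in probability by a Lenglart-type
  inequality for elementary integrals (`IsScaledBM.measure_groups_le`). A second-order expansion of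
  the logarithm and the convergence of the quadratic variation finish the proof
  (`log_sub_log_eq`, `LPPricing.IsMarketModel.log_sub_log_ae_eq`).
* The integral `∫ w d log S_i` exists because the elementary integrals of the averages of `w` over
  the cells of a uniform grid form a Cauchy sequence in `L²`, and because simple processes that
  approximate the same integrand have the same limit, again by the Lenglart-type inequality
  (`IsScaledBM.isItoIntegral_of_tendstoInMeasure`).
* For the cell averages the total log return is a sum of increments of `B` with deterministic
  coefficients, whose characteristic function on events of `𝓕 s` is explicit
  (`LPPricing.IsStandardBrownianMotion.setIntegral_cexp_sum`). Lebesgue's differentiation theorem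
  gives the convergence of the mean and the variance, and the limit is identified by its
  characteristic function (`LPPricing.IsMarketModel.exists_gaussian_sum_logReturn`).
* The correlations are limits of sums of products of increments, so that by polarization they are
  given by the quadratic variation of Brownian motion: `σ_i σ_j ρ_{ij} = ∑ k, σ_{ik} σ_{jk}`
  (`vol_mul_vol_mul_rho_eq`).
-/

/-! ### Scaled Brownian motions of the filtration and the Itô isometry -/

/-- `X` is, up to its starting value, `√c` times a Brownian motion of the filtration `𝓕`: it is
adapted, and the increment over `[s, t]` is independent of `𝓕 s` with law `N(0, c (t - s))`. -/
structure IsScaledBM {Ω : Type*} [mΩ : MeasurableSpace Ω] (P : Measure Ω) (𝓕 : Filtration ℝ≥0 mΩ)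
    (X : ℝ≥0 → Ω → ℝ) (c : ℝ≥0) : Prop where
  adapted : Adapted 𝓕 X
  indep : ∀ s t, s ≤ t →
    Indep (MeasurableSpace.comap (fun ω => X t ω - X s ω) inferInstance) (𝓕 s) P
  law : ∀ s t, s ≤ t → P.map (fun ω => X t ω - X s ω) = gaussianReal 0 (c * (t - s))

section ScaledBM

variable {Ω : Type*} [mΩ : MeasurableSpace Ω] {P : Measure Ω} {𝓕 : Filtration ℝ≥0 mΩ}

theorem LPPricing.IsStandardBrownianMotion.isScaledBM {d : ℕ}
    {B : Fin d → ℝ≥0 → Ω → ℝ} (hB : IsStandardBrownianMotion P 𝓕 B) (a : Fin d → ℝ) (c : ℝ≥0)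
    (hc : (c : ℝ) = ∑ j, a j ^ 2) : IsScaledBM P 𝓕 (fun t ω => ∑ j, a j * B j t ω) c where
  adapted t := Finset.measurable_sum _ fun j _ => (hB.adapted j t).const_mul (a j)
  indep s t hst := by
    refine indep_of_indep_of_le_left (hB.indep_increments s t hst) ?_
    have h : (fun ω => ∑ j, a j * B j t ω - ∑ j, a j * B j s ω) =
        (fun x : Fin d → ℝ => ∑ j, a j * x j) ∘ (fun ω j => B j t ω - B j s ω) := by
      funext ω
      simp [mul_sub, Finset.sum_sub_distrib]
    rw [h, ← MeasurableSpace.comap_comp]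
    exact MeasurableSpace.comap_mono (by
      apply Measurable.comap_le
      fun_prop)
  law s t hst := by
    have hP : IsProbabilityMeasure P := hB.indep_components.isProbabilityMeasure
    have hmeas : ∀ j u, Measurable (B j u) := fun j u => (hB.adapted j u).mono (𝓕.le u) le_rfl
    have hind : iIndepFun (fun j ω => a j * (B j t ω - B j s ω)) P :=
      hB.indep_components.comp (fun j (f : ℝ≥0 → ℝ) => a j * (f t - f s)) (fun j => by fun_prop)
    have hlaw : ∀ j, P.map (fun ω => a j * (B j t ω - B j s ω)) =
        gaussianReal 0 ((a j ^ 2).toNNReal * (t - s)) := by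
      intro j
      have h1 := (hB.brownian j).toIsPreBrownianReal.hasLaw_sub t s
      have h2 := (gaussianReal_const_mul h1 (a j)).map_eq
      simp only [mul_zero] at h2
      have hd : nndist t.1 s.1 = t - s := by
        apply NNReal.coe_injective
        rw [coe_nndist, NNReal.coe_sub hst, Real.dist_eq, abs_of_nonneg]
        · rfl
        · exact sub_nonneg.2 (NNReal.coe_le_coe.2 hst)
      rw [hd] at h2
      rw [Real.toNNReal_of_nonneg (sq_nonneg _)]
      exact h2
    have h : (fun ω => ∑ j, a j * B j t ω - ∑ j, a j * B j s ω) =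
        fun ω => ∑ j, a j * (B j t ω - B j s ω) := by
      funext ω
      simp [mul_sub, Finset.sum_sub_distrib]
    rw [h]
    apply Measure.ext_of_charFun
    rw [iIndepFun.charFun_map_fun_sum_eq_prod (fun j => by fun_prop) hind]
    funext u
    simp only [Finset.prod_apply, hlaw, charFun_gaussianReal, ← Complex.exp_sum]
    congr 1
    have hc' : (c : ℂ) = ∑ j, ((a j ^ 2).toNNReal : ℂ) := by
      have := congrArg (fun x : ℝ => (x : ℂ)) hc
      simpa [Real.coe_toNNReal _ (sq_nonneg _)] using this
    push_cast
    rw [hc']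
    simp [Finset.sum_mul, Finset.sum_div]

variable {X : ℝ≥0 → Ω → ℝ} {c : ℝ≥0}

theorem IsScaledBM.measurable (hX : IsScaledBM P 𝓕 X c) (t : ℝ≥0) : Measurable (X t) :=
  (hX.adapted t).mono (𝓕.le t) le_rfl

theorem IsScaledBM.indepFun (hX : IsScaledBM P 𝓕 X c) {s t : ℝ≥0} (hst : s ≤ t) {β : Type*}
    [MeasurableSpace β] {Y : Ω → β} (hY : Measurable[𝓕 s] Y) :
    IndepFun Y (fun ω => X t ω - X s ω) P :=
  (indep_of_indep_of_le_right (hX.indep s t hst) hY.comap_le).symm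

theorem IsScaledBM.memLp (hX : IsScaledBM P 𝓕 X c) {s t : ℝ≥0} (hst : s ≤ t) {p : ℝ≥0∞}
    (hp : p ≠ ∞) : MemLp (fun ω => X t ω - X s ω) p P := by
  have h := memLp_id_gaussianReal' (μ := 0) (v := c * (t - s)) p hp
  rw [← hX.law s t hst] at h
  exact (memLp_map_measure_iff aestronglyMeasurable_id
    ((hX.measurable t).sub (hX.measurable s)).aemeasurable).1 h

theorem IsScaledBM.integral_sub (hX : IsScaledBM P 𝓕 X c) {s t : ℝ≥0} (hst : s ≤ t) :
    ∫ ω, (X t ω - X s ω) ∂P = 0 := by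
  have h := integral_map (μ := P) (φ := fun ω => X t ω - X s ω) (f := fun x : ℝ => x)
    ((hX.measurable t).sub (hX.measurable s)).aemeasurable (by fun_prop)
  rw [← h, hX.law s t hst, integral_id_gaussianReal]

theorem IsScaledBM.integral_sub_sq (hX : IsScaledBM P 𝓕 X c) {s t : ℝ≥0} (hst : s ≤ t) :
    ∫ ω, (X t ω - X s ω) ^ 2 ∂P = c * ((t : ℝ) - s) := by
  have h := integral_map (μ := P) (φ := fun ω => X t ω - X s ω) (f := fun x : ℝ => x ^ 2)
    ((hX.measurable t).sub (hX.measurable s)).aemeasurable (by fun_prop)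
  rw [← h, hX.law s t hst]
  have h2 := variance_fun_id_gaussianReal (μ := 0) (v := c * (t - s))
  rw [variance_eq_integral measurable_id'.aemeasurable, integral_id_gaussianReal] at h2
  simp only [sub_zero] at h2
  rw [h2, NNReal.coe_mul, NNReal.coe_sub hst]

/-- The Itô isometry for elementary integrals, together with the measurability and
square-integrability that carry the induction. -/
theorem IsScaledBM.isometry [IsProbabilityMeasure P] (hX : IsScaledBM P 𝓕 X c) {τ : ℕ → ℝ≥0}
    (hτ : Monotone τ) {ξ : ℕ → Ω → ℝ} (hξ : ∀ q, Measurable[𝓕 (τ q)] (ξ q))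
    (hb : ∀ q, ∃ C, ∀ ω, |ξ q ω| ≤ C) {a b : ℕ} (hab : a ≤ b) :
    Measurable[𝓕 (τ b)] (fun ω => ∑ q ∈ Finset.Ico a b, ξ q ω * (X (τ (q + 1)) ω - X (τ q) ω)) ∧
    MemLp (fun ω => ∑ q ∈ Finset.Ico a b, ξ q ω * (X (τ (q + 1)) ω - X (τ q) ω)) 2 P ∧
    ∫ ω, (∑ q ∈ Finset.Ico a b, ξ q ω * (X (τ (q + 1)) ω - X (τ q) ω)) ^ 2 ∂P =
      ∑ q ∈ Finset.Ico a b, c * ((τ (q + 1) : ℝ) - τ q) * ∫ ω, ξ q ω ^ 2 ∂P := by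
  induction b, hab using Nat.le_induction with
  | base => simp
  | succ b hab ih =>
    obtain ⟨ih1, ih2, ih3⟩ := ih
    have hle : τ b ≤ τ (b + 1) := hτ (Nat.le_succ b)
    have hξm : Measurable (ξ b) := (hξ b).mono (𝓕.le _) le_rfl
    obtain ⟨C, hC⟩ := hb b
    have hξp : MemLp (ξ b) ∞ P := memLp_top_of_bound hξm.aestronglyMeasurable C
      (Eventually.of_forall hC)
    have hξ2 : MemLp (ξ b) 2 P := hξp.mono_exponent le_top
    have hD2 : MemLp (fun ω => X (τ (b + 1)) ω - X (τ b) ω) 2 P := hX.memLp hle (by simp)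
    have hprod : MemLp (fun ω => ξ b ω * (X (τ (b + 1)) ω - X (τ b) ω)) 2 P :=
      hD2.mul hξp
    simp only [Finset.sum_Ico_succ_top hab]
    set M : Ω → ℝ := fun ω => ∑ q ∈ Finset.Ico a b, ξ q ω * (X (τ (q + 1)) ω - X (τ q) ω)
      with hM
    refine ⟨?_, ih2.add hprod, ?_⟩
    · refine (ih1.mono (𝓕.mono hle) le_rfl).add ?_
      exact ((hξ b).mono (𝓕.mono hle) le_rfl).mul
        ((hX.adapted _).sub ((hX.adapted _).mono (𝓕.mono hle) le_rfl))
    -- The cross term vanishes, as the last increment is centred and independent of the past.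
    · have hcross : ∫ ω, (M ω * ξ b ω) * (X (τ (b + 1)) ω - X (τ b) ω) ∂P = 0 := by
        have := (hX.indepFun hle (ih1.mul (hξ b))).integral_fun_mul_eq_mul_integral
          (ih2.1.mul hξ2.1) hD2.1
        rw [hX.integral_sub hle, mul_zero] at this
        exact this
      have hsq : ∫ ω, ξ b ω ^ 2 * (X (τ (b + 1)) ω - X (τ b) ω) ^ 2 ∂P =
          c * ((τ (b + 1) : ℝ) - τ b) * ∫ ω, ξ b ω ^ 2 ∂P := by
        have hi : IndepFun (fun ω => ξ b ω ^ 2) (fun ω => (X (τ (b + 1)) ω - X (τ b) ω) ^ 2) P :=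
          (hX.indepFun hle (hξ b)).comp (φ := fun x => x ^ 2) (ψ := fun x => x ^ 2)
            (by fun_prop) (by fun_prop)
        rw [hi.integral_fun_mul_eq_mul_integral (hξ2.1.pow 2) (hD2.1.pow 2),
          hX.integral_sub_sq hle, mul_comm]
      have hexp : ∀ ω, (M ω + ξ b ω * (X (τ (b + 1)) ω - X (τ b) ω)) ^ 2 =
          (M ω ^ 2 + 2 * ((M ω * ξ b ω) * (X (τ (b + 1)) ω - X (τ b) ω))) +
            ξ b ω ^ 2 * (X (τ (b + 1)) ω - X (τ b) ω) ^ 2 := fun ω => by ring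
      have hc1 : Integrable (fun ω => (M ω * ξ b ω) * (X (τ (b + 1)) ω - X (τ b) ω)) P := by
        have := ih2.integrable_mul hprod
        refine this.congr (Eventually.of_forall fun ω => ?_)
        simp [mul_assoc]
      have hc2 : Integrable (fun ω => ξ b ω ^ 2 * (X (τ (b + 1)) ω - X (τ b) ω) ^ 2) P := by
        refine hprod.integrable_sq.congr (Eventually.of_forall fun ω => ?_)
        simp [mul_pow]
      simp_rw [show ∀ ω, ∑ q ∈ Finset.Ico a b, ξ q ω * (X (τ (q + 1)) ω - X (τ q) ω) = M ω
        from fun _ => rfl, hexp]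
      have e1 := integral_add (ih2.integrable_sq.add (hc1.const_mul 2)) hc2
      have e2 := integral_add ih2.integrable_sq (hc1.const_mul 2)
      simp only [Pi.add_apply] at e1
      rw [e1, e2, integral_const_mul, hcross, hsq, ih3]
      ring

end ScaledBM

/-! ### A Lenglart-type inequality for elementary integrals -/

section Truncation

variable {Ω : Type*} [mΩ : MeasurableSpace Ω] {P : Measure Ω} {𝓕 : Filtration ℝ≥0 mΩ}
  {X : ℝ≥0 → Ω → ℝ} {c : ℝ≥0}

/-- A sum of nonnegative terms in which every term is dropped once the running sum exceeds `δ` is at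
most `δ`. -/
theorem sum_range_ite_le {u : ℕ → ℝ} (hu : ∀ q, 0 ≤ u q) {δ : ℝ} (hδ : 0 ≤ δ) (m : ℕ) :
    ∑ q ∈ Finset.range m, (if ∑ p ∈ Finset.range (q + 1), u p ≤ δ then u q else 0) ≤ δ := by
  induction m with
  | zero => simpa
  | succ m ih =>
    rw [Finset.sum_range_succ]
    split_ifs with h
    · rw [Finset.sum_range_succ] at h
      refine le_trans (add_le_add_left (Finset.sum_le_sum fun q _ => ?_) _) h
      split_ifs
      exacts [le_rfl, hu q]
    · simpa using ih

theorem sum_Ico_groups {g : ℕ → ℕ} (hg : Monotone g) (K : ℕ) (f : ℕ → ℝ) :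
    ∑ k ∈ Finset.range K, ∑ q ∈ Finset.Ico (g k) (g (k + 1)), f q =
      ∑ q ∈ Finset.Ico (g 0) (g K), f q := by
  induction K with
  | zero => simp
  | succ K ih =>
    rw [Finset.sum_range_succ, ih, Finset.sum_Ico_consecutive _ (hg (Nat.zero_le K))
      (hg (Nat.le_succ K))]

/-- The second moment of an elementary integral and of the sum of the squares of its pieces over
consecutive groups of intervals. -/
theorem IsScaledBM.integral_groups [IsProbabilityMeasure P] (hX : IsScaledBM P 𝓕 X c)
    {τ : ℕ → ℝ≥0} (hτ : Monotone τ) {ξ : ℕ → Ω → ℝ} (hξ : ∀ q, Measurable[𝓕 (τ q)] (ξ q))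
    (hb : ∀ q, ∃ C, ∀ ω, |ξ q ω| ≤ C) {g : ℕ → ℕ} (hg : Monotone g) (K : ℕ) :
    Integrable (fun ω => ∑ k ∈ Finset.range K, (∑ q ∈ Finset.Ico (g k) (g (k + 1)),
        ξ q ω * (X (τ (q + 1)) ω - X (τ q) ω)) ^ 2 +
        (∑ q ∈ Finset.Ico (g 0) (g K), ξ q ω * (X (τ (q + 1)) ω - X (τ q) ω)) ^ 2) P ∧
    ∫ ω, (∑ k ∈ Finset.range K, (∑ q ∈ Finset.Ico (g k) (g (k + 1)),
        ξ q ω * (X (τ (q + 1)) ω - X (τ q) ω)) ^ 2 +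
        (∑ q ∈ Finset.Ico (g 0) (g K), ξ q ω * (X (τ (q + 1)) ω - X (τ q) ω)) ^ 2) ∂P =
      2 * c * ∫ ω, ∑ q ∈ Finset.Ico (g 0) (g K), ξ q ω ^ 2 * ((τ (q + 1) : ℝ) - τ q) ∂P := by
  have key := fun a b (hab : a ≤ b) => hX.isometry hτ hξ hb hab
  have i1 : ∀ k ∈ Finset.range K, Integrable (fun ω => (∑ q ∈ Finset.Ico (g k) (g (k + 1)),
      ξ q ω * (X (τ (q + 1)) ω - X (τ q) ω)) ^ 2) P := fun k _ =>
    (key _ _ (hg (Nat.le_succ k))).2.1.integrable_sq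
  have h0 := key _ _ (hg (Nat.zero_le K))
  refine ⟨(integrable_finsetSum _ i1).add h0.2.1.integrable_sq, ?_⟩
  rw [integral_add (integrable_finsetSum _ i1) h0.2.1.integrable_sq, integral_finsetSum _ i1,
    h0.2.2, Finset.sum_congr rfl fun k _ => (key _ _ (hg (Nat.le_succ k))).2.2, sum_Ico_groups hg,
    integral_finsetSum]
  · simp_rw [integral_mul_const]
    rw [← two_mul, mul_assoc, Finset.mul_sum (s := Finset.Ico _ _) (a := (c : ℝ))]
    congr 1
    exact Finset.sum_congr rfl fun q _ => by ring
  · intro q _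
    obtain ⟨C, hC⟩ := hb q
    have : MemLp (ξ q) ∞ P := memLp_top_of_bound
      ((hξ q).mono (𝓕.le _) le_rfl).aestronglyMeasurable C (Eventually.of_forall hC)
    exact ((this.mono_exponent le_top : MemLp (ξ q) 2 P).integrable_sq).mul_const _

/-- Lenglart-type inequality: an elementary integral, and the sum of the squares of its pieces over
consecutive groups of intervals, are small in probability if `∑ ξ² Δτ` is. The integrand need not be
bounded; the proof stops it when `∑ ξ² Δτ` exceeds `δ`. -/
theorem IsScaledBM.measure_groups_le [IsProbabilityMeasure P] (hX : IsScaledBM P 𝓕 X c)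
    {τ : ℕ → ℝ≥0} (hτ : Monotone τ) {ξ : ℕ → Ω → ℝ} {g : ℕ → ℕ} (hg : Monotone g) (hg0 : g 0 = 0)
    (K : ℕ) (hξ : ∀ q < g K, τ q < τ (q + 1) → Measurable[𝓕 (τ q)] (ξ q))
    {ε δ : ℝ} (hε : 0 < ε) (hδ : 0 ≤ δ) :
    P {ω | ε ≤ ∑ k ∈ Finset.range K, (∑ q ∈ Finset.Ico (g k) (g (k + 1)),
        ξ q ω * (X (τ (q + 1)) ω - X (τ q) ω)) ^ 2 +
        (∑ q ∈ Finset.range (g K), ξ q ω * (X (τ (q + 1)) ω - X (τ q) ω)) ^ 2} ≤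
      P {ω | δ < ∑ q ∈ Finset.range (g K), ξ q ω ^ 2 * ((τ (q + 1) : ℝ) - τ q)} +
        ENNReal.ofReal (2 * c * δ / ε) := by
  classical
  -- Off the nondegenerate intervals `ξ` need not be measurable. Its values there do not matter.
  set ζ : ℕ → Ω → ℝ := fun q => if q < g K ∧ τ q < τ (q + 1) then ξ q else 0 with hζ
  have hτ' : ∀ q, 0 ≤ (τ (q + 1) : ℝ) - τ q := fun q =>
    sub_nonneg.2 (NNReal.coe_le_coe.2 (hτ (Nat.le_succ q)))
  have hζm : ∀ q, Measurable[𝓕 (τ q)] (ζ q) := by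
    intro q
    by_cases h : q < g K ∧ τ q < τ (q + 1)
    · simpa [hζ, h] using hξ q h.1 h.2
    · simp only [hζ, h, if_false]
      exact measurable_const
  have hζX : ∀ q < g K, ∀ ω, ξ q ω * (X (τ (q + 1)) ω - X (τ q) ω) =
      ζ q ω * (X (τ (q + 1)) ω - X (τ q) ω) := by
    intro q hq ω
    by_cases h : τ q < τ (q + 1)
    · simp [hζ, hq, h]
    · have : τ (q + 1) = τ q := le_antisymm (not_lt.1 h) (hτ (Nat.le_succ q))
      simp [this]
  have hζτ : ∀ q < g K, ∀ ω, ξ q ω ^ 2 * ((τ (q + 1) : ℝ) - τ q) =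
      ζ q ω ^ 2 * ((τ (q + 1) : ℝ) - τ q) := by
    intro q hq ω
    by_cases h : τ q < τ (q + 1)
    · simp [hζ, hq, h]
    · have : τ (q + 1) = τ q := le_antisymm (not_lt.1 h) (hτ (Nat.le_succ q))
      simp [this]
  set u : ℕ → Ω → ℝ := fun q ω => ζ q ω ^ 2 * ((τ (q + 1) : ℝ) - τ q) with hu
  have hu0 : ∀ q ω, 0 ≤ u q ω := fun q ω => mul_nonneg (sq_nonneg _) (hτ' q)
  -- The stopped integrand. The running sum up to and including `q` is known at time `τ q`, and the
  -- bound on it bounds `ζ q` as well.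
  set θ : ℕ → Ω → ℝ := fun q ω =>
    if ∑ p ∈ Finset.range (q + 1), u p ω ≤ δ then ζ q ω else 0 with hθ
  have hAm : ∀ q, Measurable[𝓕 (τ q)] (fun ω => ∑ p ∈ Finset.range (q + 1), u p ω) := fun q =>
    Finset.measurable_sum _ fun p hp =>
      ((((hζm p).mono (𝓕.mono (hτ (Nat.lt_succ_iff.1 (Finset.mem_range.1 hp)))) le_rfl).pow_const
        2).mul_const _)
  have hθm : ∀ q, Measurable[𝓕 (τ q)] (θ q) := fun q =>
    Measurable.ite (measurableSet_le (hAm q) measurable_const) (hζm q) measurable_const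
  have hθb : ∀ q, ∃ C, ∀ ω, |θ q ω| ≤ C := by
    intro q
    by_cases h : q < g K ∧ τ q < τ (q + 1)
    · have hpos : 0 < (τ (q + 1) : ℝ) - τ q := sub_pos.2 (NNReal.coe_lt_coe.2 h.2)
      refine ⟨√(δ / ((τ (q + 1) : ℝ) - τ q)), fun ω => ?_⟩
      simp only [hθ]
      split_ifs with hle
      · apply Real.abs_le_sqrt
        rw [le_div_iff₀ hpos]
        refine le_trans ?_ hle
        exact Finset.single_le_sum (f := fun p => u p ω) (fun p _ => hu0 p ω)
          (Finset.self_mem_range_succ q)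
      · simp
    · exact ⟨0, fun ω => by simp [hθ, hζ, h]⟩
  obtain ⟨hint, heq⟩ := hX.integral_groups hτ hθm hθb hg K
  rw [hg0, ← Finset.range_eq_Ico] at hint heq
  have hθu : ∀ ω, ∑ q ∈ Finset.range (g K), θ q ω ^ 2 * ((τ (q + 1) : ℝ) - τ q) ≤ δ := by
    intro ω
    refine le_trans (le_of_eq (Finset.sum_congr rfl fun q _ => ?_))
      (sum_range_ite_le (fun q => hu0 q ω) hδ (g K))
    simp only [hθ, hu]
    split_ifs <;> simp
  have hle : ∫ ω, ∑ q ∈ Finset.range (g K), θ q ω ^ 2 * ((τ (q + 1) : ℝ) - τ q) ∂P ≤ δ := by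
    have h1 := integral_mono_of_nonneg (μ := P) (g := fun _ => δ)
      (Eventually.of_forall fun ω => Finset.sum_nonneg fun q _ =>
        mul_nonneg (sq_nonneg (θ q ω)) (hτ' q)) (integrable_const δ) (Eventually.of_forall hθu)
    simpa using h1
  set Q : Ω → ℝ := fun ω => ∑ k ∈ Finset.range K, (∑ q ∈ Finset.Ico (g k) (g (k + 1)),
        θ q ω * (X (τ (q + 1)) ω - X (τ q) ω)) ^ 2 +
        (∑ q ∈ Finset.range (g K), θ q ω * (X (τ (q + 1)) ω - X (τ q) ω)) ^ 2 with hQ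
  have hmarkov := mul_meas_ge_le_integral_of_nonneg (μ := P) (f := Q)
    (Eventually.of_forall fun ω => by positivity) hint ε
  have hQle : P {ω | ε ≤ Q ω} ≤ ENNReal.ofReal (2 * c * δ / ε) := by
    rw [← ofReal_measureReal (μ := P)]
    refine ENNReal.ofReal_le_ofReal ?_
    rw [le_div_iff₀ hε, mul_comm]
    refine hmarkov.trans (heq.le.trans ?_)
    exact mul_le_mul_of_nonneg_left hle (by positivity)
  refine le_trans (measure_mono ?_) ((measure_union_le _ _).trans (add_le_add_right hQle _))
  intro ω hω
  by_cases h : δ < ∑ q ∈ Finset.range (g K), ξ q ω ^ 2 * ((τ (q + 1) : ℝ) - τ q)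
  · exact Or.inl h
  · right
    rw [not_lt, Finset.sum_congr rfl fun q hq => hζτ q (Finset.mem_range.1 hq) ω] at h
    -- Outside the exceptional event nothing is stopped.
    have hθζ : ∀ q < g K, θ q ω = ζ q ω := by
      intro q hq
      refine if_pos (le_trans ?_ h)
      exact Finset.sum_le_sum_of_subset_of_nonneg (Finset.range_subset_range.2 hq)
        fun p _ _ => hu0 p ω
    have hX' : ∀ q < g K, ξ q ω * (X (τ (q + 1)) ω - X (τ q) ω) =
        θ q ω * (X (τ (q + 1)) ω - X (τ q) ω) := fun q hq => by
      rw [hθζ q hq, hζX q hq]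
    simp only [Set.mem_ofPred_eq] at hω ⊢
    refine hω.trans (le_of_eq ?_)
    simp only [hQ]
    congr 1
    · refine Finset.sum_congr rfl fun k hk => ?_
      rw [Finset.sum_congr rfl fun q hq => hX' q ((Finset.mem_Ico.1 hq).2.trans_le
        (hg (Finset.mem_range.1 hk)))]
    · rw [Finset.sum_congr rfl fun q hq => hX' q (Finset.mem_range.1 hq)]

end Truncation

/-! ### Quadratic variation and correlations -/

section QuadraticVariation

variable {Ω : Type*} [mΩ : MeasurableSpace Ω] {P : Measure Ω} {𝓕 : Filtration ℝ≥0 mΩ}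
  {X : ℝ≥0 → Ω → ℝ} {c : ℝ≥0}

/-- The `k`-th point of the partition of `[0, T]` into `K` intervals of equal length. For `K = 0` all
points are `0`. -/
noncomputable def uniformGrid (T : ℝ≥0) (K k : ℕ) : ℝ≥0 := k * T / K

theorem uniformGrid_mono (T : ℝ≥0) (K : ℕ) : Monotone (uniformGrid T K) := fun a b hab => by
  unfold uniformGrid
  gcongr

@[simp] theorem uniformGrid_zero (T : ℝ≥0) (K : ℕ) : uniformGrid T K 0 = 0 := by
  simp [uniformGrid]

theorem uniformGrid_self (T : ℝ≥0) {K : ℕ} (hK : K ≠ 0) : uniformGrid T K K = T := by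
  have : (K : ℝ≥0) ≠ 0 := Nat.cast_ne_zero.2 hK
  simp [uniformGrid, this]

theorem uniformGrid_succ_sub (T : ℝ≥0) (K k : ℕ) :
    (uniformGrid T K (k + 1) : ℝ) - uniformGrid T K k = T / K := by
  simp only [uniformGrid]
  push_cast
  ring

theorem uniformGrid_le (T : ℝ≥0) {K k : ℕ} (hk : k ≤ K) : uniformGrid T K k ≤ T := by
  rcases eq_or_ne K 0 with rfl | hK
  · simp [uniformGrid]
  · exact (uniformGrid_mono T K hk).trans_eq (uniformGrid_self T hK)

theorem uniformGrid_mul (T : ℝ≥0) (K k : ℕ) {L : ℕ} (hL : L ≠ 0) :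
    uniformGrid T (K * L) (k * L) = uniformGrid T K k := by
  have : (L : ℝ≥0) ≠ 0 := Nat.cast_ne_zero.2 hL
  simp only [uniformGrid]
  push_cast
  rw [mul_right_comm, mul_div_mul_right _ _ this]

/-- Gaussian scaling of the fourth moment. -/
theorem integral_pow_four_gaussianReal (v : ℝ≥0) :
    ∫ x, x ^ 4 ∂(gaussianReal 0 v) = v ^ 2 * ∫ x, x ^ 4 ∂(gaussianReal 0 1) := by
  have h := gaussianReal_map_const_mul (μ := 0) (v := 1) (√v)
  have h2 : NNReal.mk (√(v : ℝ) ^ 2) (sq_nonneg _) * 1 = v := by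
    apply NNReal.coe_injective
    simp
  have h3 : (gaussianReal 0 1).map (fun x => √v * x) = gaussianReal 0 v := by
    rw [h, mul_zero]
    congr 1
  rw [← h3, integral_map (by fun_prop) (by fun_prop), ← integral_const_mul]
  congr 1 with x
  rw [mul_pow, show √(v : ℝ) ^ 4 = (√(v : ℝ) ^ 2) ^ 2 by ring, Real.sq_sqrt v.coe_nonneg]

theorem IsScaledBM.variance_sub_sq_le [IsProbabilityMeasure P] (hX : IsScaledBM P 𝓕 X c)
    {s t : ℝ≥0} (hst : s ≤ t) :
    Var[fun ω => (X t ω - X s ω) ^ 2; P] ≤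
      (c * ((t : ℝ) - s)) ^ 2 * ∫ x, x ^ 4 ∂(gaussianReal 0 1) := by
  have hm : Measurable (fun ω => X t ω - X s ω) := (hX.measurable t).sub (hX.measurable s)
  refine (variance_le_expectation_sq (hm.pow_const 2).aestronglyMeasurable).trans (le_of_eq ?_)
  have h := integral_map (μ := P) (φ := fun ω => X t ω - X s ω) (f := fun x : ℝ => x ^ 4)
    hm.aemeasurable (by fun_prop)
  rw [hX.law s t hst, integral_pow_four_gaussianReal, NNReal.coe_mul, NNReal.coe_sub hst] at h
  rw [h]
  congr 1 with ω
  simp only [Pi.pow_apply]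
  ring

/-- Along uniform partitions of `[0, T]` the quadratic variation converges to `c T`. -/
theorem IsScaledBM.tendstoInMeasure_quadraticVariation [IsProbabilityMeasure P]
    (hX : IsScaledBM P 𝓕 X c) (T : ℝ≥0) :
    TendstoInMeasure P (fun K ω => ∑ k ∈ Finset.range K,
      (X (uniformGrid T K (k + 1)) ω - X (uniformGrid T K k) ω) ^ 2) atTop (fun _ => (c : ℝ) * T) := by
  rw [tendstoInMeasure_iff_norm]
  intro ε hε
  set C := ∫ x, x ^ 4 ∂(gaussianReal 0 1) with hC
  have hlim : Tendsto (fun K : ℕ => ENNReal.ofReal ((c * T) ^ 2 * C / ε ^ 2 * (K : ℝ)⁻¹)) atTop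
      (𝓝 0) := by
    have h := (tendsto_inv_atTop_zero.comp (tendsto_natCast_atTop_atTop (R := ℝ))).const_mul
      (((c : ℝ) * T) ^ 2 * C / ε ^ 2)
    rw [mul_zero] at h
    simpa using ENNReal.tendsto_ofReal h
  refine tendsto_of_tendsto_of_tendsto_of_le_of_le' tendsto_const_nhds hlim
    (Eventually.of_forall fun _ => zero_le) ?_
  filter_upwards [eventually_ne_atTop 0] with K hK
  have hK' : (K : ℝ) ≠ 0 := Nat.cast_ne_zero.2 hK
  set D : ℕ → Ω → ℝ := fun k ω =>
    (X (uniformGrid T K (k + 1)) ω - X (uniformGrid T K k) ω) ^ 2 with hD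
  have hle : ∀ k, uniformGrid T K k ≤ uniformGrid T K (k + 1) := fun k =>
    uniformGrid_mono T K (Nat.le_succ k)
  have hD2 : ∀ k, MemLp (D k) 2 P := by
    intro k
    have h4 : MemLp (fun ω => X (uniformGrid T K (k + 1)) ω - X (uniformGrid T K k) ω) 4 P :=
      hX.memLp (hle k) (by simp)
    have : ENNReal.HolderTriple 4 4 2 := ⟨by
      rw [← two_mul, show (4 : ℝ≥0∞) = 2 * 2 by norm_num, ENNReal.mul_inv (by simp) (by simp),
        ← mul_assoc, ENNReal.mul_inv_cancel (by simp) (by simp), one_mul]⟩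
    have := h4.mul h4 (r := 2)
    refine this.ae_eq (Eventually.of_forall fun ω => ?_)
    simp [hD, sq]
  have hindep : Set.Pairwise (↑(Finset.range K)) fun i j => IndepFun (D i) (D j) P := by
    have key : ∀ i j, i < j → IndepFun (D i) (D j) P := by
      intro i j hij
      have hDi : Measurable[𝓕 (uniformGrid T K j)] (D i) :=
        (((hX.adapted _).mono (𝓕.mono (uniformGrid_mono T K hij)) le_rfl).sub
          ((hX.adapted _).mono (𝓕.mono (uniformGrid_mono T K hij.le)) le_rfl)).pow_const 2
      exact (hX.indepFun (hle j) hDi).comp (φ := fun x => x) (ψ := fun x => x ^ 2)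
        (by fun_prop) (by fun_prop)
    intro i _ j _ hij
    rcases lt_or_gt_of_ne hij with h | h
    · exact key i j h
    · exact (key j i h).symm
  have hvar : Var[∑ k ∈ Finset.range K, D k; P] ≤ (c * T) ^ 2 * C * (K : ℝ)⁻¹ := by
    rw [IndepFun.variance_sum (fun k _ => hD2 k) hindep]
    refine (Finset.sum_le_sum fun k _ => hX.variance_sub_sq_le (hle k)).trans (le_of_eq ?_)
    simp only [uniformGrid_succ_sub, Finset.sum_const, Finset.card_range, nsmul_eq_mul]
    rw [← hC]
    field_simp
  have hmean : ∫ ω, (∑ k ∈ Finset.range K, D k) ω ∂P = c * T := by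
    simp only [Finset.sum_apply]
    rw [integral_finsetSum _ fun k _ => (hD2 k).integrable one_le_two,
      Finset.sum_congr rfl fun k _ => hX.integral_sub_sq (hle k)]
    simp only [uniformGrid_succ_sub, Finset.sum_const, Finset.card_range, nsmul_eq_mul]
    field_simp
  have hcheb := meas_ge_le_variance_div_sq (memLp_finsetSum' (Finset.range K) fun k _ => hD2 k) hε
  rw [hmean] at hcheb
  simp only [Finset.sum_apply] at hcheb
  refine hcheb.trans (ENNReal.ofReal_le_ofReal ?_)
  rw [div_mul_eq_mul_div]
  gcongr

/-- The uniform partition of `[0, t]` into `m + 1` intervals. -/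
noncomputable def uniformPartition (t : ℝ≥0) (m : ℕ) : TimePartition t where
  num := m + 1
  pt := uniformGrid t (m + 1)
  pt_mono := uniformGrid_mono t (m + 1)
  pt_zero := uniformGrid_zero t (m + 1)
  pt_num := uniformGrid_self t (Nat.succ_ne_zero m)

theorem tendsto_mesh_uniformPartition (t : ℝ≥0) :
    Tendsto (fun m => (uniformPartition t m).mesh) atTop (𝓝 0) := by
  have hlim : Tendsto (fun m : ℕ => t * ((m : ℝ≥0) + 1)⁻¹) atTop (𝓝 0) := by
    have h : Tendsto (fun m : ℕ => ((m : ℝ≥0) + 1)⁻¹) atTop (𝓝 0) := by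
      simpa using tendsto_one_div_add_atTop_nhds_zero_nat (𝕜 := ℝ≥0)
    simpa using h.const_mul t
  refine tendsto_of_tendsto_of_tendsto_of_le_of_le tendsto_const_nhds hlim
    (fun _ => zero_le) fun m => ?_
  refine Finset.sup_le fun k _ => ?_
  change uniformGrid t (m + 1) (k + 1) - uniformGrid t (m + 1) k ≤ _
  rw [tsub_le_iff_right]
  simp only [uniformGrid]
  push_cast
  apply le_of_eq
  ring

/-- The covariation rate of two linear combinations of the components of a Brownian motion is the
scalar product of the coefficients, by polarization. -/
theorem LPPricing.HasCovariationRate.eq_sum [IsProbabilityMeasure P] {d : ℕ}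
    {B : Fin d → ℝ≥0 → Ω → ℝ} (hB : IsStandardBrownianMotion P 𝓕 B) {a b : Fin d → ℝ} {ρ : ℝ}
    (h : HasCovariationRate P (fun t ω => ∑ j, a j * B j t ω) (fun t ω => ∑ j, b j * B j t ω) ρ) :
    ρ = ∑ j, a j * b j := by
  have qv : ∀ e : Fin d → ℝ, TendstoInMeasure P (fun m ω => ∑ k ∈ Finset.range (m + 1),
      (∑ j, e j * B j (uniformGrid 1 (m + 1) (k + 1)) ω -
        ∑ j, e j * B j (uniformGrid 1 (m + 1) k) ω) ^ 2) atTop (fun _ => ∑ j, e j ^ 2) := by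
    intro e
    have hc : ((∑ j, e j ^ 2).toNNReal : ℝ) = ∑ j, e j ^ 2 :=
      Real.coe_toNNReal _ (Finset.sum_nonneg fun j _ => sq_nonneg _)
    have := ((hB.isScaledBM e _ hc).tendstoInMeasure_quadraticVariation 1).comp
      (tendsto_add_atTop_nat 1)
    simpa [hc] using! this
  -- Along a common subsequence, `x y = ((x + y)² - (x - y)²) / 4` is summed over the intervals.
  obtain ⟨n1, h1, l1⟩ := (h 1 (uniformPartition 1)
    (tendsto_mesh_uniformPartition 1)).exists_seq_tendsto_ae
  obtain ⟨n2, h2, l2⟩ := ((qv (fun j => a j + b j)).comp h1.tendsto_atTop).exists_seq_tendsto_ae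
  obtain ⟨n3, h3, l3⟩ := ((qv (fun j => a j - b j)).comp
    (h1.tendsto_atTop.comp h2.tendsto_atTop)).exists_seq_tendsto_ae
  obtain ⟨ω, e1, e2, e3⟩ := (l1.and (l2.and l3)).exists
  have e1' := e1.comp (h2.tendsto_atTop.comp h3.tendsto_atTop)
  have e2' := e2.comp h3.tendsto_atTop
  have e4 := (e2'.sub e3).div_const 4
  have := tendsto_nhds_unique e1' (e4.congr fun m => ?_)
  · simp only [NNReal.coe_one, mul_one] at this
    rw [this, ← Finset.sum_sub_distrib, Finset.sum_div]
    exact Finset.sum_congr rfl fun j _ => by ring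
  · simp only [Function.comp]
    rw [← Finset.sum_sub_distrib, Finset.sum_div]
    refine Finset.sum_congr rfl fun k _ => ?_
    simp only [uniformPartition, add_mul, sub_mul, Finset.sum_add_distrib, Finset.sum_sub_distrib]
    ring

end QuadraticVariation

/-! ### The pathwise formula for the logarithm -/

section LogPath

/-- A perturbation with vanishing sum of squares does not change the limit of a sum of squares. -/
theorem tendsto_sum_sq_add {N : ℕ → ℕ} {u v : ℕ → ℕ → ℝ} {C : ℝ}
    (hu : Tendsto (fun m => ∑ k ∈ Finset.range (N m), u m k ^ 2) atTop (𝓝 C))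
    (hv : Tendsto (fun m => ∑ k ∈ Finset.range (N m), v m k ^ 2) atTop (𝓝 0)) :
    Tendsto (fun m => ∑ k ∈ Finset.range (N m), (u m k + v m k) ^ 2) atTop (𝓝 C) := by
  have hcross : Tendsto (fun m => ∑ k ∈ Finset.range (N m), u m k * v m k) atTop (𝓝 0) := by
    have h := (hu.mul hv).sqrt
    rw [mul_zero, Real.sqrt_zero] at h
    refine squeeze_zero_norm (fun m => ?_) h
    rw [Real.norm_eq_abs]
    exact Real.abs_le_sqrt (Finset.sum_mul_sq_le_sq_mul_sq _ _ _)
  have h := (hu.add (hcross.const_mul 2)).add hv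
  rw [mul_zero, add_zero, add_zero] at h
  refine h.congr fun m => ?_
  rw [Finset.mul_sum, ← Finset.sum_add_distrib, ← Finset.sum_add_distrib]
  exact Finset.sum_congr rfl fun k _ => by ring

theorem abs_log_one_add_sub_le {a : ℝ} (ha : |a| ≤ 1 / 2) :
    |Real.log (1 + a) - a + a ^ 2 / 2| ≤ 2 * |a| ^ 3 := by
  have h := Real.abs_log_sub_add_sum_range_le (x := -a) (by rw [abs_neg]; linarith) 2
  simp only [Finset.sum_range_succ, Finset.sum_range_zero, sub_neg_eq_add, abs_neg] at h
  have e : Real.log (1 + a) - a + a ^ 2 / 2 =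
      0 + (-a) ^ (0 + 1) / ((0 : ℕ) + 1) + (-a) ^ (1 + 1) / ((1 : ℕ) + 1) + Real.log (1 + a) := by
    push_cast
    ring
  rw [e]
  refine h.trans ?_
  rw [div_le_iff₀ (by linarith)]
  have h0 : 0 ≤ |a| ^ 3 * (1 - 2 * |a|) := mul_nonneg (by positivity) (by linarith)
  calc |a| ^ (2 + 1) = |a| ^ 3 := by norm_num
    _ ≤ |a| ^ 3 + |a| ^ 3 * (1 - 2 * |a|) := le_add_of_nonneg_right h0
    _ = 2 * |a| ^ 3 * (1 - |a|) := by ring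

/-- A second-order expansion of the logarithm, summed over ever finer partitions. -/
theorem tendsto_sum_log_one_add {N : ℕ → ℕ} {a : ℕ → ℕ → ℝ} {A C : ℝ}
    (hmax : ∀ η > 0, ∀ᶠ m in atTop, ∀ k < N m, |a m k| ≤ η)
    (h1 : Tendsto (fun m => ∑ k ∈ Finset.range (N m), a m k) atTop (𝓝 A))
    (h2 : Tendsto (fun m => ∑ k ∈ Finset.range (N m), a m k ^ 2) atTop (𝓝 C)) :
    Tendsto (fun m => ∑ k ∈ Finset.range (N m), Real.log (1 + a m k)) atTop (𝓝 (A - C / 2)) := by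
  have herr : Tendsto (fun m => ∑ k ∈ Finset.range (N m),
      (Real.log (1 + a m k) - a m k + a m k ^ 2 / 2)) atTop (𝓝 0) := by
    rw [Metric.tendsto_atTop']
    have hC : ∀ᶠ m in atTop, ∑ k ∈ Finset.range (N m), a m k ^ 2 < |C| + 1 :=
      h2.eventually_lt_const (by linarith [le_abs_self C])
    intro ε hε
    have hη : 0 < min (1 / 2) (ε / (2 * (|C| + 1)) / 2) := by positivity
    obtain ⟨m₀, hm₀⟩ := eventually_atTop.1 (hC.and (hmax _ hη))
    refine ⟨m₀, fun m hm => ?_⟩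
    obtain ⟨hCm, hmm⟩ := hm₀ m hm.le
    rw [dist_zero_right, Real.norm_eq_abs]
    calc |∑ k ∈ Finset.range (N m), (Real.log (1 + a m k) - a m k + a m k ^ 2 / 2)|
        ≤ ∑ k ∈ Finset.range (N m), |Real.log (1 + a m k) - a m k + a m k ^ 2 / 2| :=
          Finset.abs_sum_le_sum_abs _ _
      _ ≤ ∑ k ∈ Finset.range (N m), ε / (2 * (|C| + 1)) * a m k ^ 2 := by
          refine Finset.sum_le_sum fun k hk => ?_
          have hk' := hmm k (Finset.mem_range.1 hk)
          refine (abs_log_one_add_sub_le (hk'.trans (min_le_left _ _))).trans ?_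
          have := hk'.trans (min_le_right _ _)
          rw [← sq_abs (a m k)]
          have h0 := sq_nonneg |a m k|
          calc 2 * |a m k| ^ 3 = 2 * |a m k| * |a m k| ^ 2 := by ring
            _ ≤ ε / (2 * (|C| + 1)) * |a m k| ^ 2 := by
              apply mul_le_mul_of_nonneg_right _ h0
              linarith
      _ = ε / (2 * (|C| + 1)) * ∑ k ∈ Finset.range (N m), a m k ^ 2 := by
          rw [Finset.mul_sum]
      _ ≤ ε / (2 * (|C| + 1)) * (|C| + 1) := by
          apply mul_le_mul_of_nonneg_left hCm.le (by positivity)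
      _ < ε := by
          have : (0 : ℝ) < |C| + 1 := by positivity
          field_simp
          linarith
  have h := (herr.add h1).sub (h2.div_const 2)
  rw [zero_add] at h
  refine h.congr fun m => ?_
  rw [← Finset.sum_add_distrib, Finset.sum_div, ← Finset.sum_sub_distrib]
  exact Finset.sum_congr rfl fun k _ => by ring

/-- A continuous function of two times that vanishes on the diagonal is small near the diagonal. -/
theorem exists_pos_forall_dist_lt {F : ℝ≥0 × ℝ≥0 → ℝ} (hF : Continuous F) (h0 : ∀ u, F (u, u) = 0)
    (T : ℝ≥0) {δ : ℝ} (hδ : 0 < δ) :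
    ∃ h > 0, ∀ u v, u ≤ T → v ≤ T → dist u v < h → |F (u, v)| ≤ δ := by
  have hK : IsCompact (Set.Icc (0 : ℝ≥0) T ×ˢ Set.Icc (0 : ℝ≥0) T) := isCompact_Icc.prod isCompact_Icc
  have hu := hK.uniformContinuousOn_of_continuous hF.continuousOn
  obtain ⟨h, hh, H⟩ := Metric.uniformContinuousOn_iff.1 hu δ hδ
  refine ⟨h, hh, fun u v huT hvT huv => ?_⟩
  have := H (u, v) ⟨⟨zero_le, huT⟩, ⟨zero_le, hvT⟩⟩ (v, v) ⟨⟨zero_le, hvT⟩, ⟨zero_le, hvT⟩⟩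
    (by rw [Prod.dist_eq]; exact max_lt huv (by simpa using hh))
  rw [h0, dist_zero_right, Real.norm_eq_abs] at this
  exact this.le

theorem dist_le_of_mem_Icc_uniformGrid {T : ℝ≥0} {K k : ℕ} {u : ℝ≥0}
    (h1 : uniformGrid T K k ≤ u) (h2 : u ≤ uniformGrid T K (k + 1)) :
    dist u (uniformGrid T K k) ≤ T / K := by
  rw [← uniformGrid_succ_sub T K k]
  have h1' := NNReal.coe_le_coe.2 h1
  have h2' := NNReal.coe_le_coe.2 h2
  rw [NNReal.dist_eq, abs_of_nonneg (sub_nonneg.2 h1')]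
  linarith

/-- The pathwise half of Itô's formula for the logarithm: if along uniform partitions the relative
increments of `s` are `r Δt + Δx` up to errors whose sum and sum of squares vanish, and the quadratic
variation of `x` is `C`, then `log s` grows by `r T + (x T - x 0) - C / 2`. -/
theorem log_sub_log_eq {s x D : ℝ≥0 → ℝ} (hs : Continuous s) (hpos : ∀ t, 0 < s t) {r C : ℝ}
    (T : ℝ≥0) {N : ℕ → ℕ} (hN : Tendsto N atTop atTop)
    (hD : ∀ m k, s (uniformGrid T m k) =
      s 0 + (∫ u in (0 : ℝ)..uniformGrid T m k, r * s u.toNNReal) + D (uniformGrid T m k))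
    (hx : Tendsto (fun m => ∑ k ∈ Finset.range (N m),
      (x (uniformGrid T (N m) (k + 1)) - x (uniformGrid T (N m) k)) ^ 2) atTop (𝓝 C))
    (hR : Tendsto (fun m => ∑ k ∈ Finset.range (N m),
      ((D (uniformGrid T (N m) (k + 1)) - D (uniformGrid T (N m) k)) / s (uniformGrid T (N m) k) -
        (x (uniformGrid T (N m) (k + 1)) - x (uniformGrid T (N m) k))) ^ 2 +
      (∑ k ∈ Finset.range (N m),
      ((D (uniformGrid T (N m) (k + 1)) - D (uniformGrid T (N m) k)) / s (uniformGrid T (N m) k) -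
        (x (uniformGrid T (N m) (k + 1)) - x (uniformGrid T (N m) k)))) ^ 2) atTop (𝓝 0)) :
    Real.log (s T) - Real.log (s 0) = r * T + (x T - x 0) - C / 2 := by
  -- The relative increment `a` of `s` is the sum of the increment `Δ` of `x`, the error `R`, and the
  -- drift `β`.
  set g : ℕ → ℕ → ℝ≥0 := fun m k => uniformGrid T (N m) k with hg
  set Δ : ℕ → ℕ → ℝ := fun m k => x (g m (k + 1)) - x (g m k) with hΔ
  set R : ℕ → ℕ → ℝ := fun m k => (D (g m (k + 1)) - D (g m k)) / s (g m k) - Δ m k with hRdef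
  set a : ℕ → ℕ → ℝ := fun m k => s (g m (k + 1)) / s (g m k) - 1 with ha
  set β : ℕ → ℕ → ℝ := fun m k => a m k - Δ m k - R m k with hβ
  have hgm : ∀ m, Monotone (g m) := fun m => uniformGrid_mono T (N m)
  have hgT : ∀ m k, k ≤ N m → g m k ≤ T := fun m k hk => uniformGrid_le T hk
  have hsc : Continuous fun u : ℝ => s u.toNNReal := hs.comp continuous_real_toNNReal
  have hNR : Tendsto (fun m => (N m : ℝ)) atTop atTop := tendsto_natCast_atTop_atTop.comp hN
  have hmesh : Tendsto (fun m => (T : ℝ) / N m) atTop (𝓝 0) := hNR.const_div_atTop _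
  have hR2 : Tendsto (fun m => ∑ k ∈ Finset.range (N m), R m k ^ 2) atTop (𝓝 0) :=
    squeeze_zero (fun m => Finset.sum_nonneg fun k _ => sq_nonneg _)
      (fun m => le_add_of_nonneg_right (sq_nonneg _)) hR
  have hR1 : Tendsto (fun m => ∑ k ∈ Finset.range (N m), R m k) atTop (𝓝 0) := by
    have h : Tendsto (fun m => (∑ k ∈ Finset.range (N m), R m k) ^ 2) atTop (𝓝 0) :=
      squeeze_zero (fun m => sq_nonneg _)
        (fun m => le_add_of_nonneg_left (Finset.sum_nonneg fun k _ => sq_nonneg _)) hR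
    have h' := h.sqrt
    simp only [Real.sqrt_sq_eq_abs, Real.sqrt_zero] at h'
    exact (tendsto_zero_iff_abs_tendsto_zero _).2 h'
  have hsmall : ∀ δ > 0, ∀ᶠ m in atTop, ∀ k < N m, ∀ u, g m k ≤ u → u ≤ g m (k + 1) →
      |s u / s (g m k) - 1| ≤ δ := by
    intro δ hδ
    obtain ⟨h, hh, H⟩ := exists_pos_forall_dist_lt (F := fun e => s e.1 / s e.2 - 1)
      (by
        have h1 : Continuous fun e : ℝ≥0 × ℝ≥0 => s e.1 := hs.comp continuous_fst
        have h2 : Continuous fun e : ℝ≥0 × ℝ≥0 => s e.2 := hs.comp continuous_snd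
        exact (h1.div h2 fun e => (hpos _).ne').sub continuous_const)
      (fun u => by simp [(hpos u).ne']) T hδ
    filter_upwards [hmesh.eventually_lt_const hh] with m hm k hk u h1 h2
    exact H u (g m k) (h2.trans (hgT m _ hk)) (hgT m _ hk.le)
      ((dist_le_of_mem_Icc_uniformGrid h1 h2).trans_lt hm)
  have hβeq : ∀ m k, β m k =
      ∫ u in (g m k : ℝ)..g m (k + 1), r * (s u.toNNReal / s (g m k)) := by
    intro m k
    have hint : ∀ p q : ℝ, IntervalIntegrable (fun u : ℝ => r * s u.toNNReal) volume p q :=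
      fun p q => (hsc.const_mul r).intervalIntegrable p q
    have e : ∫ u in (g m k : ℝ)..g m (k + 1), r * (s u.toNNReal / s (g m k)) =
        (∫ u in (g m k : ℝ)..g m (k + 1), r * s u.toNNReal) / s (g m k) := by
      rw [← intervalIntegral.integral_div]
      congr 1 with u
      ring
    rw [e, ← intervalIntegral.integral_interval_sub_left (hint 0 _) (hint 0 _)]
    have h1 := hD (N m) k
    have h2 := hD (N m) (k + 1)
    simp only [hβ, hRdef, ha, hg]
    have hne := (hpos (uniformGrid T (N m) k)).ne'
    field_simp
    linarith
  have hβδ : ∀ δ > 0, ∀ᶠ m in atTop, ∀ k < N m, |β m k - r * (T / N m)| ≤ |r| * δ * (T / N m) := by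
    intro δ hδ
    filter_upwards [hsmall δ hδ] with m hm k hk
    have hle : (g m k : ℝ) ≤ g m (k + 1) := NNReal.coe_le_coe.2 (hgm m (Nat.le_succ k))
    have e : r * ((T : ℝ) / N m) = ∫ u in (g m k : ℝ)..g m (k + 1), r := by
      rw [intervalIntegral.integral_const, smul_eq_mul, mul_comm, uniformGrid_succ_sub]
    rw [e, hβeq, ← intervalIntegral.integral_sub
      (((hsc.div_const _).const_mul r).intervalIntegrable _ _) (by simp)]
    have hb := intervalIntegral.norm_integral_le_of_norm_le_const (a := (g m k : ℝ))
      (b := g m (k + 1)) (f := fun u => r * (s u.toNNReal / s (g m k)) - r) (C := |r| * δ) (by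
        intro u hu
        rw [Set.uIoc_of_le hle] at hu
        have hu0 : 0 ≤ u := (NNReal.coe_nonneg _).trans hu.1.le
        have := hm k hk u.toNNReal (by
            rw [← NNReal.coe_le_coe, Real.coe_toNNReal u hu0]; exact hu.1.le) (by
            rw [← NNReal.coe_le_coe, Real.coe_toNNReal u hu0]; exact hu.2)
        rw [Real.norm_eq_abs, show r * (s u.toNNReal / s (g m k)) - r =
          r * (s u.toNNReal / s (g m k) - 1) by ring, abs_mul]
        exact mul_le_mul_of_nonneg_left this (abs_nonneg r))
    rwa [uniformGrid_succ_sub, abs_of_nonneg (a := (T : ℝ) / N m) (by positivity)] at hb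
  have hN0 : ∀ᶠ m in atTop, N m ≠ 0 := hN.eventually_ne_atTop 0
  have hβ1 : Tendsto (fun m => ∑ k ∈ Finset.range (N m), β m k) atTop (𝓝 (r * T)) := by
    rw [Metric.tendsto_atTop']
    intro ε hε
    have hδ : 0 < ε / (2 * (|r| * T + 1)) := by positivity
    obtain ⟨m₀, hm₀⟩ := eventually_atTop.1 ((hβδ _ hδ).and hN0)
    refine ⟨m₀, fun m hm => ?_⟩
    obtain ⟨H, hm0⟩ := hm₀ m hm.le
    have hm0' : (N m : ℝ) ≠ 0 := Nat.cast_ne_zero.2 hm0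
    have e : r * (T : ℝ) = ∑ k ∈ Finset.range (N m), r * (T / N m) := by
      simp only [Finset.sum_const, Finset.card_range, nsmul_eq_mul]
      field_simp
    rw [Real.dist_eq, e, ← Finset.sum_sub_distrib]
    refine (Finset.abs_sum_le_sum_abs _ _).trans_lt ?_
    refine (Finset.sum_le_sum fun k hk => H k (Finset.mem_range.1 hk)).trans_lt ?_
    simp only [Finset.sum_const, Finset.card_range, nsmul_eq_mul]
    have h3 : (N m : ℝ) * (|r| * (ε / (2 * (|r| * T + 1))) * (T / N m)) =
        ε * (|r| * T / (2 * (|r| * T + 1))) := by field_simp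
    rw [h3]
    have h4 : |r| * T / (2 * (|r| * T + 1)) < 1 := by
      rw [div_lt_one (by positivity)]
      have : 0 ≤ |r| * (T : ℝ) := by positivity
      linarith
    nlinarith
  have hβ2 : Tendsto (fun m => ∑ k ∈ Finset.range (N m), β m k ^ 2) atTop (𝓝 0) := by
    have hlim : Tendsto (fun m => (2 * |r|) ^ 2 * T * ((T : ℝ) / N m)) atTop (𝓝 0) := by
      simpa using hmesh.const_mul ((2 * |r|) ^ 2 * (T : ℝ))
    refine tendsto_of_tendsto_of_tendsto_of_le_of_le' tendsto_const_nhds hlim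
      (Eventually.of_forall fun m => Finset.sum_nonneg fun k _ => sq_nonneg _) ?_
    filter_upwards [hβδ 1 one_pos, hN0] with m H hm0
    have hm0' : (N m : ℝ) ≠ 0 := Nat.cast_ne_zero.2 hm0
    have hb : ∀ k ∈ Finset.range (N m), β m k ^ 2 ≤ (2 * |r| * (T / N m)) ^ 2 := by
      intro k hk
      rw [← sq_abs]
      refine pow_le_pow_left₀ (abs_nonneg _) ?_ 2
      have h1 := H k (Finset.mem_range.1 hk)
      have h2 : |r * ((T : ℝ) / N m)| = |r| * (T / N m) := by
        rw [abs_mul, abs_of_nonneg (by positivity : (0 : ℝ) ≤ T / N m)]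
      have h3 := abs_add_le (β m k - r * (T / N m)) (r * (T / N m))
      rw [sub_add_cancel] at h3
      linarith
    refine (Finset.sum_le_sum hb).trans (le_of_eq ?_)
    simp only [Finset.sum_const, Finset.card_range, nsmul_eq_mul]
    field_simp
  have haeq : ∀ m k, a m k = Δ m k + (β m k + R m k) := fun m k => by simp only [hβ]; ring
  have hΔ1 : ∀ᶠ m in atTop, ∑ k ∈ Finset.range (N m), Δ m k = x T - x 0 := by
    filter_upwards [hN0] with m hm
    simp only [hΔ, hg]
    rw [Finset.sum_range_sub (fun k => x (uniformGrid T (N m) k)), uniformGrid_self T hm,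
      uniformGrid_zero]
  have ha1 : Tendsto (fun m => ∑ k ∈ Finset.range (N m), a m k) atTop
      (𝓝 (r * T + (x T - x 0))) := by
    have h : Tendsto (fun m => ∑ k ∈ Finset.range (N m), β m k +
        ∑ k ∈ Finset.range (N m), R m k + (x T - x 0)) atTop (𝓝 (r * T + (x T - x 0))) := by
      simpa using (hβ1.add hR1).add_const (x T - x 0)
    refine h.congr' ?_
    filter_upwards [hΔ1] with m hm
    simp only [haeq, Finset.sum_add_distrib, hm]
    ring
  have ha2 : Tendsto (fun m => ∑ k ∈ Finset.range (N m), a m k ^ 2) atTop (𝓝 C) := by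
    simp only [haeq]
    refine tendsto_sum_sq_add hx ?_
    exact tendsto_sum_sq_add hβ2 hR2
  have hlog := tendsto_sum_log_one_add (fun η hη => by
    filter_upwards [hsmall η hη] with m hm k hk
    exact hm k hk _ (hgm m (Nat.le_succ k)) le_rfl) ha1 ha2
  refine tendsto_nhds_unique (tendsto_const_nhds.congr' ?_) hlog
  filter_upwards [hN0] with m hm
  have e : ∀ k, Real.log (1 + a m k) = Real.log (s (g m (k + 1))) - Real.log (s (g m k)) := by
    intro k
    rw [← Real.log_div (hpos _).ne' (hpos _).ne']
    simp [ha]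
  simp only [e]
  rw [Finset.sum_range_sub (fun k => Real.log (s (g m k)))]
  simp only [hg, uniformGrid_self T hm, uniformGrid_zero]

end LogPath

/-! ### Convergence in probability and continuous paths -/

section InMeasure

variable {Ω : Type*} [mΩ : MeasurableSpace Ω] {P : Measure Ω}

theorem MeasureTheory.TendstoInMeasure.add_real {f f' : ℕ → Ω → ℝ} {g g' : Ω → ℝ}
    (h : TendstoInMeasure P f atTop g) (h' : TendstoInMeasure P f' atTop g') :
    TendstoInMeasure P (fun m ω => f m ω + f' m ω) atTop (fun ω => g ω + g' ω) := by
  rw [tendstoInMeasure_iff_norm] at h h' ⊢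
  intro ε hε
  have hs := (h (ε / 2) (half_pos hε)).add (h' (ε / 2) (half_pos hε))
  rw [add_zero] at hs
  refine tendsto_of_tendsto_of_tendsto_of_le_of_le tendsto_const_nhds hs (fun _ => zero_le)
    fun m => (measure_mono fun ω hω => ?_).trans (measure_union_le _ _)
  by_contra hc
  simp only [Set.mem_union, Set.mem_ofPred_eq, not_or, not_le, Real.norm_eq_abs] at hc hω
  have := abs_add_le (f m ω - g ω) (f' m ω - g' ω)
  rw [show f m ω - g ω + (f' m ω - g' ω) = f m ω + f' m ω - (g ω + g' ω) by ring] at this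
  linarith

theorem MeasureTheory.TendstoInMeasure.const_mul_real {f : ℕ → Ω → ℝ} {g : Ω → ℝ}
    (h : TendstoInMeasure P f atTop g) (a : ℝ) :
    TendstoInMeasure P (fun m ω => a * f m ω) atTop (fun ω => a * g ω) := by
  rw [tendstoInMeasure_iff_norm] at h ⊢
  intro ε hε
  have hpos : 0 < |a| + 1 := by positivity
  refine tendsto_of_tendsto_of_tendsto_of_le_of_le tendsto_const_nhds
    (h (ε / (|a| + 1)) (by positivity)) (fun _ => zero_le) fun m => measure_mono fun ω hω => ?_
  simp only [Set.mem_ofPred_eq, Real.norm_eq_abs, ← mul_sub, abs_mul] at hω ⊢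
  rw [div_le_iff₀ hpos]
  nlinarith [abs_nonneg (f m ω - g ω)]

theorem tendstoInMeasure_finset_sum {ι : Type*} (s : Finset ι) {f : ι → ℕ → Ω → ℝ} {g : ι → Ω → ℝ}
    (h : ∀ i ∈ s, TendstoInMeasure P (f i) atTop (g i)) :
    TendstoInMeasure P (fun m ω => ∑ i ∈ s, f i m ω) atTop (fun ω => ∑ i ∈ s, g i ω) := by
  classical
  induction s using Finset.induction_on with
  | empty => simpa using! (tendstoInMeasure_of_tendsto_eLpNorm (p := 1) (by simp)
      (fun _ => aestronglyMeasurable_const) aestronglyMeasurable_const (by simp) :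
        TendstoInMeasure P (fun _ _ => (0 : ℝ)) (atTop : Filter ℕ) (fun _ => 0))
  | insert a s ha ih =>
    simp only [Finset.sum_insert ha]
    exact (h a (Finset.mem_insert_self a s)).add_real
      (ih fun i hi => h i (Finset.mem_insert_of_mem hi))

/-- Finitely many sequences that converge in probability converge almost surely along a common
subsequence. -/
theorem exists_seq_tendsto_ae_forall_lt {f : ℕ → ℕ → Ω → ℝ} {g : ℕ → Ω → ℝ} (N : ℕ)
    (h : ∀ k < N, TendstoInMeasure P (f k) atTop (g k)) :
    ∃ ns : ℕ → ℕ, StrictMono ns ∧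
      ∀ᵐ ω ∂P, ∀ k < N, Tendsto (fun i => f k (ns i) ω) atTop (𝓝 (g k ω)) := by
  induction N with
  | zero => exact ⟨id, strictMono_id, by simp⟩
  | succ N ih =>
    obtain ⟨ns, hns, H⟩ := ih fun k hk => h k (hk.trans (Nat.lt_succ_self N))
    obtain ⟨ms, hms, H'⟩ := ((h N (Nat.lt_succ_self N)).comp hns.tendsto_atTop).exists_seq_tendsto_ae
    refine ⟨ns ∘ ms, hns.comp hms, ?_⟩
    filter_upwards [H, H'] with ω h1 h2 k hk
    rcases Nat.lt_succ_iff_lt_or_eq.1 hk with hk' | rfl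
    · exact (h1 k hk').comp hms.tendsto_atTop
    · exact h2

theorem tendsto_measure_of_eventually_notMem [IsFiniteMeasure P] {E : ℕ → Set Ω}
    (hE : ∀ m, NullMeasurableSet (E m) P) (h : ∀ᵐ ω ∂P, ∀ᶠ m in atTop, ω ∉ E m) :
    Tendsto (fun m => P (E m)) atTop (𝓝 0) := by
  have hF : Tendsto (fun m => P (⋃ l ∈ Set.Ici m, E l)) atTop (𝓝 (P (⋂ m, ⋃ l ∈ Set.Ici m, E l))) :=
    tendsto_measure_iInter_atTop
      (fun m => NullMeasurableSet.biUnion (Set.to_countable _) fun l _ => hE l)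
      (fun a b hab => Set.biUnion_subset_biUnion_left (Set.Ici_subset_Ici.2 hab))
      ⟨0, measure_ne_top _ _⟩
  have h0 : P (⋂ m, ⋃ l ∈ Set.Ici m, E l) = 0 := by
    refine measure_mono_null ?_ (ae_iff.1 h)
    intro ω hω hev
    obtain ⟨m, hm⟩ := eventually_atTop.1 hev
    have := Set.mem_iInter.1 hω m
    simp only [Set.mem_iUnion] at this
    obtain ⟨l, hl, hlE⟩ := this
    exact hm l hl hlE
  rw [h0] at hF
  exact tendsto_of_tendsto_of_tendsto_of_le_of_le tendsto_const_nhds hF (fun _ => zero_le)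
    fun m => measure_mono (Set.subset_biUnion_of_mem (u := fun l => E l) Set.self_mem_Ici)

/-- For a process with almost surely continuous paths, the event that the paths exceed a level
somewhere in an open set is decided by countably many times, hence null-measurable. -/
theorem nullMeasurableSet_exists_lt {E : Type*} [TopologicalSpace E] [SecondCountableTopology E]
    {f : E → Ω → ℝ} (hf : ∀ e, Measurable (f e)) (hc : ∀ᵐ ω ∂P, Continuous fun e => f e ω)
    {U : Set E} (hU : IsOpen U) (a : ℝ) : NullMeasurableSet {ω | ∃ e ∈ U, a < f e ω} P := by
  obtain ⟨D, hDc, hDd⟩ := TopologicalSpace.exists_countable_dense E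
  have hm : MeasurableSet (⋃ e ∈ D ∩ U, {ω | a < f e ω}) :=
    MeasurableSet.biUnion (hDc.mono Set.inter_subset_left) fun e _ =>
      measurableSet_lt measurable_const (hf e)
  refine hm.nullMeasurableSet.congr ?_
  filter_upwards [hc] with ω hω
  apply propext
  change ω ∈ (⋃ e ∈ D ∩ U, {ω | a < f e ω}) ↔ ∃ e ∈ U, a < f e ω
  simp only [Set.mem_iUnion, Set.mem_inter_iff, exists_prop]
  constructor
  · rintro ⟨e, ⟨_, heU⟩, he⟩
    exact ⟨e, heU, he⟩
  · rintro ⟨e, heU, he⟩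
    obtain ⟨e', he', heD⟩ := hDd.inter_open_nonempty (U ∩ {e | a < f e ω})
      (hU.inter (isOpen_lt continuous_const hω)) ⟨e, heU, he⟩
    exact ⟨e', ⟨heD, he'.1⟩, he'.2⟩

/-- The event that `F` exceeds `δ` at some pair of times before `T + 1` at distance less than
`(T + 1) / K`. The margin `1` makes the set of these pairs open and lets it contain the pairs of times
in `[0, T]` at distance at most `T / K`. -/
def oscillationEvent (F : ℝ≥0 × ℝ≥0 → Ω → ℝ) (T : ℝ≥0) (δ : ℝ) (K : ℕ) : Set Ω :=
  {ω | ∃ e ∈ {e : ℝ≥0 × ℝ≥0 | e.1 < T + 1 ∧ e.2 < T + 1 ∧ dist e.1 e.2 < (T + 1) / K}, δ < F e ω}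

theorem tendsto_measure_oscillationEvent [IsFiniteMeasure P] {F : ℝ≥0 × ℝ≥0 → Ω → ℝ}
    (hF : ∀ e, Measurable (F e)) (hc : ∀ᵐ ω ∂P, Continuous fun e => F e ω)
    (h0 : ∀ u ω, F (u, u) ω = 0) (T : ℝ≥0) {δ : ℝ} (hδ : 0 < δ) :
    Tendsto (fun K => P (oscillationEvent F T δ K)) atTop (𝓝 0) := by
  refine tendsto_measure_of_eventually_notMem (fun K => ?_) ?_
  · refine nullMeasurableSet_exists_lt hF hc ?_ δ
    exact (isOpen_lt continuous_fst continuous_const).inter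
      ((isOpen_lt continuous_snd continuous_const).inter
        (isOpen_lt (continuous_fst.dist continuous_snd) continuous_const))
  · filter_upwards [hc] with ω hω
    obtain ⟨h, hh, H⟩ := exists_pos_forall_dist_lt hω (fun u => h0 u ω) (T + 1) hδ
    have hlim : Tendsto (fun K : ℕ => ((T : ℝ) + 1) / K) atTop (𝓝 0) :=
      (tendsto_natCast_atTop_atTop (R := ℝ)).const_div_atTop _
    filter_upwards [hlim.eventually_lt_const hh] with K hK
    rintro ⟨e, ⟨h1, h2, h3⟩, h4⟩
    have := H e.1 e.2 h1.le h2.le (h3.trans hK)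
    exact absurd h4 (not_lt.2 ((le_abs_self _).trans this))

/-- The event that the path of `S` exceeds the level `L` before time `T + 1`. -/
def exceedEvent (S : ℝ≥0 → Ω → ℝ) (T : ℝ≥0) (L : ℕ) : Set Ω :=
  {ω | ∃ u ∈ Set.Iio (T + 1), (L : ℝ) < S u ω}

theorem tendsto_measure_exceedEvent [IsFiniteMeasure P] {S : ℝ≥0 → Ω → ℝ}
    (hS : ∀ u, Measurable (S u)) (hc : ∀ᵐ ω ∂P, Continuous fun u => S u ω) (T : ℝ≥0) :
    Tendsto (fun L => P (exceedEvent S T L)) atTop (𝓝 0) := by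
  refine tendsto_measure_of_eventually_notMem
    (fun L => nullMeasurableSet_exists_lt hS hc isOpen_Iio _) ?_
  filter_upwards [hc] with ω hω
  obtain ⟨M, hM⟩ := (isCompact_Icc (a := (0 : ℝ≥0)) (b := T + 1)).bddAbove_image hω.continuousOn
  filter_upwards [(tendsto_natCast_atTop_atTop (R := ℝ)).eventually_ge_atTop M] with L hL
  rintro ⟨u, hu, h⟩
  exact absurd h (not_lt.2 ((hM ⟨u, ⟨zero_le, (Set.mem_Iio.1 hu).le⟩, rfl⟩).trans hL))

end InMeasure

/-! ### Sampling a continuous process -/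

section SimpleProcess

variable {Ω : Type*} [mΩ : MeasurableSpace Ω] {P : Measure Ω} {𝓕 : Filtration ℝ≥0 mΩ}

theorem exists_mem_Ioc_succ {τ : ℕ → ℝ≥0} {N : ℕ} {u : ℝ≥0} (h0 : τ 0 < u) (hN : u ≤ τ N) :
    ∃ p < N, u ∈ Set.Ioc (τ p) (τ (p + 1)) := by
  induction N with
  | zero => exact absurd h0 (not_lt.2 hN)
  | succ N ih =>
    by_cases h : u ≤ τ N
    · obtain ⟨p, hp, hu⟩ := ih h
      exact ⟨p, hp.trans (Nat.lt_succ_self N), hu⟩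
    · exact ⟨N, Nat.lt_succ_self N, not_le.1 h, hN⟩

theorem LPPricing.SimpleProcess.eval_eq_val (V : SimpleProcess 𝓕) {k : ℕ} (hk : k < V.num)
    {u : ℝ≥0} (hu : u ∈ Set.Ioc (V.time k) (V.time (k + 1))) (ω : Ω) : V.eval u ω = V.val k ω := by
  unfold SimpleProcess.eval
  rw [Finset.sum_eq_single k, Set.indicator_of_mem hu]
  · intro l _ hlk
    refine Set.indicator_of_notMem (fun hl => ?_) _
    rcases lt_or_gt_of_ne hlk with h | h
    · exact absurd (hl.2.trans (V.time_mono h)) (not_le.2 hu.1)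
    · exact absurd (hu.2.trans (V.time_mono h)) (not_le.2 hl.1)
  · intro h
    exact absurd (Finset.mem_range.2 hk) h

theorem LPPricing.SimpleProcess.integral_time (V : SimpleProcess 𝓕) (X : ℝ≥0 → Ω → ℝ) {m : ℕ}
    (hm : m ≤ V.num) (ω : Ω) :
    V.integral X 0 (V.time m) ω =
      ∑ p ∈ Finset.range m, V.val p ω * (X (V.time (p + 1)) ω - X (V.time p) ω) := by
  unfold SimpleProcess.integral
  rw [← Finset.sum_range_add_sum_Ico _ hm, Finset.sum_eq_zero (s := Finset.Ico m V.num), add_zero]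
  · refine Finset.sum_congr rfl fun p hp => ?_
    have hp' := Finset.mem_range.1 hp
    simp [min_eq_left (V.time_mono hp'), min_eq_left (V.time_mono hp'.le)]
  · intro p hp
    have hp' := (Finset.mem_Ico.1 hp).1
    simp [min_eq_right (V.time_mono hp'), min_eq_right (V.time_mono (hp'.trans (Nat.le_succ p)))]

/-- The values of the positive process `S`, capped at `L`, frozen along the uniform partition of
`[0, T]` into `N` intervals. The cap makes the process bounded. -/
noncomputable def cappedSampling (S : ℝ≥0 → Ω → ℝ) (hS : Adapted 𝓕 S) (hpos : ∀ t ω, 0 < S t ω)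
    (T : ℝ≥0) (N L : ℕ) : SimpleProcess 𝓕 where
  num := N
  time := uniformGrid T N
  time_mono := uniformGrid_mono T N
  val p ω := min (S (uniformGrid T N p) ω) L
  val_meas p := (hS _).min measurable_const
  val_bdd := ⟨L, fun p ω => by
    rw [abs_of_nonneg (le_min (hpos _ _).le (Nat.cast_nonneg L))]
    exact min_le_right _ _⟩

/-- Sampling on ever finer grids, with a cap that tends to infinity, approximates a continuous process.
The grids refine the partition of `[0, T]` into `K` intervals. -/
theorem approximates_cappedSampling [IsFiniteMeasure P] {S : ℝ≥0 → Ω → ℝ} (hS : Adapted 𝓕 S)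
    (hpos : ∀ t ω, 0 < S t ω) (hc : ∀ᵐ ω ∂P, Continuous fun u => S u ω) {t T : ℝ≥0} (ht : t ≤ T)
    {K : ℕ} (hK : K ≠ 0) :
    Approximates P (fun L => cappedSampling S hS hpos T (K * L) L) S 0 t := by
  intro ε hε
  have hSm : ∀ u, Measurable (S u) := fun u => (hS u).mono (𝓕.le u) le_rfl
  obtain ⟨δ, hδ, hδε⟩ : ∃ δ > 0, ENNReal.ofReal δ ^ 2 * ENNReal.ofReal t < ε := by
    rcases eq_or_ne ε ∞ with rfl | hε'
    · exact ⟨1, one_pos, by finiteness⟩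
    · have he : 0 < ε.toReal := ENNReal.toReal_pos hε.ne' hε'
      refine ⟨√(ε.toReal / (t + 1)), by positivity, ?_⟩
      rw [← ENNReal.ofReal_pow (by positivity), ← ENNReal.ofReal_mul (by positivity),
        Real.sq_sqrt (by positivity), ← ENNReal.ofReal_toReal hε',
        ENNReal.ofReal_lt_ofReal_iff (by simpa using he), ENNReal.toReal_ofReal he.le,
        div_mul_eq_mul_div, div_lt_iff₀ (by positivity)]
      have : (t : ℝ) < t + 1 := by linarith
      nlinarith
  set F : ℝ≥0 × ℝ≥0 → Ω → ℝ := fun e ω => |S e.1 ω - S e.2 ω| with hF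
  have hosc := (tendsto_measure_oscillationEvent (P := P) (F := F)
    (fun e => ((hSm _).sub (hSm _)).abs) (by
      filter_upwards [hc] with ω hω
      exact ((hω.comp continuous_fst).sub (hω.comp continuous_snd)).abs)
    (fun u ω => by simp [hF]) T hδ).comp
      (tendsto_id.const_mul_atTop' (Nat.pos_of_ne_zero hK))
  have hsum := hosc.add (tendsto_measure_exceedEvent hSm hc T)
  rw [add_zero] at hsum
  refine tendsto_of_tendsto_of_tendsto_of_le_of_le' tendsto_const_nhds hsum
    (Eventually.of_forall fun _ => zero_le) ?_
  filter_upwards [eventually_ne_atTop 0] with L hL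
  refine (measure_mono fun ω hω => ?_).trans (measure_union_le _ _)
  by_contra hcon
  simp only [Set.mem_union, not_or] at hcon
  obtain ⟨h1, h2⟩ := hcon
  have hKL : K * L ≠ 0 := mul_ne_zero hK hL
  have hT1 : T < T + 1 := lt_add_one T
  refine absurd (Set.mem_ofPred_eq ▸ hω : ε ≤ _) (not_le.2 (lt_of_le_of_lt ?_ hδε))
  calc ∫⁻ u in Set.Ioc ((0 : ℝ≥0) : ℝ) t, ‖(cappedSampling S hS hpos T (K * L) L).eval u.toNNReal ω -
        S u.toNNReal ω‖ₑ ^ 2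
      ≤ ∫⁻ _ in Set.Ioc ((0 : ℝ≥0) : ℝ) t, ENNReal.ofReal δ ^ 2 := by
        refine setLIntegral_mono measurable_const fun u hu => ?_
        have hu0 : 0 < u.toNNReal := Real.toNNReal_pos.2 hu.1
        have hut : u.toNNReal ≤ T := (Real.toNNReal_le_iff_le_coe.2 hu.2).trans ht
        obtain ⟨p, hp, hup⟩ := exists_mem_Ioc_succ (τ := uniformGrid T (K * L)) (N := K * L)
          (u := u.toNNReal) (by rwa [uniformGrid_zero]) (by rwa [uniformGrid_self T hKL])
        rw [SimpleProcess.eval_eq_val _ (k := p) hp hup]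
        change ‖min (S (uniformGrid T (K * L) p) ω) L - S u.toNNReal ω‖ₑ ^ 2 ≤ _
        have hpT : uniformGrid T (K * L) p ≤ T := uniformGrid_le T hp.le
        rw [min_eq_left (not_lt.1 fun hlt => h2 ⟨_, hpT.trans_lt hT1, hlt⟩)]
        gcongr
        rw [← ofReal_norm]
        refine ENNReal.ofReal_le_ofReal ?_
        rw [Real.norm_eq_abs]
        refine not_lt.1 fun hlt => h1 ⟨(uniformGrid T (K * L) p, u.toNNReal),
          ⟨hpT.trans_lt hT1, hut.trans_lt hT1, ?_⟩, hlt⟩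
        rw [dist_comm]
        refine (dist_le_of_mem_Icc_uniformGrid hup.1.le hup.2).trans_lt ?_
        have : (0 : ℝ) < (K * L : ℕ) := by exact_mod_cast Nat.pos_of_ne_zero hKL
        simp only [id]
        gcongr
        linarith
    _ = ENNReal.ofReal δ ^ 2 * ENNReal.ofReal t := by simp

end SimpleProcess

/-! ### The log-price -/

section LogPrice

variable {Ω : Type*} [mΩ : MeasurableSpace Ω] {P : Measure Ω} {𝓕 : Filtration ℝ≥0 mΩ}
  {X : ℝ≥0 → Ω → ℝ} {c : ℝ≥0}

/-- The difference `(D t_{k+1} - D t_k) / S t_k - (X t_{k+1} - X t_k)` on the `k`-th interval of the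
uniform partition of `[0, T]` into `K` intervals. When `D = ∫ S dX` it is the error of freezing the
integrand at the left end point, relative to `S t_k`. -/
noncomputable def freezingError (S X D : ℝ≥0 → Ω → ℝ) (T : ℝ≥0) (K k : ℕ) (ω : Ω) : ℝ :=
  (D (uniformGrid T K (k + 1)) ω - D (uniformGrid T K k) ω) / S (uniformGrid T K k) ω -
    (X (uniformGrid T K (k + 1)) ω - X (uniformGrid T K k) ω)

/-- The estimate of the freezing errors for the elementary integrals of the capped samplings of `S`
along a refinement of the partition. -/
theorem IsScaledBM.measure_freezingError_cappedSampling_le [IsProbabilityMeasure P]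
    (hX : IsScaledBM P 𝓕 X c) {S : ℝ≥0 → Ω → ℝ} (hS : Adapted 𝓕 S) (hpos : ∀ t ω, 0 < S t ω)
    (T : ℝ≥0) {K L : ℕ} (hL : L ≠ 0) {ε δ : ℝ} (hε : 0 < ε) (hδ : 0 < δ) :
    P {ω | ε ≤ ∑ k ∈ Finset.range K, freezingError S X
        (fun t => (cappedSampling S hS hpos T (K * L) L).integral X 0 t) T K k ω ^ 2 +
      (∑ k ∈ Finset.range K, freezingError S X
        (fun t => (cappedSampling S hS hpos T (K * L) L).integral X 0 t) T K k ω) ^ 2} ≤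
    P (oscillationEvent (fun e ω => |S e.1 ω / S e.2 ω - 1|) T δ K) + P (exceedEvent S T L) +
      ENNReal.ofReal (2 * c * (δ ^ 2 * T) / ε) := by
  set τ := uniformGrid T (K * L) with hτ
  have hτK : ∀ k, τ (k * L) = uniformGrid T K k := fun k => uniformGrid_mul T K k hL
  have hτm : Monotone τ := uniformGrid_mono T (K * L)
  set V := cappedSampling S hS hpos T (K * L) L with hV
  -- The point `τ (p / L * L)` of the coarse partition precedes `τ p`.
  set s : ℕ → Ω → ℝ := fun p => S (τ (p / L * L)) with hs
  set ξ : ℕ → Ω → ℝ := fun p ω => (V.val p ω - s p ω) / s p ω with hξ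
  have hg : Monotone fun k : ℕ => k * L := fun a b hab => Nat.mul_le_mul_right L hab
  have hdiv : ∀ k q, q ∈ Finset.Ico (k * L) ((k + 1) * L) → q / L = k := by
    intro k q hq
    exact Nat.div_eq_of_lt_le (Finset.mem_Ico.1 hq).1 (Finset.mem_Ico.1 hq).2
  have hVτ : ∀ k ≤ K, ∀ ω, V.integral X 0 (uniformGrid T K k) ω =
      ∑ p ∈ Finset.range (k * L), V.val p ω * (X (τ (p + 1)) ω - X (τ p) ω) := by
    intro k hk ω
    rw [← hτK]
    exact V.integral_time X (m := k * L) (Nat.mul_le_mul_right L hk) ω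
  have hgroup : ∀ k < K, ∀ ω, freezingError S X (fun t => V.integral X 0 t) T K k ω =
      ∑ q ∈ Finset.Ico (k * L) ((k + 1) * L), ξ q ω * (X (τ (q + 1)) ω - X (τ q) ω) := by
    intro k hk ω
    have hle : k * L ≤ (k + 1) * L := hg (Nat.le_succ k)
    have e1 : ∑ q ∈ Finset.Ico (k * L) ((k + 1) * L), ξ q ω * (X (τ (q + 1)) ω - X (τ q) ω) =
        ∑ q ∈ Finset.Ico (k * L) ((k + 1) * L), (V.val q ω * (X (τ (q + 1)) ω - X (τ q) ω) /
          S (τ (k * L)) ω - (X (τ (q + 1)) ω - X (τ q) ω)) := by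
      refine Finset.sum_congr rfl fun q hq => ?_
      simp only [hξ, hs, hdiv k q hq]
      have := (hpos (τ (k * L)) ω).ne'
      field_simp
    rw [e1, Finset.sum_sub_distrib, ← Finset.sum_div,
      Finset.sum_Ico_sub (fun q => X (τ q) ω) hle, Finset.sum_Ico_eq_sub _ hle, hτK, hτK]
    simp only [freezingError]
    rw [hVτ k hk.le, hVτ (k + 1) hk]
  have hξm : ∀ q < K * L, τ q < τ (q + 1) → Measurable[𝓕 (τ q)] (ξ q) := by
    intro q _ _
    have hsq : Measurable[𝓕 (τ q)] (s q) :=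
      (hS _).mono (𝓕.mono (hτm (Nat.div_mul_le_self q L))) le_rfl
    exact ((V.val_meas q).sub hsq).div hsq
  have h := hX.measure_groups_le hτm hg (Nat.zero_mul L) K hξm hε (δ := δ ^ 2 * T) (by positivity)
  have hall : ∀ ω, ∑ k ∈ Finset.range K, freezingError S X (fun t => V.integral X 0 t) T K k ω =
      ∑ q ∈ Finset.range (K * L), ξ q ω * (X (τ (q + 1)) ω - X (τ q) ω) := by
    intro ω
    rw [Finset.sum_congr rfl fun k hk => hgroup k (Finset.mem_range.1 hk) ω,
      sum_Ico_groups hg K fun q => ξ q ω * (X (τ (q + 1)) ω - X (τ q) ω), Nat.zero_mul,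
      Finset.range_eq_Ico]
  have hset : {ω | ε ≤ ∑ k ∈ Finset.range K, freezingError S X (fun t => V.integral X 0 t) T K k ω ^ 2
      + (∑ k ∈ Finset.range K, freezingError S X (fun t => V.integral X 0 t) T K k ω) ^ 2} =
      {ω | ε ≤ ∑ k ∈ Finset.range K, (∑ q ∈ Finset.Ico (k * L) ((k + 1) * L),
        ξ q ω * (X (τ (q + 1)) ω - X (τ q) ω)) ^ 2 +
        (∑ q ∈ Finset.range (K * L), ξ q ω * (X (τ (q + 1)) ω - X (τ q) ω)) ^ 2} := by
    ext ω
    simp only [Set.mem_ofPred_eq]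
    rw [hall, Finset.sum_congr rfl fun k hk => by rw [hgroup k (Finset.mem_range.1 hk) ω]]
  rw [hset]
  refine h.trans (add_le_add_left ((measure_mono fun ω hω => ?_).trans (measure_union_le _ _)) _)
  by_contra hcon
  simp only [Set.mem_union, not_or] at hcon
  obtain ⟨h1, h2⟩ := hcon
  refine absurd (Set.mem_ofPred_eq ▸ hω : δ ^ 2 * T < _) (not_lt.2 ?_)
  have hT1 : T < T + 1 := lt_add_one T
  have hb : ∀ q ∈ Finset.range (K * L), ξ q ω ^ 2 * ((τ (q + 1) : ℝ) - τ q) ≤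
      δ ^ 2 * (T / (K * L : ℕ)) := by
    intro q hq
    have hq' := Finset.mem_range.1 hq
    have hK : 0 < K := Nat.pos_of_ne_zero fun h => by simp [h] at hq'
    have hqT : τ q ≤ T := uniformGrid_le T hq'.le
    have hsT : τ (q / L * L) ≤ T := (hτm (Nat.div_mul_le_self q L)).trans hqT
    rw [uniformGrid_succ_sub]
    refine mul_le_mul_of_nonneg_right ?_ (by positivity)
    rw [← sq_abs]
    refine pow_le_pow_left₀ (abs_nonneg _) ?_ 2
    have hval : V.val q ω = S (τ q) ω :=
      min_eq_left (not_lt.1 fun hlt => h2 ⟨_, hqT.trans_lt hT1, hlt⟩)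
    have hξe : ξ q ω = S (τ q) ω / S (τ (q / L * L)) ω - 1 := by
      simp only [hξ, hs, hval]
      rw [sub_div, div_self (hpos _ ω).ne']
    rw [hξe]
    refine not_lt.1 fun hlt => h1 ⟨(τ q, τ (q / L * L)),
      ⟨hqT.trans_lt hT1, hsT.trans_lt hT1, ?_⟩, hlt⟩
    have hd := dist_le_of_mem_Icc_uniformGrid (T := T) (K := K) (k := q / L) (u := τ q)
      (by rw [← hτK]; exact hτm (Nat.div_mul_le_self q L))
      (by
        rw [← hτK]
        refine hτm (Nat.le_of_lt ?_)
        have := Nat.lt_mul_div_succ q (Nat.pos_of_ne_zero hL)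
        rwa [mul_comm] at this)
    rw [← hτK] at hd
    refine hd.trans_lt ?_
    have : (0 : ℝ) < K := Nat.cast_pos.2 hK
    gcongr
    linarith
  refine (Finset.sum_le_sum hb).trans ?_
  simp only [Finset.sum_const, Finset.card_range, nsmul_eq_mul]
  rcases eq_or_ne K 0 with rfl | hK
  · simp only [zero_mul, Nat.cast_zero]
    positivity
  · have : ((K * L : ℕ) : ℝ) ≠ 0 := Nat.cast_ne_zero.2 (mul_ne_zero hK hL)
    field_simp
    exact le_rfl

theorem IsScaledBM.measurable_integral (hX : IsScaledBM P 𝓕 X c) (V : SimpleProcess 𝓕)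
    (s t : ℝ≥0) : Measurable (V.integral X s t) :=
  Finset.measurable_sum _ fun k _ => ((V.val_meas k).mono (𝓕.le _) le_rfl).mul
    ((hX.measurable _).sub (hX.measurable _))

/-- The freezing errors of the Itô integral `D = ∫ S dX` are small in probability once `S` oscillates
little, in relative terms, on the intervals of the partition. -/
theorem IsScaledBM.measure_freezingError_le [IsProbabilityMeasure P]
    (hX : IsScaledBM P 𝓕 X c) {S D : ℝ≥0 → Ω → ℝ} (hS : Adapted 𝓕 S) (hpos : ∀ t ω, 0 < S t ω)
    (hc : ∀ᵐ ω ∂P, Continuous fun u => S u ω)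
    (hD : ∀ t (V : ℕ → SimpleProcess 𝓕), Approximates P V S 0 t →
      TendstoInMeasure P (fun m => (V m).integral X 0 t) atTop (D t))
    (T : ℝ≥0) {K : ℕ} (hK : K ≠ 0) {ε δ : ℝ} (hε : 0 < ε) (hδ : 0 < δ) :
    P {ω | 2 * ε ≤ ∑ k ∈ Finset.range K, freezingError S X D T K k ω ^ 2 +
      (∑ k ∈ Finset.range K, freezingError S X D T K k ω) ^ 2} ≤
    P (oscillationEvent (fun e ω => |S e.1 ω / S e.2 ω - 1|) T δ K) +
      ENNReal.ofReal (2 * c * (δ ^ 2 * T) / ε) := by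
  have hSm : ∀ u, Measurable (S u) := fun u => (hS u).mono (𝓕.le u) le_rfl
  set V : ℕ → SimpleProcess 𝓕 := fun L => cappedSampling S hS hpos T (K * L) L with hV
  obtain ⟨ns, hns, hlim⟩ := exists_seq_tendsto_ae_forall_lt (P := P)
    (f := fun k L => (V L).integral X 0 (uniformGrid T K k)) (g := fun k => D (uniformGrid T K k))
    (K + 1) fun k hk => hD _ V (approximates_cappedSampling hS hpos hc
      (uniformGrid_le T (Nat.lt_succ_iff.1 hk)) hK)
  set Q : (ℝ≥0 → Ω → ℝ) → Ω → ℝ := fun D ω =>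
    ∑ k ∈ Finset.range K, freezingError S X D T K k ω ^ 2 +
      (∑ k ∈ Finset.range K, freezingError S X D T K k ω) ^ 2 with hQ
  have hQlim : TendstoInMeasure P (fun i => Q fun t => (V (ns i)).integral X 0 t) atTop (Q D) := by
    refine tendstoInMeasure_of_tendsto_ae (fun i => Measurable.aestronglyMeasurable ?_) ?_
    · have hR : ∀ k, Measurable
          (freezingError S X (fun t => (V (ns i)).integral X 0 t) T K k) := fun k =>
        (((hX.measurable_integral _ _ _).sub (hX.measurable_integral _ _ _)).div (hSm _)).sub
          ((hX.measurable _).sub (hX.measurable _))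
      exact (Finset.measurable_sum _ fun k _ => (hR k).pow_const 2).add
        ((Finset.measurable_sum _ fun k _ => hR k).pow_const 2)
    · filter_upwards [hlim] with ω hω
      have hR : ∀ k ∈ Finset.range K, Tendsto (fun i =>
          freezingError S X (fun t => (V (ns i)).integral X 0 t) T K k ω) atTop
          (𝓝 (freezingError S X D T K k ω)) := by
        intro k hk
        have hk' := Finset.mem_range.1 hk
        exact (((hω (k + 1) (Nat.succ_lt_succ hk')).sub
          (hω k (hk'.trans (Nat.lt_succ_self K)))).div_const _).sub_const _
      exact (tendsto_finsetSum _ fun k hk => (hR k hk).pow 2).add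
        ((tendsto_finsetSum _ hR).pow 2)
  rw [tendstoInMeasure_iff_norm] at hQlim
  have hex := ((tendsto_measure_exceedEvent (P := P) hSm hc T).comp hns.tendsto_atTop)
  set A := P (oscillationEvent (fun e ω => |S e.1 ω / S e.2 ω - 1|) T δ K)
  set E := ENNReal.ofReal (2 * c * (δ ^ 2 * T) / ε)
  have htot : Tendsto (fun i => A + P (exceedEvent S T (ns i)) + E +
      P {ω | ε ≤ ‖Q (fun t => (V (ns i)).integral X 0 t) ω - Q D ω‖}) atTop (𝓝 (A + E)) := by
    have := (((tendsto_const_nhds (x := A)).add hex).add (tendsto_const_nhds (x := E))).add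
      (hQlim ε hε)
    simpa using this
  refine ge_of_tendsto htot ?_
  filter_upwards [eventually_ne_atTop 0] with i hi
  have hL : ns i ≠ 0 := fun h => hi (Nat.le_zero.1 (h ▸ hns.id_le i))
  refine le_trans ((measure_mono fun ω hω => ?_).trans (measure_union_le
    {ω | ε ≤ Q (fun t => (V (ns i)).integral X 0 t) ω}
    {ω | ε ≤ ‖Q (fun t => (V (ns i)).integral X 0 t) ω - Q D ω‖}))
    (add_le_add_left (hX.measure_freezingError_cappedSampling_le hS hpos T hL hε hδ) _)
  by_contra hcon
  simp only [Set.mem_union, Set.mem_ofPred_eq, not_or, not_le, Real.norm_eq_abs] at hcon hω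
  have h1 : 2 * ε ≤ Q D ω := hω
  have h2 := (abs_lt.1 hcon.2).1
  linarith [hcon.1]

/-- Itô's formula for the logarithm of a solution of `dS = S (r dt + dX)`. -/
theorem IsScaledBM.log_sub_log_ae_eq [IsProbabilityMeasure P]
    (hX : IsScaledBM P 𝓕 X c) {S : ℝ≥0 → Ω → ℝ} (hS : Adapted 𝓕 S) (hpos : ∀ t ω, 0 < S t ω)
    (hc : ∀ᵐ ω ∂P, Continuous fun u => S u ω) {r : ℝ}
    (hD : ∀ t, ∃ D, (∀ V : ℕ → SimpleProcess 𝓕, Approximates P V S 0 t →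
      TendstoInMeasure P (fun m => (V m).integral X 0 t) atTop D) ∧
      ∀ᵐ ω ∂P, S t ω = S 0 ω + (∫ u in (0 : ℝ)..t, r * S u.toNNReal ω) + D ω)
    (T : ℝ≥0) :
    ∀ᵐ ω ∂P, Real.log (S T ω) - Real.log (S 0 ω) = r * T + (X T ω - X 0 ω) - c * T / 2 := by
  choose D hD1 hD2 using hD
  have hSm : ∀ u, Measurable (S u) := fun u => (hS u).mono (𝓕.le u) le_rfl
  have hR : TendstoInMeasure P (fun K ω => ∑ k ∈ Finset.range K, freezingError S X D T K k ω ^ 2 +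
      (∑ k ∈ Finset.range K, freezingError S X D T K k ω) ^ 2) atTop (fun _ => 0) := by
    rw [tendstoInMeasure_iff_norm]
    intro ε hε
    rw [ENNReal.tendsto_nhds_zero]
    intro κ hκ
    obtain ⟨δ, hδ, hδκ⟩ : ∃ δ > 0, ENNReal.ofReal (2 * c * (δ ^ 2 * T) / (ε / 2)) < κ / 2 := by
      have hcont : Tendsto (fun δ : ℝ => ENNReal.ofReal (2 * c * (δ ^ 2 * T) / (ε / 2))) (𝓝[>] 0)
          (𝓝 0) := by
        have : Continuous fun δ : ℝ => ENNReal.ofReal (2 * c * (δ ^ 2 * T) / (ε / 2)) :=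
          ENNReal.continuous_ofReal.comp (by fun_prop)
        have h := (this.tendsto 0).mono_left (nhdsWithin_le_nhds (s := Set.Ioi 0))
        simpa using h
      obtain ⟨δ, h1, h2⟩ := ((hcont.eventually_lt_const (ENNReal.half_pos hκ.ne')).and
        self_mem_nhdsWithin).exists
      exact ⟨δ, h2, h1⟩
    have hosc := tendsto_measure_oscillationEvent (P := P)
      (F := fun e ω => |S e.1 ω / S e.2 ω - 1|)
      (fun e => (((hSm _).div (hSm _)).sub measurable_const).abs) (by
        filter_upwards [hc] with ω hω
        have h1 : Continuous fun e : ℝ≥0 × ℝ≥0 => S e.1 ω := hω.comp continuous_fst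
        have h2 : Continuous fun e : ℝ≥0 × ℝ≥0 => S e.2 ω := hω.comp continuous_snd
        exact ((h1.div h2 fun e => (hpos _ _).ne').sub continuous_const).abs)
      (fun u ω => by simp [(hpos u ω).ne']) T hδ
    filter_upwards [hosc.eventually_lt_const (ENNReal.half_pos hκ.ne'), eventually_ne_atTop 0]
      with K hK1 hK0
    have h := hX.measure_freezingError_le hS hpos hc hD1 T hK0 (half_pos hε) hδ
    rw [mul_div_cancel₀ ε two_ne_zero] at h
    refine le_trans (le_of_eq ?_) (h.trans ((add_le_add hK1.le hδκ.le).trans_eq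
      (ENNReal.add_halves κ)))
    congr 1
    ext ω
    simp only [Set.mem_ofPred_eq, sub_zero]
    rw [Real.norm_of_nonneg (by positivity)]
  obtain ⟨n1, h1, l1⟩ := hR.exists_seq_tendsto_ae
  obtain ⟨n2, h2, l2⟩ :=
    ((hX.tendstoInMeasure_quadraticVariation T).comp h1.tendsto_atTop).exists_seq_tendsto_ae
  have hDall : ∀ᵐ ω ∂P, ∀ m k, S (uniformGrid T m k) ω = S 0 ω +
      (∫ u in (0 : ℝ)..uniformGrid T m k, r * S u.toNNReal ω) + D (uniformGrid T m k) ω :=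
    ae_all_iff.2 fun m => ae_all_iff.2 fun k => hD2 _
  filter_upwards [l1, l2, hDall, hc] with ω e1 e2 e3 e4
  exact log_sub_log_eq (s := fun t => S t ω) (x := fun t => X t ω) (D := fun t => D t ω) e4
    (fun t => hpos t ω) T (h1.tendsto_atTop.comp h2.tendsto_atTop) e3 e2
    (e1.comp h2.tendsto_atTop)

/-- The log-price of an asset of the market model is a Brownian motion with drift. -/
theorem LPPricing.IsMarketModel.log_sub_log_ae_eq [IsProbabilityMeasure P] {n d : ℕ}
    {B : Fin d → ℝ≥0 → Ω → ℝ} (hB : IsStandardBrownianMotion P 𝓕 B) {r : ℝ}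
    {σ : Matrix (Fin n) (Fin d) ℝ} {S : Fin n → ℝ≥0 → Ω → ℝ} (hS : IsMarketModel P 𝓕 B r σ S)
    (i : Fin n) (t : ℝ≥0) :
    ∀ᵐ ω ∂P, Real.log (S i t ω) = Real.log (S i 0 ω) + (r - vol σ i ^ 2 / 2) * t +
      (∑ j, σ i j * B j t ω - ∑ j, σ i j * B j 0 ω) := by
  have hvol : vol σ i ^ 2 = ∑ j, σ i j ^ 2 :=
    Real.sq_sqrt (Finset.sum_nonneg fun j _ => sq_nonneg _)
  have hc : ((vol σ i ^ 2).toNNReal : ℝ) = ∑ j, σ i j ^ 2 := by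
    rw [Real.coe_toNNReal _ (sq_nonneg _), hvol]
  have hX := hB.isScaledBM (fun j => σ i j) _ hc
  have h := hX.log_sub_log_ae_eq (hS.adapted i) (hS.pos i) (hS.continuous i) (r := r) (fun t => by
    obtain ⟨J, hJ, hJS⟩ := hS.sde i t
    refine ⟨fun ω => ∑ j, σ i j * J j ω, fun V hV => ?_, hJS⟩
    have := tendstoInMeasure_finset_sum Finset.univ
      (fun j _ => ((hJ j).2 V hV).const_mul_real (σ i j))
    refine this.congr_left fun m => Eventually.of_forall fun ω => ?_
    simp only [SimpleProcess.integral, Finset.mul_sum, ← Finset.sum_sub_distrib]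
    rw [Finset.sum_comm]
    refine Finset.sum_congr rfl fun k _ => Finset.sum_congr rfl fun j _ => ?_
    ring) t
  filter_upwards [h] with ω hω
  rw [Real.coe_toNNReal _ (sq_nonneg _)] at hω
  linarith

end LogPrice

/-! ### Common refinements of simple processes -/

section Refinement

/-- Every finite set of times is compatible with some partition of `[s, t]`: none of its elements lies
strictly inside an interval of the partition. -/
theorem exists_partition (F : Finset ℝ≥0) {s t : ℝ≥0} (hst : s ≤ t) :
    ∃ (N : ℕ) (p : ℕ → ℝ≥0), Monotone p ∧ p 0 = s ∧ p N = t ∧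
      ∀ x ∈ F, ∀ q < N, x ≤ p q ∨ p (q + 1) ≤ x := by
  classical
  set G : Finset ℝ≥0 := insert s (insert t (F.filter fun x => s ≤ x ∧ x ≤ t)) with hG
  have hGm : ∀ x ∈ G, s ≤ x ∧ x ≤ t := by
    intro x hx
    simp only [hG, Finset.mem_insert, Finset.mem_filter] at hx
    rcases hx with rfl | rfl | hx
    · exact ⟨le_rfl, hst⟩
    · exact ⟨hst, le_rfl⟩
    · exact hx.2
  have hsG : s ∈ G := Finset.mem_insert_self _ _
  have htG : t ∈ G := Finset.mem_insert_of_mem (Finset.mem_insert_self _ _)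
  obtain ⟨N, hN⟩ : ∃ N, G.card = N + 1 := Nat.exists_eq_succ_of_ne_zero (Finset.card_ne_zero_of_mem hsG)
  set f := G.orderEmbOfFin hN with hf
  have hfG : ∀ i, f i ∈ G := fun i => Finset.orderEmbOfFin_mem G hN i
  have hfr : ∀ x ∈ G, ∃ i, f i = x := by
    intro x hx
    have : x ∈ Set.range f := by rw [hf, Finset.range_orderEmbOfFin]; exact hx
    exact this
  have hle : ∀ q, min q N < N + 1 := fun q => Nat.lt_succ_of_le (min_le_right q N)
  refine ⟨N, fun q => f ⟨min q N, hle q⟩, fun a b hab => f.monotone (min_le_min_right N hab), ?_, ?_, ?_⟩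
  · obtain ⟨i, hi⟩ := hfr s hsG
    refine le_antisymm ?_ (hGm _ (hfG _)).1
    rw [← hi]
    refine f.monotone ?_
    simp
  · obtain ⟨i, hi⟩ := hfr t htG
    refine le_antisymm (hGm _ (hfG _)).2 ?_
    rw [← hi]
    refine f.monotone ?_
    simp [Fin.le_def, Nat.lt_succ_iff.1 i.2]
  · intro x hx q hq
    by_cases h1 : x < s
    · exact Or.inl (h1.le.trans (hGm _ (hfG _)).1)
    by_cases h2 : t < x
    · exact Or.inr ((hGm _ (hfG _)).2.trans h2.le)
    obtain ⟨i, hi⟩ := hfr x (by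
      simp only [hG, Finset.mem_insert, Finset.mem_filter]
      exact Or.inr (Or.inr ⟨hx, not_lt.1 h1, not_lt.1 h2⟩))
    rw [← hi]
    rcases Nat.lt_or_ge q i with h | h
    · exact Or.inr (f.monotone (by
        simp only [Fin.le_def]
        exact (min_le_left _ _).trans h))
    · exact Or.inl (f.monotone (by
        simp only [Fin.le_def]
        exact le_min h (Nat.lt_succ_iff.1 i.2)))

/-- The increments of `f` over the intervals of a compatible partition that lie to the left of `b` add
up to the increment up to `b`, moved into the range of the partition. -/
theorem sum_ite_le_sub {N : ℕ} {p : ℕ → ℝ≥0} (hp : Monotone p) {b : ℝ≥0}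
    (hb : ∀ q < N, b ≤ p q ∨ p (q + 1) ≤ b) (f : ℝ≥0 → ℝ) :
    ∑ q ∈ Finset.range N, (if p (q + 1) ≤ b then f (p (q + 1)) - f (p q) else 0) =
      f (max (p 0) (min b (p N))) - f (p 0) := by
  set β := max (p 0) (min b (p N)) with hβ
  have h0 : min (p 0) β = p 0 := min_eq_left (le_max_left _ _)
  have hN : min (p N) β = β := min_eq_right (max_le (hp (Nat.zero_le N)) (min_le_right _ _))
  have key : ∀ q ∈ Finset.range N, (if p (q + 1) ≤ b then f (p (q + 1)) - f (p q) else 0) =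
      f (min (p (q + 1)) β) - f (min (p q) β) := by
    intro q hq
    have hq' := Finset.mem_range.1 hq
    split_ifs with h
    · have h1 : p (q + 1) ≤ β := le_max_of_le_right (le_min h (hp hq'))
      rw [min_eq_left h1, min_eq_left ((hp (Nat.le_succ q)).trans h1)]
    · have h1 : b ≤ p q := (hb q hq').resolve_right h
      have h2 : β ≤ p q := max_le (hp (Nat.zero_le q)) ((min_le_left _ _).trans h1)
      rw [min_eq_right h2, min_eq_right (h2.trans (hp (Nat.le_succ q))), sub_self]
  rw [Finset.sum_congr rfl key, Finset.sum_range_sub (fun q => f (min (p q) β)), h0, hN]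

theorem lintegral_Ioc_eq_sum {N : ℕ} {p : ℕ → ℝ≥0} (hp : Monotone p) {φ : ℝ≥0 → ℝ≥0∞}
    (hφ : ∀ q < N, ∀ u ∈ Set.Ioc (p q) (p (q + 1)), φ u = φ (p (q + 1))) :
    ∫⁻ u in Set.Ioc (p 0 : ℝ) (p N), φ u.toNNReal =
      ∑ q ∈ Finset.range N, φ (p (q + 1)) * ENNReal.ofReal ((p (q + 1) : ℝ) - p q) := by
  induction N with
  | zero => simp
  | succ N ih =>
    rw [Finset.sum_range_succ, ← ih fun q hq => hφ q (hq.trans (Nat.lt_succ_self N)),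
      ← Set.Ioc_union_Ioc_eq_Ioc (NNReal.coe_le_coe.2 (hp (Nat.zero_le N)))
        (NNReal.coe_le_coe.2 (hp (Nat.le_succ N))),
      lintegral_union measurableSet_Ioc (Set.Ioc_disjoint_Ioc_of_le le_rfl)]
    congr 1
    rw [setLIntegral_congr_fun measurableSet_Ioc (g := fun _ => φ (p (N + 1)))]
    · simp
    · intro u hu
      have hu0 : 0 ≤ u := (NNReal.coe_nonneg _).trans hu.1.le
      refine hφ N (Nat.lt_succ_self N) _ ⟨?_, ?_⟩
      · rw [← NNReal.coe_lt_coe, Real.coe_toNNReal u hu0]; exact hu.1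
      · rw [← NNReal.coe_le_coe, Real.coe_toNNReal u hu0]; exact hu.2

theorem enorm_sq_eq_ofReal (x : ℝ) : ‖x‖ₑ ^ 2 = ENNReal.ofReal (x ^ 2) := by
  rw [Real.enorm_eq_ofReal_abs, ← ENNReal.ofReal_pow (abs_nonneg x), sq_abs]

variable {Ω : Type*} [mΩ : MeasurableSpace Ω] {P : Measure Ω} {𝓕 : Filtration ℝ≥0 mΩ}

theorem LPPricing.SimpleProcess.eval_eq_of_mem_Ioc (V : SimpleProcess 𝓕) {a b : ℝ≥0}
    (h : ∀ k ≤ V.num, V.time k ≤ a ∨ b ≤ V.time k) {u : ℝ≥0} (hu : u ∈ Set.Ioc a b) (ω : Ω) :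
    V.eval u ω = V.eval b ω := by
  refine Finset.sum_congr rfl fun k hk => ?_
  have hk' := Finset.mem_range.1 hk
  have key : ∀ l ≤ V.num, V.time l < u ↔ V.time l < b := fun l hl =>
    ⟨fun h1 => h1.trans_le hu.2, fun h1 => ((h l hl).resolve_right (not_le.2 h1)).trans_lt hu.1⟩
  have : u ∈ Set.Ioc (V.time k) (V.time (k + 1)) ↔ b ∈ Set.Ioc (V.time k) (V.time (k + 1)) := by
    rw [Set.mem_Ioc, Set.mem_Ioc, key k hk'.le, ← not_lt, key (k + 1) hk', not_lt]
  simp only [Set.indicator_apply, this]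

theorem LPPricing.SimpleProcess.measurable_eval (V : SimpleProcess 𝓕) {a b : ℝ≥0}
    (h : ∀ k ≤ V.num, V.time k ≤ a ∨ b ≤ V.time k) : Measurable[𝓕 a] (V.eval b) := by
  refine Finset.measurable_sum _ fun k hk => ?_
  by_cases hb : b ∈ Set.Ioc (V.time k) (V.time (k + 1))
  · simp only [Set.indicator_of_mem hb]
    exact (V.val_meas k).mono (𝓕.mono ((h k (Finset.mem_range.1 hk).le).resolve_right
      (not_le.2 hb.1))) le_rfl
  · simp only [Set.indicator_of_notMem hb]
    exact measurable_const

theorem LPPricing.SimpleProcess.measurable_eval_left (V : SimpleProcess 𝓕) (ω : Ω) :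
    Measurable fun u => V.eval u ω :=
  Finset.measurable_sum _ fun _ _ => measurable_const.indicator measurableSet_Ioc

theorem LPPricing.SimpleProcess.exists_abs_eval_le (V : SimpleProcess 𝓕) :
    ∃ C, ∀ u ω, |V.eval u ω| ≤ C := by
  obtain ⟨C, hC⟩ := V.val_bdd
  refine ⟨∑ _k ∈ Finset.range V.num, C, fun u ω => (Finset.abs_sum_le_sum_abs _ _).trans
    (Finset.sum_le_sum fun k _ => ?_)⟩
  rw [Set.indicator_apply]
  split_ifs
  · exact hC k ω
  · simpa using (abs_nonneg _).trans (hC k ω)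

theorem LPPricing.SimpleProcess.integral_eq_sum_eval (V : SimpleProcess 𝓕) (X : ℝ≥0 → Ω → ℝ)
    {N : ℕ} {p : ℕ → ℝ≥0} (hp : Monotone p)
    (h : ∀ k ≤ V.num, ∀ q < N, V.time k ≤ p q ∨ p (q + 1) ≤ V.time k) (ω : Ω) :
    V.integral X (p 0) (p N) ω =
      ∑ q ∈ Finset.range N, V.eval (p (q + 1)) ω * (X (p (q + 1)) ω - X (p q) ω) := by
  simp only [SimpleProcess.eval, Finset.sum_mul]
  rw [Finset.sum_comm]
  refine Finset.sum_congr rfl fun k hk => ?_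
  have hk' := Finset.mem_range.1 hk
  have e1 := sum_ite_le_sub hp (h (k + 1) hk') (fun u => X u ω)
  have e2 := sum_ite_le_sub hp (h k hk'.le) (fun u => X u ω)
  have e3 : X (max (p 0) (min (V.time (k + 1)) (p N))) ω -
      X (max (p 0) (min (V.time k) (p N))) ω =
      ∑ q ∈ Finset.range N, ((if p (q + 1) ≤ V.time (k + 1) then X (p (q + 1)) ω - X (p q) ω else 0) -
        (if p (q + 1) ≤ V.time k then X (p (q + 1)) ω - X (p q) ω else 0)) := by
    rw [Finset.sum_sub_distrib, e1, e2]
    ring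
  rw [e3, Finset.mul_sum]
  refine Finset.sum_congr rfl fun q _ => ?_
  have hmono := V.time_mono (Nat.le_succ k)
  by_cases h1 : p (q + 1) ≤ V.time k
  · simp [h1, h1.trans hmono]
  · by_cases h3 : p (q + 1) ≤ V.time (k + 1)
    · have h2 : p (q + 1) ∈ Set.Ioc (V.time k) (V.time (k + 1)) := ⟨not_le.1 h1, h3⟩
      simp [h1, h3, Set.indicator_of_mem h2]
    · simp [h1, h3]

/-- The difference of two simple processes, written on a common refinement `p` of their time grids:
`e q` is its value on `(p q, p (q + 1)]`. Values on degenerate intervals are set to `0`. -/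
theorem LPPricing.SimpleProcess.exists_common_grid (V V' : SimpleProcess 𝓕) {s t : ℝ≥0}
    (hst : s ≤ t) :
    ∃ (N : ℕ) (p : ℕ → ℝ≥0) (e : ℕ → Ω → ℝ), Monotone p ∧ p 0 = s ∧ p N = t ∧
      (∀ q, Measurable[𝓕 (p q)] (e q)) ∧ (∀ q, ∃ C, ∀ ω, |e q ω| ≤ C) ∧
      (∀ (X : ℝ≥0 → Ω → ℝ) ω, V.integral X s t ω - V'.integral X s t ω =
        ∑ q ∈ Finset.range N, e q ω * (X (p (q + 1)) ω - X (p q) ω)) ∧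
      ∀ ω, ∫⁻ u in Set.Ioc (s : ℝ) t, ‖V.eval u.toNNReal ω - V'.eval u.toNNReal ω‖ₑ ^ 2 =
        ENNReal.ofReal (∑ q ∈ Finset.range N, e q ω ^ 2 * ((p (q + 1) : ℝ) - p q)) := by
  classical
  obtain ⟨N, p, hp, h0, hN, hF⟩ := exists_partition
    ((Finset.range (V.num + 1)).image V.time ∪ (Finset.range (V'.num + 1)).image V'.time) hst
  have hV : ∀ k ≤ V.num, ∀ q < N, V.time k ≤ p q ∨ p (q + 1) ≤ V.time k := fun k hk =>
    hF _ (Finset.mem_union_left _ (Finset.mem_image_of_mem _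
      (Finset.mem_range.2 (Nat.lt_succ_of_le hk))))
  have hV' : ∀ k ≤ V'.num, ∀ q < N, V'.time k ≤ p q ∨ p (q + 1) ≤ V'.time k := fun k hk =>
    hF _ (Finset.mem_union_right _ (Finset.mem_image_of_mem _
      (Finset.mem_range.2 (Nat.lt_succ_of_le hk))))
  set e : ℕ → Ω → ℝ := fun q =>
    if q < N ∧ p q < p (q + 1) then fun ω => V.eval (p (q + 1)) ω - V'.eval (p (q + 1)) ω else 0
    with he
  have hdeg : ∀ q, ¬ p q < p (q + 1) → p (q + 1) = p q := fun q h =>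
    le_antisymm (not_lt.1 h) (hp (Nat.le_succ q))
  refine ⟨N, p, e, hp, h0, hN, fun q => ?_, fun q => ?_, fun X ω => ?_, fun ω => ?_⟩
  · by_cases h : q < N ∧ p q < p (q + 1)
    · simp only [he, h, and_self, if_true]
      exact (V.measurable_eval fun k hk => hV k hk q h.1).sub
        (V'.measurable_eval fun k hk => hV' k hk q h.1)
    · simp only [he, h, if_false]
      exact measurable_const
  · obtain ⟨C, hC⟩ := V.exists_abs_eval_le
    obtain ⟨C', hC'⟩ := V'.exists_abs_eval_le
    refine ⟨C + C', fun ω => ?_⟩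
    by_cases h : q < N ∧ p q < p (q + 1)
    · simp only [he, h, and_self, if_true]
      exact (abs_sub _ _).trans (add_le_add (hC _ _) (hC' _ _))
    · simp only [he, h, if_false, Pi.zero_apply, abs_zero]
      exact add_nonneg ((abs_nonneg _).trans (hC 0 ω)) ((abs_nonneg _).trans (hC' 0 ω))
  · rw [← h0, ← hN, V.integral_eq_sum_eval X hp hV, V'.integral_eq_sum_eval X hp hV',
      ← Finset.sum_sub_distrib]
    refine Finset.sum_congr rfl fun q hq => ?_
    by_cases h : p q < p (q + 1)
    · simp only [he, Finset.mem_range.1 hq, h, and_self, if_true]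
      ring
    · simp [hdeg q h]
  · rw [← h0, ← hN, lintegral_Ioc_eq_sum (φ := fun u => ‖V.eval u ω - V'.eval u ω‖ₑ ^ 2) hp,
      ENNReal.ofReal_sum_of_nonneg]
    · refine Finset.sum_congr rfl fun q hq => ?_
      rw [enorm_sq_eq_ofReal, ← ENNReal.ofReal_mul (sq_nonneg _)]
      by_cases h : p q < p (q + 1)
      · simp only [he, Finset.mem_range.1 hq, h, and_self, if_true]
      · simp [hdeg q h]
    · exact fun q _ => mul_nonneg (sq_nonneg _)
        (sub_nonneg.2 (NNReal.coe_le_coe.2 (hp (Nat.le_succ q))))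
    · intro q hq u hu
      simp only [V.eval_eq_of_mem_Ioc (fun k hk => hV k hk q hq) hu,
        V'.eval_eq_of_mem_Ioc (fun k hk => hV' k hk q hq) hu]

end Refinement

/-! ### The Itô integral of a deterministic weight -/

section ItoIntegral

variable {Ω : Type*} [mΩ : MeasurableSpace Ω] {P : Measure Ω} {𝓕 : Filtration ℝ≥0 mΩ}

/-- `X` is, up to its starting value, the sum of the drift `μ t` and the martingale `Y`, almost surely
at each time. -/
def HasDriftDecomposition (P : Measure Ω) (X Y : ℝ≥0 → Ω → ℝ) (μ : ℝ) : Prop :=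
  ∀ t, ∀ᵐ ω ∂P, X t ω = X 0 ω + μ * t + (Y t ω - Y 0 ω)

theorem HasDriftDecomposition.sub_ae_eq {X Y : ℝ≥0 → Ω → ℝ} {μ : ℝ}
    (h : HasDriftDecomposition P X Y μ) (s t : ℝ≥0) :
    ∀ᵐ ω ∂P, X t ω - X s ω = μ * ((t : ℝ) - s) + (Y t ω - Y s ω) := by
  filter_upwards [h s, h t] with ω h1 h2
  rw [h1, h2]
  ring

theorem sum_sq_mul_le {N : ℕ} {p : ℕ → ℝ≥0} (hp : Monotone p) (e : ℕ → ℝ) :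
    (∑ q ∈ Finset.range N, e q * ((p (q + 1) : ℝ) - p q)) ^ 2 ≤
      (∑ q ∈ Finset.range N, e q ^ 2 * ((p (q + 1) : ℝ) - p q)) * ((p N : ℝ) - p 0) := by
  rw [← Finset.sum_range_sub (fun q => (p q : ℝ))]
  have h0 : ∀ q, 0 ≤ (p (q + 1) : ℝ) - p q := fun q =>
    sub_nonneg.2 (NNReal.coe_le_coe.2 (hp (Nat.le_succ q)))
  exact Finset.sum_sq_le_sum_mul_sum_of_sq_le_mul _ (fun q _ => mul_nonneg (sq_nonneg _) (h0 q))
    (fun q _ => h0 q) fun q _ => le_of_eq (by ring)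

/-- The triangle inequality in `L²`, in the form `(x + y)² ≤ 2 x² + 2 y²`. -/
theorem lintegral_enorm_sub_sq_le {f g h : ℝ → ℝ} {s : Set ℝ} (hf : Measurable f) (hh : Measurable h) :
    ∫⁻ u in s, ‖f u - g u‖ₑ ^ 2 ≤
      2 * (∫⁻ u in s, ‖f u - h u‖ₑ ^ 2) + 2 * ∫⁻ u in s, ‖g u - h u‖ₑ ^ 2 := by
  rw [← lintegral_const_mul' _ _ (by simp), ← lintegral_const_mul' _ _ (by simp),
    ← lintegral_add_left (f := fun u => 2 * ‖f u - h u‖ₑ ^ 2) (by fun_prop)]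
  refine lintegral_mono fun u => ?_
  simp only [enorm_sq_eq_ofReal]
  rw [show (2 : ℝ≥0∞) = ENNReal.ofReal 2 by simp, ← ENNReal.ofReal_mul zero_le_two,
    ← ENNReal.ofReal_mul zero_le_two,
    ← ENNReal.ofReal_add (by positivity) (by positivity)]
  refine ENNReal.ofReal_le_ofReal ?_
  nlinarith [sq_nonneg ((f u - h u) + (g u - h u))]

/-- The elementary integrals of two sequences of simple processes whose `L²(dt)` distance vanishes in
probability have the same limit. -/
theorem IsScaledBM.tendstoInMeasure_integral_sub [IsProbabilityMeasure P] {X Y : ℝ≥0 → Ω → ℝ}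
    {c : ℝ≥0} {μ : ℝ} (hY : IsScaledBM P 𝓕 Y c) (hX : HasDriftDecomposition P X Y μ)
    {V V' : ℕ → SimpleProcess 𝓕} {s t : ℝ≥0} (hst : s ≤ t)
    (h : ∀ δ : ℝ, 0 < δ → Tendsto (fun m => P {ω | ENNReal.ofReal δ < ∫⁻ u in Set.Ioc (s : ℝ) t,
      ‖(V m).eval u.toNNReal ω - (V' m).eval u.toNNReal ω‖ₑ ^ 2}) atTop (𝓝 0)) :
    TendstoInMeasure P (fun m ω => (V m).integral X s t ω - (V' m).integral X s t ω) atTop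
      (fun _ => 0) := by
  rw [tendstoInMeasure_iff_norm]
  intro ε hε
  rw [ENNReal.tendsto_nhds_zero]
  intro κ hκ
  obtain ⟨δ, hδ, hδκ, hδε⟩ : ∃ δ > 0, ENNReal.ofReal (2 * c * δ / (ε / 2) ^ 2) < κ / 2 ∧
      μ ^ 2 * (δ * ((t : ℝ) - s)) < (ε / 2) ^ 2 := by
    have h1 : Tendsto (fun δ : ℝ => ENNReal.ofReal (2 * c * δ / (ε / 2) ^ 2)) (𝓝[>] 0) (𝓝 0) := by
      have : Continuous fun δ : ℝ => ENNReal.ofReal (2 * c * δ / (ε / 2) ^ 2) :=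
        ENNReal.continuous_ofReal.comp (by fun_prop)
      have h := (this.tendsto 0).mono_left (nhdsWithin_le_nhds (s := Set.Ioi 0))
      simpa using h
    have h2 : Tendsto (fun δ : ℝ => μ ^ 2 * (δ * ((t : ℝ) - s))) (𝓝[>] 0) (𝓝 0) := by
      have : Continuous fun δ : ℝ => μ ^ 2 * (δ * ((t : ℝ) - s)) := by fun_prop
      have h := (this.tendsto 0).mono_left (nhdsWithin_le_nhds (s := Set.Ioi 0))
      simpa using h
    obtain ⟨δ, ⟨h1, h2⟩, h3⟩ := (((h1.eventually_lt_const (ENNReal.half_pos hκ.ne')).and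
      (h2.eventually_lt_const (by positivity : 0 < (ε / 2) ^ 2))).and self_mem_nhdsWithin).exists
    exact ⟨δ, h3, h1, h2⟩
  filter_upwards [(h δ hδ).eventually_lt_const
    (ENNReal.half_pos (ENNReal.half_pos hκ.ne').ne')] with m hm
  obtain ⟨N, p, e, hp, h0, hN, hem, -, heX, hel⟩ := (V m).exists_common_grid (V' m) hst
  -- All intervals of the common grid form a single group.
  have hg : Monotone fun k : ℕ => k * N := fun a b hab => Nat.mul_le_mul_right N hab
  have hKL := hY.measure_groups_le hp (ξ := e) (g := fun k => k * N) hg (Nat.zero_mul N) 1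
    (fun q _ _ => hem q) (ε := (ε / 2) ^ 2) (by positivity) hδ.le
  simp only [one_mul] at hKL
  have hinc : ∀ᵐ ω ∂P, ∀ q, X (p (q + 1)) ω - X (p q) ω =
      μ * ((p (q + 1) : ℝ) - p q) + (Y (p (q + 1)) ω - Y (p q) ω) :=
    ae_all_iff.2 fun q => hX.sub_ae_eq _ _
  set A := {ω | ENNReal.ofReal δ < ∫⁻ u in Set.Ioc (s : ℝ) t,
      ‖(V m).eval u.toNNReal ω - (V' m).eval u.toNNReal ω‖ₑ ^ 2} with hA
  have hAe : {ω | δ < ∑ q ∈ Finset.range N, e q ω ^ 2 * ((p (q + 1) : ℝ) - p q)} = A := by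
    ext ω
    simp only [hA, Set.mem_ofPred_eq, hel]
    rw [ENNReal.ofReal_lt_ofReal_iff_of_nonneg hδ.le]
  rw [hAe] at hKL
  have hκ4 : κ / 2 / 2 + (κ / 2 / 2 + κ / 2) = κ := by
    rw [← add_assoc, ENNReal.add_halves, ENNReal.add_halves]
  refine le_trans (measure_mono_ae ?_) ((measure_union_le A _).trans
    ((add_le_add hm.le (hKL.trans (add_le_add hm.le hδκ.le))).trans_eq hκ4))
  filter_upwards [hinc] with ω hω hmem
  by_cases hωA : ω ∈ A
  · exact Or.inl hωA
  refine Or.inr (Set.mem_ofPred_eq ▸ ?_)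
  have hsmall : ∑ q ∈ Finset.range N, e q ω ^ 2 * ((p (q + 1) : ℝ) - p q) ≤ δ := by
    rw [← hAe] at hωA
    exact not_lt.1 hωA
  have hmem' : ε ≤ |(V m).integral X s t ω - (V' m).integral X s t ω| := by
    simpa using! hmem
  set U := ∑ q ∈ Finset.range N, e q ω * ((p (q + 1) : ℝ) - p q) with hU
  set M := ∑ q ∈ Finset.range N, e q ω * (Y (p (q + 1)) ω - Y (p q) ω) with hM
  have hsplit : (V m).integral X s t ω - (V' m).integral X s t ω = μ * U + M := by
    rw [heX, hU, hM, Finset.mul_sum, ← Finset.sum_add_distrib]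
    refine Finset.sum_congr rfl fun q _ => ?_
    rw [hω q]
    ring
  have hU2 : U ^ 2 ≤ δ * ((t : ℝ) - s) := by
    have := sum_sq_mul_le (N := N) hp fun q => e q ω
    rw [hN, h0] at this
    exact this.trans (mul_le_mul_of_nonneg_right hsmall (sub_nonneg.2 (NNReal.coe_le_coe.2 hst)))
  have hdrift : |μ * U| < ε / 2 := by
    refine abs_lt_of_sq_lt_sq ?_ (by positivity)
    rw [mul_pow]
    exact (mul_le_mul_of_nonneg_left hU2 (sq_nonneg μ)).trans_lt hδε
  have hM2 : ε / 2 ≤ |M| := by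
    rw [hsplit] at hmem'
    linarith [abs_add_le (μ * U) M]
  have hM3 : (ε / 2) ^ 2 ≤ M ^ 2 := by
    rw [← sq_abs M]
    exact pow_le_pow_left₀ (by positivity) hM2 2
  exact hM3.trans (le_add_of_nonneg_left (Finset.sum_nonneg fun k _ => sq_nonneg _))

/-- A Cauchy sequence in `L²` converges in probability. -/
theorem exists_tendstoInMeasure_of_cauchy [IsFiniteMeasure P] {f : ℕ → Ω → ℝ}
    (hf : ∀ m, MemLp (f m) 2 P) {a : ℕ × ℕ → ℝ} (ha : Tendsto a atTop (𝓝 0))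
    (hle : ∀ m, ∫ ω, (f m.1 ω - f m.2 ω) ^ 2 ∂P ≤ a m) :
    ∃ J, TendstoInMeasure P f atTop J := by
  have hc : CauchySeq fun m => (hf m).toLp (f m) := by
    rw [Lp.cauchySeq_Lp_iff_cauchySeq_eLpNorm]
    have hlim : Tendsto (fun m => ENNReal.ofReal (√(a m))) atTop (𝓝 0) := by
      have := ENNReal.tendsto_ofReal ha.sqrt
      simpa using this
    refine tendsto_of_tendsto_of_tendsto_of_le_of_le tendsto_const_nhds hlim (fun _ => zero_le)
      fun m => ?_
    have hd : MemLp (f m.1 - f m.2) 2 P := (hf m.1).sub (hf m.2)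
    rw [eLpNorm_congr_ae ((hf m.1).coeFn_toLp.sub (hf m.2).coeFn_toLp),
      hd.eLpNorm_eq_integral_rpow_norm two_ne_zero (by simp)]
    refine ENNReal.ofReal_le_ofReal ?_
    rw [Real.sqrt_eq_rpow]
    simp only [ENNReal.toReal_ofNat, Real.rpow_ofNat, Pi.sub_apply, Real.norm_eq_abs, sq_abs,
      one_div]
    exact Real.rpow_le_rpow (integral_nonneg fun ω => sq_nonneg _) (hle m) (by norm_num)
  obtain ⟨J, hJ⟩ := cauchySeq_tendsto_of_complete hc
  refine ⟨J, (tendstoInMeasure_of_tendsto_Lp hJ).congr_left fun m => (hf m).coeFn_toLp⟩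

theorem LPPricing.SimpleProcess.integral_ae_eq {X Y : ℝ≥0 → Ω → ℝ} {μ : ℝ}
    (hX : HasDriftDecomposition P X Y μ) (V : SimpleProcess 𝓕) (s t : ℝ≥0) :
    V.integral X s t =ᵐ[P] V.integral (fun u ω => μ * u + Y u ω) s t := by
  have h : ∀ᵐ ω ∂P, ∀ k, X (max s (min (V.time (k + 1)) t)) ω - X (max s (min (V.time k) t)) ω =
      μ * ((max s (min (V.time (k + 1)) t) : ℝ≥0) - (max s (min (V.time k) t) : ℝ≥0)) +
        (Y (max s (min (V.time (k + 1)) t)) ω - Y (max s (min (V.time k) t)) ω) :=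
    ae_all_iff.2 fun k => hX.sub_ae_eq _ _
  filter_upwards [h] with ω hω
  refine Finset.sum_congr rfl fun k _ => ?_
  rw [hω k]
  ring

theorem IsScaledBM.memLp_integral [IsProbabilityMeasure P] {Y : ℝ≥0 → Ω → ℝ} {c : ℝ≥0}
    (hY : IsScaledBM P 𝓕 Y c) (μ : ℝ) (V : SimpleProcess 𝓕) (s t : ℝ≥0) :
    MemLp (V.integral (fun u ω => μ * u + Y u ω) s t) 2 P := by
  obtain ⟨C, hC⟩ := V.val_bdd
  refine memLp_finsetSum _ fun k _ => ?_
  have h1 : MemLp (V.val k) ∞ P := memLp_top_of_bound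
    ((V.val_meas k).mono (𝓕.le _) le_rfl).aestronglyMeasurable C (Eventually.of_forall (hC k))
  have hle : max s (min (V.time k) t) ≤ max s (min (V.time (k + 1)) t) :=
    max_le_max_left s (min_le_min_right t (V.time_mono (Nat.le_succ k)))
  have h2 := (memLp_const (μ := P) (p := 2)
    (μ * ((max s (min (V.time (k + 1)) t) : ℝ≥0) - (max s (min (V.time k) t) : ℝ≥0)))).add
      (hY.memLp hle (p := 2) (by simp))
  refine (h2.mul h1).ae_eq (Eventually.of_forall fun ω => ?_)
  simp only [Pi.mul_apply, Pi.add_apply]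
  ring

/-- The elementary integrals of simple processes that converge to `w` in `L²(dt)`, uniformly in `ω`,
converge in probability: they form a Cauchy sequence in `L²`. -/
theorem IsScaledBM.exists_tendstoInMeasure_integral [IsProbabilityMeasure P] {X Y : ℝ≥0 → Ω → ℝ}
    {c : ℝ≥0} {μ : ℝ} (hY : IsScaledBM P 𝓕 Y c) (hX : HasDriftDecomposition P X Y μ)
    {v : ℕ → SimpleProcess 𝓕} {w : ℝ≥0 → ℝ} (hw : Measurable w) {s t : ℝ≥0} (hst : s ≤ t)
    {a : ℕ → ℝ} (ha0 : ∀ m, 0 ≤ a m) (ha : Tendsto a atTop (𝓝 0))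
    (hv : ∀ m ω, ∫⁻ u in Set.Ioc (s : ℝ) t, ‖(v m).eval u.toNNReal ω - w u.toNNReal‖ₑ ^ 2 ≤
      ENNReal.ofReal (a m)) :
    ∃ J, TendstoInMeasure P (fun m => (v m).integral X s t) atTop J := by
  have hts : 0 ≤ (t : ℝ) - s := sub_nonneg.2 (NNReal.coe_le_coe.2 hst)
  obtain ⟨J, hJ⟩ := exists_tendstoInMeasure_of_cauchy (P := P)
    (fun m => hY.memLp_integral μ (v m) s t)
    (a := fun m => (2 * a m.1 + 2 * a m.2) * (2 * μ ^ 2 * ((t : ℝ) - s) + 2 * c)) (by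
      rw [← prod_atTop_atTop_eq]
      have h1 : Tendsto (fun m : ℕ × ℕ => a m.1) (atTop ×ˢ atTop) (𝓝 0) := ha.comp tendsto_fst
      have h2 : Tendsto (fun m : ℕ × ℕ => a m.2) (atTop ×ˢ atTop) (𝓝 0) := ha.comp tendsto_snd
      have := ((h1.const_mul 2).add (h2.const_mul 2)).mul_const
        (2 * μ ^ 2 * ((t : ℝ) - s) + 2 * c)
      simpa using this) (by
      rintro ⟨m, n⟩
      obtain ⟨N, p, e, hp, h0, hN, hem, heb, heX, hel⟩ := (v m).exists_common_grid (v n) hst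
      set b := 2 * a m + 2 * a n with hb
      have hb0 : 0 ≤ b := add_nonneg (mul_nonneg zero_le_two (ha0 m)) (mul_nonneg zero_le_two (ha0 n))
      have hsum : ∀ ω, ∑ q ∈ Finset.range N, e q ω ^ 2 * ((p (q + 1) : ℝ) - p q) ≤ b := by
        intro ω
        rw [← ENNReal.ofReal_le_ofReal_iff hb0, ← hel]
        refine (lintegral_enorm_sub_sq_le (h := fun u => w u.toNNReal)
          (((v m).measurable_eval_left ω).comp measurable_real_toNNReal)
          (hw.comp measurable_real_toNNReal)).trans ?_
        rw [hb, ENNReal.ofReal_add (mul_nonneg zero_le_two (ha0 m)) (mul_nonneg zero_le_two (ha0 n)),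
          ENNReal.ofReal_mul zero_le_two, ENNReal.ofReal_mul zero_le_two]
        simp only [ENNReal.ofReal_ofNat]
        exact add_le_add (mul_le_mul_right (hv m ω) 2) (mul_le_mul_right (hv n ω) 2)
      have hg : Monotone fun k : ℕ => k * N := fun a b hab => Nat.mul_le_mul_right N hab
      obtain ⟨hint, hE⟩ := hY.integral_groups hp hem heb hg 1
      simp only [Finset.sum_range_one, zero_add, zero_mul, one_mul, ← Finset.range_eq_Ico] at hint hE
      have hEle : ∫ ω, ∑ q ∈ Finset.range N, e q ω ^ 2 * ((p (q + 1) : ℝ) - p q) ∂P ≤ b := by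
        have h1 := integral_mono_of_nonneg (μ := P) (g := fun _ => b)
          (Eventually.of_forall fun ω => Finset.sum_nonneg fun q _ => mul_nonneg (sq_nonneg (e q ω))
            (sub_nonneg.2 (NNReal.coe_le_coe.2 (hp (Nat.le_succ q)))))
          (integrable_const b) (Eventually.of_forall hsum)
        simpa using h1
      have hmono := integral_mono_of_nonneg (μ := P)
        (f := fun ω => ((v m).integral (fun u ω => μ * u + Y u ω) s t ω -
          (v n).integral (fun u ω => μ * u + Y u ω) s t ω) ^ 2)
        (Eventually.of_forall fun ω => sq_nonneg _)
        ((integrable_const (2 * μ ^ 2 * (b * ((t : ℝ) - s)))).add hint)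
        (Eventually.of_forall fun ω => by
          simp only [Pi.add_apply, heX]
          set U := ∑ q ∈ Finset.range N, e q ω * ((p (q + 1) : ℝ) - p q) with hU
          set M := ∑ q ∈ Finset.range N, e q ω * (Y (p (q + 1)) ω - Y (p q) ω) with hM
          have hsplit : ∑ q ∈ Finset.range N, e q ω * (μ * (p (q + 1) : ℝ) + Y (p (q + 1)) ω -
              (μ * (p q : ℝ) + Y (p q) ω)) = μ * U + M := by
            rw [hU, hM, Finset.mul_sum, ← Finset.sum_add_distrib]
            exact Finset.sum_congr rfl fun q _ => by ring
          have hU2 : U ^ 2 ≤ b * ((t : ℝ) - s) := by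
            have := sum_sq_mul_le (N := N) hp fun q => e q ω
            rw [hN, h0] at this
            exact this.trans (mul_le_mul_of_nonneg_right (hsum ω) hts)
          rw [hsplit]
          nlinarith [sq_nonneg (μ * U - M), mul_le_mul_of_nonneg_left hU2 (sq_nonneg μ)])
      refine hmono.trans ?_
      have e1 := integral_add (integrable_const (2 * μ ^ 2 * (b * ((t : ℝ) - s)))) hint
      simp only [Pi.add_apply] at e1 ⊢
      rw [e1, hE]
      simp only [integral_const, probReal_univ, one_smul]
      have := mul_le_mul_of_nonneg_left hEle (by positivity : (0 : ℝ) ≤ 2 * c)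
      nlinarith)
  exact ⟨J, hJ.congr_left fun m => ((v m).integral_ae_eq hX s t).symm⟩

/-- The limit of the elementary integrals along one approximating sequence that is uniform in `ω` is
the Itô integral. -/
theorem IsScaledBM.isItoIntegral_of_tendstoInMeasure [IsProbabilityMeasure P]
    {X Y : ℝ≥0 → Ω → ℝ} {c : ℝ≥0} {μ : ℝ} (hY : IsScaledBM P 𝓕 Y c)
    (hX : HasDriftDecomposition P X Y μ)
    {v : ℕ → SimpleProcess 𝓕} {w : ℝ≥0 → ℝ} (hw : Measurable w) {s t : ℝ≥0} (hst : s ≤ t)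
    {a : ℕ → ℝ} (ha : Tendsto a atTop (𝓝 0))
    (hv : ∀ m ω, ∫⁻ u in Set.Ioc (s : ℝ) t, ‖(v m).eval u.toNNReal ω - w u.toNNReal‖ₑ ^ 2 ≤
      ENNReal.ofReal (a m)) {J : Ω → ℝ}
    (hJ : TendstoInMeasure P (fun m => (v m).integral X s t) atTop J) :
    IsItoIntegral P 𝓕 (fun u _ => w u) X s t J := by
  have ha' : Tendsto (fun m => ENNReal.ofReal (a m)) atTop (𝓝 0) := by
    simpa using ENNReal.tendsto_ofReal ha
  have hvε : ∀ ε : ℝ≥0∞, 0 < ε → ∀ᶠ m in atTop, ∀ ω, ∫⁻ u in Set.Ioc (s : ℝ) t,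
      ‖(v m).eval u.toNNReal ω - w u.toNNReal‖ₑ ^ 2 < ε := by
    intro ε hε
    filter_upwards [ha'.eventually_lt_const hε] with m hm ω
    exact (hv m ω).trans_lt hm
  refine ⟨⟨v, fun ε hε => ?_⟩, fun V hV => ?_⟩
  · refine tendsto_const_nhds.congr' ?_
    filter_upwards [hvε ε hε] with m hm
    rw [eq_comm, measure_eq_zero_iff_ae_notMem]
    exact Eventually.of_forall fun ω => not_le.2 (hm ω)
  · have h := hY.tendstoInMeasure_integral_sub hX (V := V) (V' := v) hst (by
      intro δ hδ
      have hδ4 : 0 < ENNReal.ofReal (δ / 4) := ENNReal.ofReal_pos.2 (by positivity)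
      refine tendsto_of_tendsto_of_tendsto_of_le_of_le' tendsto_const_nhds (hV _ hδ4)
        (Eventually.of_forall fun _ => zero_le) ?_
      filter_upwards [hvε _ hδ4] with m hm
      refine measure_mono fun ω hω => ?_
      by_contra hcon
      have h1 := lintegral_enorm_sub_sq_le (f := fun u => (V m).eval u.toNNReal ω)
        (g := fun u => (v m).eval u.toNNReal ω) (h := fun u => w u.toNNReal)
        (s := Set.Ioc (s : ℝ) t)
        (((V m).measurable_eval_left ω).comp measurable_real_toNNReal)
        (hw.comp measurable_real_toNNReal)
      have h2 : ∫⁻ u in Set.Ioc (s : ℝ) t, ‖(V m).eval u.toNNReal ω - w u.toNNReal‖ₑ ^ 2 ≤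
          ENNReal.ofReal (δ / 4) := (not_le.1 hcon).le
      have h3 : ENNReal.ofReal δ < ∫⁻ u in Set.Ioc (s : ℝ) t,
          ‖(V m).eval u.toNNReal ω - (v m).eval u.toNNReal ω‖ₑ ^ 2 := hω
      refine absurd h3 (not_lt.2 (h1.trans
        ((add_le_add (mul_le_mul_right h2 2) (mul_le_mul_right (hm ω).le 2)).trans_eq ?_)))
      rw [← ENNReal.ofReal_ofNat 2, ← ENNReal.ofReal_mul (by norm_num),
        ← ENNReal.ofReal_add (by positivity) (by positivity)]
      congr 1
      ring)
    have h' := h.add_real hJ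
    simpa using h'

theorem isItoIntegral_itoIntegral {H X : ℝ≥0 → Ω → ℝ} {s t : ℝ≥0} {J : Ω → ℝ}
    (h : IsItoIntegral P 𝓕 H X s t J) :
    IsItoIntegral P 𝓕 H X s t (itoIntegral P 𝓕 H X s t) := by
  have hex : ∃ J, IsItoIntegral P 𝓕 H X s t J := ⟨J, h⟩
  unfold itoIntegral
  rw [dif_pos hex]
  exact hex.choose_spec

theorem LPPricing.Approximates.mono {V : ℕ → SimpleProcess 𝓕} {H : ℝ≥0 → Ω → ℝ} {s t s' t' : ℝ≥0}
    (h : Approximates P V H s t) (hs : s ≤ s') (ht : t' ≤ t) : Approximates P V H s' t' :=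
  fun ε hε => tendsto_of_tendsto_of_tendsto_of_le_of_le tendsto_const_nhds (h ε hε)
    (fun _ => zero_le) fun _ => measure_mono fun _ hω => le_trans hω
      (lintegral_mono_set (Set.Ioc_subset_Ioc (NNReal.coe_le_coe.2 hs) (NNReal.coe_le_coe.2 ht)))

theorem LPPricing.SimpleProcess.integral_add_integral (V : SimpleProcess 𝓕) (X : ℝ≥0 → Ω → ℝ)
    {s t u : ℝ≥0} (hst : s ≤ t) (htu : t ≤ u) (ω : Ω) :
    V.integral X s t ω + V.integral X t u ω = V.integral X s u ω := by
  have key : ∀ x, X (max s (min x u)) ω =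
      X (max s (min x t)) ω + X (max t (min x u)) ω - X t ω := by
    intro x
    rcases le_total x t with h | h
    · rw [min_eq_left h, min_eq_left (h.trans htu), max_eq_left h]
      ring
    · rw [min_eq_right h, max_eq_right hst, max_eq_right (hst.trans (le_min h htu)),
        max_eq_right (le_min h htu)]
      ring
  simp only [SimpleProcess.integral, ← Finset.sum_add_distrib]
  refine Finset.sum_congr rfl fun k _ => ?_
  rw [key (V.time (k + 1)), key (V.time k)]
  ring

theorem LPPricing.IsItoIntegral.ae_eq_add {H X : ℝ≥0 → Ω → ℝ} {s t u : ℝ≥0} (hst : s ≤ t)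
    (htu : t ≤ u) {J₁ J₂ J : Ω → ℝ} (h₁ : IsItoIntegral P 𝓕 H X s t J₁)
    (h₂ : IsItoIntegral P 𝓕 H X t u J₂) (h : IsItoIntegral P 𝓕 H X s u J) :
    J =ᵐ[P] fun ω => J₁ ω + J₂ ω := by
  obtain ⟨V, hV⟩ := h.1
  have h3 := (h₁.2 V (hV.mono le_rfl htu)).add_real (h₂.2 V (hV.mono hst le_rfl))
  refine tendstoInMeasure_ae_unique (h.2 V hV) ?_
  simpa only [SimpleProcess.integral_add_integral _ _ hst htu] using! h3

theorem LPPricing.SimpleProcess.measurable_integral_of_adapted (V : SimpleProcess 𝓕)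
    {X : ℝ≥0 → Ω → ℝ} (hX : Adapted 𝓕 X) {s t : ℝ≥0} (hst : s ≤ t) :
    Measurable[𝓕 t] (V.integral X s t) := by
  refine Finset.measurable_sum _ fun k _ => ?_
  have hle : ∀ x, max s (min x t) ≤ t := fun x => max_le hst (min_le_right _ _)
  by_cases hk : V.time k ≤ t
  · exact ((V.val_meas k).mono (𝓕.mono hk) le_rfl).mul
      (((hX _).mono (𝓕.mono (hle _)) le_rfl).sub ((hX _).mono (𝓕.mono (hle _)) le_rfl))
  · have h1 : t ≤ V.time k := (not_le.1 hk).le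
    have h2 : t ≤ V.time (k + 1) := h1.trans (V.time_mono (Nat.le_succ k))
    simp only [min_eq_right h1, min_eq_right h2, sub_self, mul_zero]
    exact measurable_const

/-- The Itô integral over `[s, t]` agrees almost surely with an `𝓕 t`-measurable random variable. The
filtration need not be complete, so that strict `𝓕 t`-measurability cannot be expected. -/
theorem LPPricing.IsItoIntegral.exists_measurable_ae_eq {H X : ℝ≥0 → Ω → ℝ} (hX : Adapted 𝓕 X)
    {s t : ℝ≥0} (hst : s ≤ t) {J : Ω → ℝ} (h : IsItoIntegral P 𝓕 H X s t J) :
    ∃ J', Measurable[𝓕 t] J' ∧ J =ᵐ[P] J' := by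
  obtain ⟨V, hV⟩ := h.1
  obtain ⟨ns, -, hns⟩ := (h.2 V hV).exists_seq_tendsto_ae
  refine ⟨fun ω => limsup (fun i => (V (ns i)).integral X s t ω) atTop,
    Measurable.limsup fun i => (V (ns i)).measurable_integral_of_adapted hX hst, ?_⟩
  filter_upwards [hns] with ω hω
  exact hω.limsup_eq.symm

end ItoIntegral

/-! ### Cell averages of the weights -/

section CellAverage

/-- The index `k` of the cell `(k / (m + 1), (k + 1) / (m + 1)]` that contains `u > 0`. For `u = 0` the
value is `0`. -/
noncomputable def cellIndex (m : ℕ) (u : ℝ≥0) : ℕ := ⌈u * (m + 1)⌉₊ - 1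

/-- The average of `w` over the `k`-th cell, written as a ball around its midpoint. -/
noncomputable def cellAverage (w : ℝ≥0 → ℝ) (m k : ℕ) : ℝ :=
  ⨍ u in Metric.closedBall (((k : ℝ) + 1 / 2) / (m + 1)) (1 / 2 / (m + 1)), w u.toNNReal

theorem cellIndex_eq {m k : ℕ} {u : ℝ≥0} (hu : u ∈ Set.Ioc ((k : ℝ≥0) / (m + 1)) ((k + 1) / (m + 1))) :
    cellIndex m u = k := by
  have hm : (0 : ℝ≥0) < m + 1 := by positivity
  have h1 : (k : ℝ≥0) < u * (m + 1) := (div_lt_iff₀ hm).1 hu.1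
  have h2 : u * (m + 1) ≤ k + 1 := (le_div_iff₀ hm).1 hu.2
  have h3 : ⌈u * (m + 1)⌉₊ = k + 1 := by
    refine (Nat.ceil_eq_iff (Nat.succ_ne_zero k)).2 ⟨?_, ?_⟩
    · simpa using h1
    · exact_mod_cast h2
  simp [cellIndex, h3]

theorem mem_cell_cellIndex (m : ℕ) {u : ℝ≥0} (hu : 0 < u) :
    u ∈ Set.Ioc ((cellIndex m u : ℝ≥0) / (m + 1)) ((cellIndex m u + 1) / (m + 1)) := by
  have hm : (0 : ℝ≥0) < m + 1 := by positivity
  have hpos : 0 < ⌈u * (m + 1)⌉₊ := Nat.ceil_pos.2 (by positivity)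
  have e : cellIndex m u + 1 = ⌈u * (m + 1)⌉₊ := Nat.sub_add_cancel hpos
  constructor
  · rw [div_lt_iff₀ hm]
    exact Nat.lt_ceil.1 (e ▸ Nat.lt_succ_self _)
  · rw [le_div_iff₀ hm]
    have : ((cellIndex m u + 1 : ℕ) : ℝ≥0) = ⌈u * (m + 1)⌉₊ := by rw [e]
    push_cast at this
    rw [this]
    exact Nat.le_ceil _

theorem measurable_cellIndex (m : ℕ) : Measurable (cellIndex m) :=
  (measurable_from_nat (f := fun k : ℕ => k - 1)).comp
    (Nat.measurable_ceil.comp (measurable_id.mul_const _))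

variable {w : ℝ≥0 → ℝ} {C : ℝ}

theorem abs_cellAverage_le (hC : ∀ u, |w u| ≤ C) (m k : ℕ) : |cellAverage w m k| ≤ C := by
  have hm : (0 : ℝ) < 1 / 2 / (m + 1) := by positivity
  set s := Metric.closedBall (((k : ℝ) + 1 / 2) / (m + 1)) (1 / 2 / (m + 1)) with hs
  have hfin : volume s < ∞ := measure_closedBall_lt_top
  have hpos : 0 < volume.real s :=
    ENNReal.toReal_pos (Metric.measure_closedBall_pos _ _ hm).ne' hfin.ne
  have h := norm_setIntegral_le_of_norm_le_const (μ := volume) (f := fun u : ℝ => w u.toNNReal) hfin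
    (C := C) fun u _ => hC _
  unfold cellAverage
  rw [setAverage_eq, smul_eq_mul, abs_mul, abs_of_pos (inv_pos.2 hpos), inv_mul_le_iff₀ hpos, mul_comm]
  exact h

/-- Lebesgue's differentiation theorem for the cell averages. -/
theorem ae_tendsto_cellAverage (hw : Measurable w) (hC : ∀ u, |w u| ≤ C) :
    ∀ᵐ u : ℝ, 0 < u →
      Tendsto (fun m => cellAverage w m (cellIndex m u.toNNReal)) atTop (𝓝 (w u.toNNReal)) := by
  have hwr : Measurable fun u : ℝ => w u.toNNReal := hw.comp measurable_real_toNNReal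
  have hloc : LocallyIntegrable (fun u : ℝ => w u.toNNReal) volume := by
    refine (locallyIntegrable_const C).mono hwr.aestronglyMeasurable (Eventually.of_forall fun u => ?_)
    exact (hC _).trans (le_abs_self C)
  filter_upwards [IsUnifLocDoublingMeasure.ae_tendsto_average volume hloc 1] with u hu hu0
  refine hu (l := atTop) (fun m : ℕ => ((cellIndex m u.toNNReal : ℝ) + 1 / 2) / (m + 1))
    (fun m : ℕ => 1 / 2 / ((m : ℝ) + 1)) ?_ (Eventually.of_forall fun m => ?_)
  · refine tendsto_nhdsWithin_iff.2 ⟨?_, Eventually.of_forall fun m => ?_⟩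
    · have := (tendsto_one_div_add_atTop_nhds_zero_nat (𝕜 := ℝ)).const_mul (1 / 2)
      rw [mul_zero] at this
      refine this.congr fun m => ?_
      ring
    · exact Set.mem_Ioi.2 (by positivity)
  · obtain ⟨h1, h2⟩ := mem_cell_cellIndex m (Real.toNNReal_pos.2 hu0)
    rw [← NNReal.coe_lt_coe] at h1
    rw [← NNReal.coe_le_coe] at h2
    push_cast at h1 h2
    rw [Real.coe_toNNReal u hu0.le] at h1 h2
    have hm : (0 : ℝ) < m + 1 := by positivity
    rw [one_mul, Metric.mem_closedBall, Real.dist_eq, abs_le]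
    rw [div_lt_iff₀ hm] at h1
    rw [le_div_iff₀ hm] at h2
    constructor
    · rw [← sub_nonneg]
      have : u - (↑(cellIndex m u.toNNReal) + 1 / 2) / (↑m + 1) - -(1 / 2 / (↑m + 1)) =
          (u * (m + 1) - cellIndex m u.toNNReal) / (m + 1) := by field_simp; ring
      rw [this]
      exact div_nonneg (by linarith) hm.le
    · rw [← sub_nonneg]
      have : 1 / 2 / ((m : ℝ) + 1) - (u - (↑(cellIndex m u.toNNReal) + 1 / 2) / (↑m + 1)) =
          (cellIndex m u.toNNReal + 1 - u * (m + 1)) / (m + 1) := by field_simp; ring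
      rw [this]
      exact div_nonneg (by linarith) hm.le

/-- The clamped cell end points, which form a partition of `[s, t]`. -/
noncomputable def cellPoint (s t : ℝ≥0) (m k : ℕ) : ℝ≥0 := max s (min ((k : ℝ≥0) / (m + 1)) t)

theorem cellPoint_mono (s t : ℝ≥0) (m : ℕ) : Monotone (cellPoint s t m) := fun a b hab => by
  unfold cellPoint
  gcongr

theorem cellPoint_zero (s t : ℝ≥0) (m : ℕ) : cellPoint s t m 0 = s := by simp [cellPoint]

theorem cellPoint_num {s t T : ℝ≥0} (hst : s ≤ t) (htT : t ≤ T) (m : ℕ) :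
    cellPoint s t m (⌈T⌉₊ * (m + 1)) = t := by
  have hm : (0 : ℝ≥0) < m + 1 := by positivity
  have h : t ≤ ((⌈T⌉₊ * (m + 1) : ℕ) : ℝ≥0) / (m + 1) := by
    push_cast
    rw [mul_div_cancel_right₀ _ hm.ne']
    exact htT.trans (Nat.le_ceil T)
  rw [cellPoint, min_eq_right h, max_eq_right hst]

theorem cellIndex_eq_of_mem_Ioc_cellPoint {s t : ℝ≥0} (hst : s ≤ t) {m k : ℕ} {u : ℝ≥0}
    (hu : u ∈ Set.Ioc (cellPoint s t m k) (cellPoint s t m (k + 1))) : cellIndex m u = k := by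
  have hlt : cellPoint s t m k < cellPoint s t m (k + 1) := hu.1.trans_le hu.2
  refine cellIndex_eq ⟨?_, ?_⟩
  · by_contra hcon
    have h1 : u ≤ (k : ℝ≥0) / (m + 1) := not_lt.1 hcon
    have h2 : u ≤ t := hu.2.trans (max_le hst (min_le_right _ _))
    exact absurd hu.1 (not_lt.2 (le_max_of_le_right (le_min h1 h2)))
  · by_contra hcon
    have h1 : ((k : ℝ≥0) + 1) / (m + 1) < u := not_le.1 hcon
    have h2 : u ≤ max s (min (((k : ℝ≥0) + 1) / (m + 1)) t) := by simpa [cellPoint] using hu.2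
    have h3 : s < u := (le_max_left _ _).trans_lt hu.1
    exact absurd h2 (not_le.2 (max_lt h3 ((min_le_left _ _).trans_lt h1)))

/-- The integral of a function that is constant on the cells. -/
theorem integral_cellIndex_eq_sum {s t T : ℝ≥0} (hst : s ≤ t) (htT : t ≤ T) (m : ℕ) (Φ : ℕ → ℝ) :
    ∫ u in (s : ℝ)..t, Φ (cellIndex m u.toNNReal) =
      ∑ k ∈ Finset.range (⌈T⌉₊ * (m + 1)),
        Φ k * ((cellPoint s t m (k + 1) : ℝ) - cellPoint s t m k) := by
  have hle : ∀ k, (cellPoint s t m k : ℝ) ≤ cellPoint s t m (k + 1) := fun k =>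
    NNReal.coe_le_coe.2 (cellPoint_mono s t m (Nat.le_succ k))
  have hEq : ∀ k, Set.EqOn (fun _ => Φ k) (fun u : ℝ => Φ (cellIndex m u.toNNReal))
      (Set.uIoc (cellPoint s t m k : ℝ) (cellPoint s t m (k + 1))) := by
    intro k u hu
    rw [Set.uIoc_of_le (hle k)] at hu
    have hu0 : 0 ≤ u := (NNReal.coe_nonneg _).trans hu.1.le
    have : cellIndex m u.toNNReal = k := cellIndex_eq_of_mem_Ioc_cellPoint hst (by
      constructor
      · rw [← NNReal.coe_lt_coe, Real.coe_toNNReal u hu0]; exact hu.1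
      · rw [← NNReal.coe_le_coe, Real.coe_toNNReal u hu0]; exact hu.2)
    simp only [this]
  have h := intervalIntegral.sum_integral_adjacent_intervals (μ := volume)
    (f := fun u : ℝ => Φ (cellIndex m u.toNNReal)) (a := fun k => (cellPoint s t m k : ℝ))
    (n := ⌈T⌉₊ * (m + 1)) fun k _ => (intervalIntegrable_const (c := Φ k)).congr (hEq k)
  rw [cellPoint_zero, cellPoint_num hst htT] at h
  rw [← h]
  refine Finset.sum_congr rfl fun k _ => ?_
  rw [← intervalIntegral.integral_congr_ae (Eventually.of_forall fun u hu => hEq k hu),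
    intervalIntegral.integral_const, smul_eq_mul,
    mul_comm]

variable {Ω : Type*} [mΩ : MeasurableSpace Ω] {𝓕 : Filtration ℝ≥0 mΩ}

/-- The simple process on `(0, ⌈T⌉]` whose value on each cell is the average of `w` over the cell. -/
noncomputable def cellProcess (𝓕 : Filtration ℝ≥0 mΩ) (hC : ∀ u, |w u| ≤ C) (T : ℝ≥0) (m : ℕ) :
    SimpleProcess 𝓕 where
  num := ⌈T⌉₊ * (m + 1)
  time k := (k : ℝ≥0) / (m + 1)
  time_mono _ _ hab := div_le_div_of_nonneg_right (Nat.cast_le.2 hab) zero_le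
  val k _ := cellAverage w m k
  val_meas _ := measurable_const
  val_bdd := ⟨C, fun k _ => abs_cellAverage_le hC m k⟩

theorem cellProcess_eval (hC : ∀ u, |w u| ≤ C) {T : ℝ≥0} (m : ℕ) {u : ℝ≥0} (hu : 0 < u)
    (huT : u ≤ T) (ω : Ω) :
    (cellProcess 𝓕 hC T m).eval u ω = cellAverage w m (cellIndex m u) := by
  have hm : (0 : ℝ≥0) < m + 1 := by positivity
  have hmem := mem_cell_cellIndex m hu
  refine SimpleProcess.eval_eq_val (cellProcess 𝓕 hC T m) (k := cellIndex m u) ?_ ?_ ω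
  · change cellIndex m u < ⌈T⌉₊ * (m + 1)
    have h : (cellIndex m u : ℝ≥0) < ⌈T⌉₊ * (m + 1) := by
      rw [← div_lt_iff₀ hm]
      exact hmem.1.trans_le (huT.trans (Nat.le_ceil T))
    exact_mod_cast h
  · simpa [cellProcess] using hmem

theorem cellProcess_integral (hC : ∀ u, |w u| ≤ C) (T : ℝ≥0) (m : ℕ) (X : ℝ≥0 → Ω → ℝ) (s t : ℝ≥0)
    (ω : Ω) :
    (cellProcess 𝓕 hC T m).integral X s t ω = ∑ k ∈ Finset.range (⌈T⌉₊ * (m + 1)),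
      cellAverage w m k * (X (cellPoint s t m (k + 1)) ω - X (cellPoint s t m k) ω) := by
  simp [SimpleProcess.integral, cellProcess, cellPoint]

/-- The cell averages converge to `w` in `L²(0, T)`. -/
theorem exists_lintegral_cellProcess_le (hw : Measurable w) (hC : ∀ u, |w u| ≤ C) (T : ℝ≥0) :
    ∃ a : ℕ → ℝ, (∀ m, 0 ≤ a m) ∧ Tendsto a atTop (𝓝 0) ∧
      ∀ (s t : ℝ≥0), t ≤ T → ∀ (𝓕 : Filtration ℝ≥0 mΩ) m ω, ∫⁻ u in Set.Ioc (s : ℝ) t,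
        ‖(cellProcess 𝓕 hC T m).eval u.toNNReal ω - w u.toNNReal‖ₑ ^ 2 ≤ ENNReal.ofReal (a m) := by
  set f : ℕ → ℝ → ℝ := fun m u => (cellAverage w m (cellIndex m u.toNNReal) - w u.toNNReal) ^ 2
    with hf
  have hfm : ∀ m, Measurable (f m) := fun m =>
    (((measurable_from_nat (f := cellAverage w m)).comp ((measurable_cellIndex m).comp
      measurable_real_toNNReal)).sub (hw.comp measurable_real_toNNReal)).pow_const 2
  have hfb : ∀ m u, ‖f m u‖ ≤ (2 * C) ^ 2 := by
    intro m u
    rw [Real.norm_of_nonneg (sq_nonneg _), ← sq_abs]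
    refine pow_le_pow_left₀ (abs_nonneg _) ?_ 2
    refine (abs_sub _ _).trans ?_
    linarith [abs_cellAverage_le hC m (cellIndex m u.toNNReal), hC u.toNNReal]
  have hfi : ∀ m, IntegrableOn (f m) (Set.Ioc (0 : ℝ) T) := fun m =>
    Measure.integrableOn_of_bounded (by simp) (hfm m).aestronglyMeasurable
      (Eventually.of_forall (hfb m))
  refine ⟨fun m => ∫ u in Set.Ioc (0 : ℝ) T, f m u, fun m => integral_nonneg fun u => sq_nonneg _,
    ?_, fun s t htT 𝓕 m ω => ?_⟩
  · have h := tendsto_integral_of_dominated_convergence (μ := volume.restrict (Set.Ioc (0 : ℝ) T))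
      (F := f) (f := fun _ => 0) (fun _ => (2 * C) ^ 2) (fun m => (hfm m).aestronglyMeasurable)
      (integrable_const _) (fun m => Eventually.of_forall (hfb m)) (by
        rw [ae_restrict_iff' measurableSet_Ioc]
        filter_upwards [ae_tendsto_cellAverage hw hC] with u hu hmem
        have := ((hu hmem.1).sub_const (w u.toNNReal)).pow 2
        simpa using this)
    simpa using h
  · rw [ofReal_integral_eq_lintegral_ofReal (hfi m) (Eventually.of_forall fun u => sq_nonneg _)]
    refine le_trans (lintegral_mono_set (Set.Ioc_subset_Ioc (NNReal.coe_nonneg s)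
      (NNReal.coe_le_coe.2 htT))) (le_of_eq (setLIntegral_congr_fun measurableSet_Ioc fun u hu => ?_))
    simp only [hf]
    rw [cellProcess_eval hC m (Real.toNNReal_pos.2 hu.1) (Real.toNNReal_le_iff_le_coe.2 hu.2),
      enorm_sq_eq_ofReal]

/-- Bounded continuous functions of finitely many cell averages converge under the integral. -/
theorem tendsto_integral_cellAverage {n : ℕ} {w : Fin n → ℝ≥0 → ℝ} (hw : ∀ i, Measurable (w i))
    (hC : ∀ i u, |w i u| ≤ C) {Ψ : (Fin n → ℝ) → ℝ} (hΨ : Continuous Ψ) (s t : ℝ≥0) :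
    Tendsto (fun m => ∫ u in (s : ℝ)..t, Ψ fun i => cellAverage (w i) m (cellIndex m u.toNNReal))
      atTop (𝓝 (∫ u in (s : ℝ)..t, Ψ fun i => w i u.toNNReal)) := by
  obtain ⟨K, hK⟩ := (isCompact_closedBall (0 : Fin n → ℝ) |C|).bddAbove_image
    (f := fun x => ‖Ψ x‖) hΨ.norm.continuousOn
  refine intervalIntegral.tendsto_integral_filter_of_dominated_convergence (fun _ => K)
    (Eventually.of_forall fun m => ?_) (Eventually.of_forall fun m => ?_) (by simp) ?_
  · refine (hΨ.measurable.comp (measurable_pi_lambda _ fun i => ?_)).aestronglyMeasurable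
    exact (measurable_from_nat (f := cellAverage (w i) m)).comp ((measurable_cellIndex m).comp
      measurable_real_toNNReal)
  · refine Eventually.of_forall fun u _ => hK ⟨_, ?_, rfl⟩
    rw [mem_closedBall_zero_iff, pi_norm_le_iff_of_nonneg (abs_nonneg C)]
    exact fun i => (abs_cellAverage_le (hC i) m _).trans (le_abs_self C)
  · have hall : ∀ᵐ u : ℝ, ∀ i, 0 < u → Tendsto
        (fun m => cellAverage (w i) m (cellIndex m u.toNNReal)) atTop (𝓝 (w i u.toNNReal)) :=
      ae_all_iff.2 fun i => ae_tendsto_cellAverage (hw i) (hC i)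
    filter_upwards [hall] with u hu hmem
    have hu0 : 0 < u := (le_min s.coe_nonneg t.coe_nonneg).trans_lt hmem.1
    exact (hΨ.tendsto _).comp (tendsto_pi_nhds.2 fun i => hu i hu0)

end CellAverage

/-! ### Gaussian laws by characteristic functions -/

section GaussianLaw

variable {Ω : Type*} [mΩ : MeasurableSpace Ω] {P : Measure Ω}
  {𝓕 : Filtration ℝ≥0 mΩ} {d : ℕ} {B : Fin d → ℝ≥0 → Ω → ℝ}

/-- The characteristic function of a weighted sum of consecutive increments of `B`, on an event
from the past: one increment at a time is integrated out, starting with the last. -/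
theorem LPPricing.IsStandardBrownianMotion.setIntegral_cexp_sum (hB : IsStandardBrownianMotion P 𝓕 B)
    {τ : ℕ → ℝ≥0} (hτ : Monotone τ) (b : ℕ → Fin d → ℝ) {A : Set Ω}
    (hA : MeasurableSet[𝓕 (τ 0)] A) (x : ℝ) (N : ℕ) :
    ∫ ω in A, Complex.exp (x * (∑ q ∈ Finset.range N,
        ∑ j, b q j * (B j (τ (q + 1)) ω - B j (τ q) ω) : ℝ) * Complex.I) ∂P =
      P.real A * Complex.exp (-(x ^ 2 / 2 * ∑ q ∈ Finset.range N,
        (∑ j, b q j ^ 2) * ((τ (q + 1) : ℝ) - τ q) : ℝ)) := by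
  induction N with
  | zero => simp [Measure.real]
  | succ N ih =>
    have hA' : MeasurableSet A := 𝓕.le _ _ hA
    set c : ℝ≥0 := ⟨∑ j, b N j ^ 2, Finset.sum_nonneg fun j _ => sq_nonneg _⟩ with hc
    have hX := hB.isScaledBM (b N) c rfl
    set Q : Ω → ℝ := fun ω => ∑ q ∈ Finset.range N,
      ∑ j, b q j * (B j (τ (q + 1)) ω - B j (τ q) ω) with hQ
    set D : Ω → ℝ := fun ω => ∑ j, b N j * B j (τ (N + 1)) ω - ∑ j, b N j * B j (τ N) ω with hD
    have hQm : Measurable[𝓕 (τ N)] Q := by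
      refine Finset.measurable_sum _ fun q hq => Finset.measurable_sum _ fun j _ => ?_
      have hq' : q + 1 ≤ N := Finset.mem_range.1 hq
      exact ((((hB.adapted j _).mono (𝓕.mono (hτ hq')) le_rfl)).sub
        ((hB.adapted j _).mono (𝓕.mono (hτ (by omega))) le_rfl)).const_mul _
    have hmul : Measurable fun y : ℝ => Complex.exp (x * y * Complex.I) := by fun_prop
    set Y : Ω → ℂ := A.indicator fun ω => Complex.exp (x * (Q ω : ℂ) * Complex.I) with hY
    have hYm : Measurable[𝓕 (τ N)] Y :=
      (hmul.comp hQm).indicator (𝓕.mono (hτ (Nat.zero_le N)) _ hA)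
    have hind : IndepFun Y (fun ω => Complex.exp (x * (D ω : ℂ) * Complex.I)) P :=
      (hX.indepFun (hτ (Nat.le_succ N)) hYm).comp measurable_id hmul
    have hDm : Measurable D := (hX.measurable _).sub (hX.measurable _)
    have hmain := hind.integral_fun_mul_eq_mul_integral
      (hYm.mono (𝓕.le _) le_rfl).aestronglyMeasurable (hmul.comp hDm).aestronglyMeasurable
    have hchar : ∫ ω, Complex.exp (x * (D ω : ℂ) * Complex.I) ∂P =
        Complex.exp (-(x ^ 2 / 2 * (c * ((τ (N + 1) : ℝ) - τ N)) : ℝ)) := by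
      have h1 := integral_map (μ := P) hDm.aemeasurable (f := fun y : ℝ =>
        Complex.exp (x * y * Complex.I)) hmul.aestronglyMeasurable
      rw [← h1, hX.law _ _ (hτ (Nat.le_succ N)), ← charFun_apply_real, charFun_gaussianReal]
      congr 1
      push_cast [NNReal.coe_sub (hτ (Nat.le_succ N))]
      ring
    have hleft : ∫ ω in A, Complex.exp (x * (∑ q ∈ Finset.range (N + 1),
        ∑ j, b q j * (B j (τ (q + 1)) ω - B j (τ q) ω) : ℝ) * Complex.I) ∂P =
        ∫ ω, Y ω * Complex.exp (x * (D ω : ℂ) * Complex.I) ∂P := by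
      rw [← integral_indicator hA']
      refine integral_congr_ae (Eventually.of_forall fun ω => ?_)
      have hsum : ∑ j, b N j * (B j (τ (N + 1)) ω - B j (τ N) ω) = D ω := by
        simp only [hD, mul_sub, Finset.sum_sub_distrib]
      have hQω : Q ω = ∑ q ∈ Finset.range N,
        ∑ j, b q j * (B j (τ (q + 1)) ω - B j (τ q) ω) := rfl
      by_cases hω : ω ∈ A
      · simp only [hY, Set.indicator_of_mem hω, ← Complex.exp_add]
        rw [Finset.sum_range_succ, hsum, ← hQω, Complex.ofReal_add]
        ring_nf
      · simp [hY, Set.indicator_of_notMem hω]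
    rw [hleft, hmain, hchar, hY, integral_indicator hA', ih, mul_assoc, ← Complex.exp_add,
      Finset.sum_range_succ]
    have hcN : ∑ j, b N j ^ 2 = c := rfl
    rw [hcN, mul_add, Complex.ofReal_add, neg_add]

/-- A random variable whose characteristic function on every event of `m` is that of a fixed
Gaussian law, is independent of `m` and has that law. -/
theorem indep_and_map_eq_gaussianReal {Ω : Type*} {m mΩ : MeasurableSpace Ω} {P : Measure Ω}
    [IsProbabilityMeasure P] {Z : Ω → ℝ}
    (hZ : Measurable Z) {a : ℝ} {v : ℝ≥0}
    (h : ∀ A, MeasurableSet[m] A → ∀ x : ℝ, ∫ ω in A, Complex.exp (x * (Z ω : ℂ) * Complex.I) ∂P =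
      P.real A * charFun (gaussianReal a v) x) :
    Indep (MeasurableSpace.comap Z inferInstance) m P ∧ P.map Z = gaussianReal a v := by
  have key : ∀ A, MeasurableSet[m] A → (P.restrict A).map Z = P A • gaussianReal a v := by
    intro A hA
    have hfin : IsFiniteMeasure (P A • gaussianReal a v) :=
      Measure.smul_finite _ (measure_ne_top P A)
    refine Measure.ext_of_charFun ?_
    funext x
    rw [charFun_apply_real, integral_map hZ.aemeasurable (by fun_prop), h A hA x,
      charFun_apply_real, charFun_apply_real, integral_smul_measure, Complex.real_smul]
    rfl
  have hlaw : P.map Z = gaussianReal a v := by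
    simpa using key Set.univ MeasurableSet.univ
  refine ⟨?_, hlaw⟩
  rw [Indep_iff]
  rintro _ A ⟨E, hE, rfl⟩ hA
  have h1 := congrArg (fun ν => ν E) (key A hA)
  simp only [Measure.smul_apply, smul_eq_mul] at h1
  rw [Measure.map_apply hZ hE, Measure.restrict_apply (hZ hE)] at h1
  rw [h1, ← hlaw, Measure.map_apply hZ hE, mul_comm]

/-- A limit in probability of random variables whose characteristic functions on the event `A`
are those of Gaussian laws with converging parameters. -/
theorem setIntegral_cexp_of_tendstoInMeasure [IsProbabilityMeasure P] {Z : Ω → ℝ} {Zm : ℕ → Ω → ℝ}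
    (hZm : ∀ m, AEMeasurable (Zm m) P) (hZ : TendstoInMeasure P Zm atTop Z) {a : ℝ} {v : ℝ≥0}
    {am vm : ℕ → ℝ} (ham : Tendsto am atTop (𝓝 a)) (hvm : Tendsto vm atTop (𝓝 v)) {A : Set Ω}
    {x : ℝ} (h : ∀ m, ∫ ω in A, Complex.exp (x * (Zm m ω : ℂ) * Complex.I) ∂P =
      P.real A * Complex.exp (x * (am m : ℂ) * Complex.I - (x ^ 2 / 2 * vm m : ℝ))) :
    ∫ ω in A, Complex.exp (x * (Z ω : ℂ) * Complex.I) ∂P =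
      P.real A * charFun (gaussianReal a v) x := by
  obtain ⟨ns, hns, hlim⟩ := hZ.exists_seq_tendsto_ae
  have hcont : Continuous fun y : ℝ => Complex.exp (x * y * Complex.I) := by fun_prop
  have h1 : Tendsto (fun i => ∫ ω in A, Complex.exp (x * (Zm (ns i) ω : ℂ) * Complex.I) ∂P) atTop
      (𝓝 (∫ ω in A, Complex.exp (x * (Z ω : ℂ) * Complex.I) ∂P)) := by
    refine tendsto_integral_of_dominated_convergence (fun _ => 1)
      (fun i => (hcont.measurable.comp_aemeasurable (hZm _)).aestronglyMeasurable.restrict)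
      (integrable_const _) (fun i => Eventually.of_forall fun ω => ?_)
      (ae_restrict_of_ae (hlim.mono fun ω hω => (hcont.tendsto _).comp hω))
    rw [← Complex.ofReal_mul, Complex.norm_exp_ofReal_mul_I]
  have h2 : Tendsto (fun m => (P.real A : ℂ) * Complex.exp (x * (am m : ℂ) * Complex.I -
      (x ^ 2 / 2 * vm m : ℝ))) atTop (𝓝 (P.real A * charFun (gaussianReal a v) x)) := by
    have hc : Continuous fun p : ℝ × ℝ => (P.real A : ℂ) * Complex.exp (x * (p.1 : ℂ) * Complex.I -
      (x ^ 2 / 2 * p.2 : ℝ)) := by fun_prop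
    have := (hc.tendsto (a, (v : ℝ))).comp (ham.prodMk_nhds hvm)
    have he : charFun (gaussianReal a v) x =
        Complex.exp (x * (a : ℂ) * Complex.I - (x ^ 2 / 2 * (v : ℝ) : ℝ)) := by
      rw [charFun_gaussianReal]
      congr 1
      push_cast
      ring
    rw [he]
    exact this
  refine tendsto_nhds_unique h1 ?_
  simp only [h]
  exact h2.comp hns.tendsto_atTop

end GaussianLaw

/-! ### The law of the total log return -/

section LogReturn

variable {Ω : Type*} [mΩ : MeasurableSpace Ω] {P : Measure Ω} {𝓕 : Filtration ℝ≥0 mΩ} {n d : ℕ}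
  {B : Fin d → ℝ≥0 → Ω → ℝ} {r : ℝ} {σ : Matrix (Fin n) (Fin d) ℝ} {S : Fin n → ℝ≥0 → Ω → ℝ}

theorem sq_vol (σ : Matrix (Fin n) (Fin d) ℝ) (i : Fin n) : vol σ i ^ 2 = ∑ j, σ i j ^ 2 :=
  Real.sq_sqrt (Finset.sum_nonneg fun _ _ => sq_nonneg _)

theorem LPPricing.IsMarketModel.adapted_log (hS : IsMarketModel P 𝓕 B r σ S) (i : Fin n) :
    Adapted 𝓕 fun u ω => Real.log (S i u ω) := fun u =>
  Real.measurable_log.comp (hS.adapted i u)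

theorem approximates_cellProcess {w : ℝ≥0 → ℝ} {C : ℝ} (hw : Measurable w) (hC : ∀ u, |w u| ≤ C)
    (s t : ℝ≥0) : Approximates P (cellProcess 𝓕 hC t) (fun u _ => w u) s t := by
  obtain ⟨a, -, ha, hle⟩ := exists_lintegral_cellProcess_le (Ω := Ω) hw hC t
  intro ε hε
  have ha' : Tendsto (fun m => ENNReal.ofReal (a m)) atTop (𝓝 0) := by
    simpa using ENNReal.tendsto_ofReal ha
  refine tendsto_const_nhds.congr' ?_
  filter_upwards [ha'.eventually (gt_mem_nhds hε)] with m hm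
  have hempty : {ω | ε ≤ ∫⁻ u in Set.Ioc (s : ℝ) t,
      ‖(cellProcess 𝓕 hC t m).eval u.toNNReal ω - w u.toNNReal‖ₑ ^ 2} = ∅ :=
    Set.eq_empty_of_forall_notMem fun ω hω =>
      absurd (le_trans hω (hle s t le_rfl 𝓕 m ω)) (not_le.2 hm)
  rw [hempty, measure_empty]

variable [IsProbabilityMeasure P]

theorem LPPricing.IsMarketModel.hasDriftDecomposition_log (hB : IsStandardBrownianMotion P 𝓕 B)
    (hS : IsMarketModel P 𝓕 B r σ S) (i : Fin n) :
    HasDriftDecomposition P (fun u ω => Real.log (S i u ω)) (fun u ω => ∑ j, σ i j * B j u ω)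
      (r - vol σ i ^ 2 / 2) :=
  fun t => hS.log_sub_log_ae_eq hB i t

theorem LPPricing.IsMarketModel.isItoIntegral_logReturn (hB : IsStandardBrownianMotion P 𝓕 B)
    (hS : IsMarketModel P 𝓕 B r σ S) (i : Fin n) {w : ℝ≥0 → ℝ} {C : ℝ} (hw : Measurable w)
    (hC : ∀ u, |w u| ≤ C) {s t : ℝ≥0} (hst : s ≤ t) :
    IsItoIntegral P 𝓕 (fun u _ => w u) (fun u ω => Real.log (S i u ω)) s t
      (logReturn P 𝓕 w (S i) s t) := by
  obtain ⟨a, ha0, ha, hle⟩ := exists_lintegral_cellProcess_le (Ω := Ω) hw hC t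
  have hY := hB.isScaledBM (σ i) ⟨∑ j, σ i j ^ 2, Finset.sum_nonneg fun j _ => sq_nonneg _⟩ rfl
  have hX := hS.hasDriftDecomposition_log hB i
  obtain ⟨J, hJ⟩ := hY.exists_tendstoInMeasure_integral hX hw hst ha0 ha
    (v := cellProcess 𝓕 hC t) fun m ω => hle s t le_rfl 𝓕 m ω
  exact isItoIntegral_itoIntegral (hY.isItoIntegral_of_tendstoInMeasure hX hw hst ha
    (fun m ω => hle s t le_rfl 𝓕 m ω) hJ)

/-- On the grid of cells, the elementary integrals of the weights add up to a drift plus a weighted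
sum of increments of `B`. -/
theorem LPPricing.IsMarketModel.sum_cellProcess_integral_ae_eq
    (hB : IsStandardBrownianMotion P 𝓕 B)
    (hS : IsMarketModel P 𝓕 B r σ S) {w : Fin n → ℝ≥0 → ℝ} {C : ℝ} (hC : ∀ i u, |w i u| ≤ C)
    {s t : ℝ≥0} (hst : s ≤ t) (m : ℕ) :
    ∀ᵐ ω ∂P, ∑ i, (cellProcess 𝓕 (hC i) t m).integral (fun u ω => Real.log (S i u ω)) s t ω =
      (∫ u in (s : ℝ)..t, ∑ i, cellAverage (w i) m (cellIndex m u.toNNReal) *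
        (r - vol σ i ^ 2 / 2)) +
      ∑ k ∈ Finset.range (⌈t⌉₊ * (m + 1)), ∑ j, (∑ i, cellAverage (w i) m k * σ i j) *
        (B j (cellPoint s t m (k + 1)) ω - B j (cellPoint s t m k) ω) := by
  have h : ∀ᵐ ω ∂P, ∀ i k, Real.log (S i (cellPoint s t m (k + 1)) ω) -
      Real.log (S i (cellPoint s t m k) ω) = (r - vol σ i ^ 2 / 2) *
        ((cellPoint s t m (k + 1) : ℝ) - cellPoint s t m k) +
      (∑ j, σ i j * B j (cellPoint s t m (k + 1)) ω - ∑ j, σ i j * B j (cellPoint s t m k) ω) :=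
    ae_all_iff.2 fun i => ae_all_iff.2 fun k => (hS.hasDriftDecomposition_log hB i).sub_ae_eq _ _
  filter_upwards [h] with ω hω
  rw [integral_cellIndex_eq_sum hst le_rfl m fun k =>
    ∑ i, cellAverage (w i) m k * (r - vol σ i ^ 2 / 2), ← Finset.sum_add_distrib]
  simp only [cellProcess_integral, hω]
  rw [Finset.sum_comm]
  refine Finset.sum_congr rfl fun k _ => ?_
  simp only [mul_add, Finset.sum_add_distrib, Finset.sum_mul, mul_assoc]
  congr 1
  rw [Finset.sum_comm]
  refine Finset.sum_congr rfl fun i _ => ?_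
  rw [← Finset.sum_sub_distrib, Finset.mul_sum]
  refine Finset.sum_congr rfl fun j _ => ?_
  ring

/-- The total return `∑ i, ∫_s^t w_i d log S_i` is independent of the past of `s` and Gaussian. -/
theorem LPPricing.IsMarketModel.exists_gaussian_sum_logReturn (hB : IsStandardBrownianMotion P 𝓕 B)
    (hS : IsMarketModel P 𝓕 B r σ S) {w : Fin n → ℝ≥0 → ℝ} {C : ℝ} (hw : ∀ i, Measurable (w i))
    (hC : ∀ i u, |w i u| ≤ C) {s t : ℝ≥0} (hst : s ≤ t) {v : ℝ≥0}
    (hv : (v : ℝ) = ∫ u in (s : ℝ)..t, ∑ j, (∑ i, w i u.toNNReal * σ i j) ^ 2) :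
    ∃ Z : Ω → ℝ, Measurable[𝓕 t] Z ∧ (fun ω => ∑ i, logReturn P 𝓕 (w i) (S i) s t ω) =ᵐ[P] Z ∧
      Indep (MeasurableSpace.comap Z inferInstance) (𝓕 s) P ∧
      P.map Z = gaussianReal (∫ u in (s : ℝ)..t, ∑ i, w i u.toNNReal * (r - vol σ i ^ 2 / 2)) v := by
  have hJ := fun i => hS.isItoIntegral_logReturn hB i (hw i) (hC i) hst
  choose Z hZm hZ using fun i => (hJ i).exists_measurable_ae_eq (hS.adapted_log i) hst
  have hZsum : (fun ω => ∑ i, logReturn P 𝓕 (w i) (S i) s t ω) =ᵐ[P] fun ω => ∑ i, Z i ω := by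
    filter_upwards [ae_all_iff.2 hZ] with ω hω
    exact Finset.sum_congr rfl fun i _ => hω i
  have hZmeas : Measurable[𝓕 t] fun ω => ∑ i, Z i ω := Finset.measurable_sum _ fun i _ => hZm i
  refine ⟨fun ω => ∑ i, Z i ω, hZmeas, hZsum, ?_⟩
  refine indep_and_map_eq_gaussianReal (hZmeas.mono (𝓕.le t) le_rfl) fun A hA x => ?_
  have hlim : TendstoInMeasure P (fun m ω => ∑ i, (cellProcess 𝓕 (hC i) t m).integral
      (fun u ω => Real.log (S i u ω)) s t ω) atTop fun ω => ∑ i, Z i ω :=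
    (tendstoInMeasure_finset_sum Finset.univ fun i _ =>
      (hJ i).2 _ (approximates_cellProcess (hw i) (hC i) s t)).congr_right hZsum
  refine setIntegral_cexp_of_tendstoInMeasure (fun m => ?_) hlim
    (tendsto_integral_cellAverage hw hC
      (Ψ := fun y => ∑ i, y i * (r - vol σ i ^ 2 / 2)) (by fun_prop) s t)
    (vm := fun m => ∫ u in (s : ℝ)..t, ∑ j,
      (∑ i, cellAverage (w i) m (cellIndex m u.toNNReal) * σ i j) ^ 2) ?_ fun m => ?_
  · exact ((Finset.measurable_sum _ fun i _ => (SimpleProcess.measurable_integral_of_adapted _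
      (hS.adapted_log i) hst)).mono (𝓕.le t) le_rfl).aemeasurable
  · rw [hv]
    exact tendsto_integral_cellAverage hw hC
      (Ψ := fun y => ∑ j, (∑ i, y i * σ i j) ^ 2) (by fun_prop) s t
  · have hA' : MeasurableSet[𝓕 (cellPoint s t m 0)] A := by rwa [cellPoint_zero]
    have h := hB.setIntegral_cexp_sum (cellPoint_mono s t m)
      (fun k j => ∑ i, cellAverage (w i) m k * σ i j) hA' x (⌈t⌉₊ * (m + 1))
    rw [← integral_cellIndex_eq_sum hst le_rfl m fun k =>
      ∑ j, (∑ i, cellAverage (w i) m k * σ i j) ^ 2] at h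
    rw [sub_eq_add_neg, Complex.exp_add, mul_left_comm, ← h, ← integral_const_mul]
    refine setIntegral_congr_ae (𝓕.le _ _ hA) ?_
    filter_upwards [hS.sum_cellProcess_integral_ae_eq hB hC hst m] with ω hω _
    rw [hω, ← Complex.exp_add, Complex.ofReal_add, mul_add, add_mul]

end LogReturn

/-! ### The drift and variance of the total log return -/

section Eta

variable {Ω : Type*} [mΩ : MeasurableSpace Ω] {P : Measure Ω} {𝓕 : Filtration ℝ≥0 mΩ} {n d : ℕ}
  {B : Fin d → ℝ≥0 → Ω → ℝ} {σ : Matrix (Fin n) (Fin d) ℝ} {ρ : Fin n → Fin n → ℝ}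

/-- The correlations recover the covariance matrix `σ σᵀ`. -/
theorem vol_mul_vol_mul_rho_eq [IsProbabilityMeasure P] (hB : IsStandardBrownianMotion P 𝓕 B)
    (hσ : ∀ i, 0 < vol σ i)
    (hρ : ∀ i j, HasCovariationRate P (drivingBM σ B i) (drivingBM σ B j) (ρ i j)) (i j : Fin n) :
    vol σ i * vol σ j * ρ i j = ∑ k, σ i k * σ j k := by
  have h : ρ i j = ∑ k, σ i k / vol σ i * (σ j k / vol σ j) :=
    LPPricing.HasCovariationRate.eq_sum hB (hρ i j)
  rw [h, Finset.mul_sum]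
  refine Finset.sum_congr rfl fun k _ => ?_
  have h1 := (hσ i).ne'
  have h2 := (hσ j).ne'
  field_simp

/-- The drift of the total log return plus half its variance, at a fixed time with weights `x`. -/
theorem drift_add_half_variance_eq (hcov : ∀ i j, vol σ i * vol σ j * ρ i j = ∑ k, σ i k * σ j k)
    (r : ℝ) {x : Fin n → ℝ} (hx : ∑ i, x i = 1) :
    ∑ i, x i * (r - vol σ i ^ 2 / 2) + 1 / 2 * ∑ j, (∑ i, x i * σ i j) ^ 2 =
      r + (∑ i, vol σ i ^ 2 / 2 * (x i ^ 2 - x i) + 1 / 2 * ∑ i,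
        ∑ j ∈ Finset.univ.filter (fun j => j ≠ i), vol σ i * vol σ j * ρ i j * (x i * x j)) := by
  have hsq : ∑ j, (∑ i, x i * σ i j) ^ 2 =
      ∑ i, ∑ i', vol σ i * vol σ i' * ρ i i' * (x i * x i') := by
    have h : ∀ j, (∑ i, x i * σ i j) ^ 2 = ∑ i, ∑ i', x i * σ i j * (x i' * σ i' j) := fun j => by
      rw [sq, Finset.sum_mul_sum]
    rw [Finset.sum_congr rfl fun j _ => h j, Finset.sum_comm]
    refine Finset.sum_congr rfl fun i _ => ?_
    rw [Finset.sum_comm]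
    refine Finset.sum_congr rfl fun i' _ => ?_
    rw [hcov, Finset.sum_mul]
    exact Finset.sum_congr rfl fun j _ => by ring
  have hdiag : ∀ i, ∑ i', vol σ i * vol σ i' * ρ i i' * (x i * x i') = vol σ i ^ 2 * x i ^ 2 +
      ∑ j ∈ Finset.univ.filter (fun j => j ≠ i), vol σ i * vol σ j * ρ i j * (x i * x j) := by
    intro i
    have hii : vol σ i * vol σ i * ρ i i = vol σ i ^ 2 := by
      rw [hcov, sq_vol]
      exact Finset.sum_congr rfl fun k _ => (sq _).symm
    rw [Finset.filter_ne', ← Finset.add_sum_erase _ _ (Finset.mem_univ i), hii, sq (x i)]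
  have hr : r = ∑ i, x i * r := by rw [← Finset.sum_mul, hx, one_mul]
  rw [hsq, Finset.sum_congr rfl fun i _ => hdiag i, Finset.sum_add_distrib, mul_add, ← add_assoc,
    ← add_assoc]
  congr 1
  nth_rewrite 2 [hr]
  rw [Finset.mul_sum, ← Finset.sum_add_distrib, ← Finset.sum_add_distrib]
  exact Finset.sum_congr rfl fun i _ => by ring

theorem intervalIntegrable_comp_weights {w : Fin n → ℝ≥0 → ℝ} {C : ℝ} (hw : ∀ i, Measurable (w i))
    (hC : ∀ i u, |w i u| ≤ C) {Ψ : (Fin n → ℝ) → ℝ} (hΨ : Continuous Ψ) (a b : ℝ) :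
    IntervalIntegrable (fun u : ℝ => Ψ fun i => w i u.toNNReal) volume a b := by
  obtain ⟨K, hK⟩ := (isCompact_closedBall (0 : Fin n → ℝ) |C|).bddAbove_image
    (f := fun x => ‖Ψ x‖) hΨ.norm.continuousOn
  refine (intervalIntegrable_const (c := K)).mono_fun' ?_ (Eventually.of_forall fun u => ?_)
  · exact (hΨ.measurable.comp (measurable_pi_lambda _ fun i =>
      (hw i).comp measurable_real_toNNReal)).aestronglyMeasurable
  · refine hK ⟨_, ?_, rfl⟩
    rw [mem_closedBall_zero_iff, pi_norm_le_iff_of_nonneg (abs_nonneg C)]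
    exact fun i => (hC i _).trans (le_abs_self C)

/-- The exponent in the mean of the lognormal total return is `r (T - t) + η(t, T)`. -/
theorem integral_drift_add_half_variance_eq
    (hcov : ∀ i j, vol σ i * vol σ j * ρ i j = ∑ k, σ i k * σ j k) (r : ℝ)
    {w : Fin n → ℝ≥0 → ℝ} {C : ℝ} (hw : ∀ i, Measurable (w i)) (hC : ∀ i u, |w i u| ≤ C)
    (hw_sum : ∀ u, ∑ i, w i u = 1) (t T : ℝ≥0) :
    (∫ u in (t : ℝ)..T, ∑ i, w i u.toNNReal * (r - vol σ i ^ 2 / 2)) +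
      (∫ u in (t : ℝ)..T, ∑ j, (∑ i, w i u.toNNReal * σ i j) ^ 2) / 2 =
      r * ((T : ℝ) - t) + eta (vol σ) ρ w t T := by
  have hI : ∀ Ψ : (Fin n → ℝ) → ℝ, Continuous Ψ →
      IntervalIntegrable (fun u : ℝ => Ψ fun i => w i u.toNNReal) volume t T := fun Ψ hΨ =>
    intervalIntegrable_comp_weights hw hC hΨ t T
  have heta : eta (vol σ) ρ w t T = ∫ u in (t : ℝ)..T,
      (∑ i, vol σ i ^ 2 / 2 * (w i u.toNNReal ^ 2 - w i u.toNNReal) + 1 / 2 * ∑ i,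
        ∑ j ∈ Finset.univ.filter (fun j => j ≠ i),
          vol σ i * vol σ j * ρ i j * (w i u.toNNReal * w j u.toNNReal)) := by
    rw [intervalIntegral.integral_add
      (hI (fun x => ∑ i, vol σ i ^ 2 / 2 * (x i ^ 2 - x i)) (by fun_prop))
      (hI (fun x => 1 / 2 * ∑ i, ∑ j ∈ Finset.univ.filter (fun j => j ≠ i),
          vol σ i * vol σ j * ρ i j * (x i * x j)) (by fun_prop)),
      intervalIntegral.integral_const_mul,
      intervalIntegral.integral_finsetSum fun i _ =>
        hI (fun x => vol σ i ^ 2 / 2 * (x i ^ 2 - x i)) (by fun_prop),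
      intervalIntegral.integral_finsetSum fun i _ =>
        hI (fun x => ∑ j ∈ Finset.univ.filter (fun j => j ≠ i),
          vol σ i * vol σ j * ρ i j * (x i * x j)) (by fun_prop)]
    unfold eta
    congr 1
    · exact Finset.sum_congr rfl fun i _ => (intervalIntegral.integral_const_mul _ _).symm
    · congr 1
      refine Finset.sum_congr rfl fun i _ => ?_
      rw [intervalIntegral.integral_finsetSum fun j _ =>
        hI (fun x => vol σ i * vol σ j * ρ i j * (x i * x j)) (by fun_prop)]
      exact Finset.sum_congr rfl fun j _ => (intervalIntegral.integral_const_mul _ _).symm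
  have hconst : r * ((T : ℝ) - t) = ∫ _ in (t : ℝ)..T, r := by
    rw [intervalIntegral.integral_const, smul_eq_mul, mul_comm]
  rw [heta, hconst, ← intervalIntegral.integral_add intervalIntegrable_const
      (hI (fun x => ∑ i, vol σ i ^ 2 / 2 * (x i ^ 2 - x i) + 1 / 2 * ∑ i,
        ∑ j ∈ Finset.univ.filter (fun j => j ≠ i),
          vol σ i * vol σ j * ρ i j * (x i * x j)) (by fun_prop)),
    div_eq_inv_mul, ← one_div, ← intervalIntegral.integral_const_mul,
    ← intervalIntegral.integral_add
      (hI (fun x => ∑ i, x i * (r - vol σ i ^ 2 / 2)) (by fun_prop))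
      (hI (fun x => 1 / 2 * ∑ j, (∑ i, x i * σ i j) ^ 2) (by fun_prop))]
  exact intervalIntegral.integral_congr fun u _ =>
    drift_add_half_variance_eq hcov r (hw_sum u.toNNReal)

end Eta

/-! ### Pricing -/

section Pricing

variable {Ω : Type*} [mΩ : MeasurableSpace Ω] {P : Measure Ω}

theorem integrable_exp_of_map_eq_gaussianReal {Z : Ω → ℝ} (hZ : Measurable Z) {a : ℝ} {v : ℝ≥0}
    (h : P.map Z = gaussianReal a v) : Integrable (fun ω => Real.exp (Z ω)) P := by
  have h1 := integrable_exp_mul_gaussianReal (μ := a) (v := v) 1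
  simp only [one_mul] at h1
  rw [← h] at h1
  exact h1.comp_measurable hZ

theorem integral_exp_of_map_eq_gaussianReal {Z : Ω → ℝ} {a : ℝ} {v : ℝ≥0}
    (h : P.map Z = gaussianReal a v) : ∫ ω, Real.exp (Z ω) ∂P = Real.exp (a + v / 2) := by
  have h1 := mgf_gaussianReal h 1
  simpa [mgf] using h1

/-- The conditional expectation of a past factor times an exponential Gaussian independent of the
past. -/
theorem condExp_mul_exp_of_gaussian {Ω : Type*} {m mΩ : MeasurableSpace Ω} {P : Measure Ω}
    [IsProbabilityMeasure P] (hm : m ≤ mΩ) {G Z : Ω → ℝ} (hG : Measurable[m] G)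
    (hGi : Integrable G P) (hZ : Measurable Z) {a : ℝ} {v : ℝ≥0}
    (hind : Indep (MeasurableSpace.comap Z inferInstance) m P) (hlaw : P.map Z = gaussianReal a v) :
    Integrable (fun ω => G ω * Real.exp (Z ω)) P ∧
    P[fun ω => G ω * Real.exp (Z ω) | m] =ᵐ[P] fun ω => G ω * Real.exp (a + v / 2) := by
  have hexp : Integrable (fun ω => Real.exp (Z ω)) P := integrable_exp_of_map_eq_gaussianReal hZ hlaw
  have hindf : IndepFun G (fun ω => Real.exp (Z ω)) P := by
    have h1 : IndepFun G Z P := by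
      rw [IndepFun_iff_Indep]
      exact (indep_of_indep_of_le_right hind hG.comap_le).symm
    exact h1.comp measurable_id Real.measurable_exp
  have hint : Integrable (fun ω => G ω * Real.exp (Z ω)) P := hindf.integrable_mul hGi hexp
  refine ⟨hint, ?_⟩
  have h1 := condExp_mul_of_aestronglyMeasurable_left (m := m) (μ := P)
    hG.aestronglyMeasurable hint hexp
  have h2 : P[fun ω => Real.exp (Z ω) | m] =ᵐ[P] fun _ => Real.exp (a + v / 2) := by
    have h3 := condExp_indep_eq (m₁ := MeasurableSpace.comap Z inferInstance) (m₂ := m) (μ := P)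
      hZ.comap_le hm (f := fun ω => Real.exp (Z ω))
      (Real.measurable_exp.comp (comap_measurable Z)).stronglyMeasurable hind
    rwa [integral_exp_of_map_eq_gaussianReal hlaw] at h3
  refine h1.trans ?_
  filter_upwards [h2] with ω hω
  rw [Pi.mul_apply, hω]

end Pricing

theorem mainTheorem3 {Ω : Type*} [mΩ : MeasurableSpace Ω] (P : Measure Ω) [IsProbabilityMeasure P]
    (𝓕 : Filtration ℝ≥0 mΩ) {n d : ℕ}
    (B : Fin d → ℝ≥0 → Ω → ℝ) (hB : IsStandardBrownianMotion P 𝓕 B)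
    (r : ℝ) (σ : Matrix (Fin n) (Fin d) ℝ) (hσ : ∀ i, 0 < vol σ i)
    (S : Fin n → ℝ≥0 → Ω → ℝ) (hS : IsMarketModel P 𝓕 B r σ S)
    (ρ : Fin n → Fin n → ℝ)
    (hρ : ∀ i j, HasCovariationRate P (drivingBM σ B i) (drivingBM σ B j) (ρ i j))
    (w : Fin n → ℝ≥0 → ℝ) (hw_meas : ∀ i, Measurable (w i))
    (hw_nonneg : ∀ i t, 0 ≤ w i t) (hw_sum : ∀ t, ∑ i, w i t = 1)
    (G₀ : Ω → ℝ) (hG₀_meas : Measurable[𝓕 0] G₀) (hG₀_int : Integrable G₀ P)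
    (t T : ℝ≥0) (htT : t ≤ T) :
    (∀ᵐ ω ∂P, lpPayoff P 𝓕 G₀ w S T ω =
      lpPayoff P 𝓕 G₀ w S t ω * ∏ i, Real.exp (logReturn P 𝓕 (w i) (S i) t T ω)) ∧
    Integrable (lpPayoff P 𝓕 G₀ w S T) P ∧
    P[fun ω => Real.exp (-r * ((T : ℝ) - t)) * lpPayoff P 𝓕 G₀ w S T ω | 𝓕 t] =ᵐ[P]
      fun ω => lpPayoff P 𝓕 G₀ w S t ω * Real.exp (eta (vol σ) ρ w t T) := by
  have hC : ∀ i u, |w i u| ≤ 1 := fun i u => by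
    rw [abs_of_nonneg (hw_nonneg i u), ← hw_sum u]
    exact Finset.single_le_sum (fun j _ => hw_nonneg j u) (Finset.mem_univ i)
  have hJ := fun i {s t : ℝ≥0} (hst : s ≤ t) =>
    hS.isItoIntegral_logReturn hB i (hw_meas i) (hC i) hst
  have hvar : ∀ {s t : ℝ≥0}, s ≤ t →
      0 ≤ ∫ u in (s : ℝ)..t, ∑ j, (∑ i, w i u.toNNReal * σ i j) ^ 2 := fun hst =>
    intervalIntegral.integral_nonneg (NNReal.coe_le_coe.2 hst) fun u _ =>
      Finset.sum_nonneg fun j _ => sq_nonneg _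
  have hmult : ∀ᵐ ω ∂P, lpPayoff P 𝓕 G₀ w S T ω =
      lpPayoff P 𝓕 G₀ w S t ω * ∏ i, Real.exp (logReturn P 𝓕 (w i) (S i) t T ω) := by
    have hadd := fun i => (hJ i zero_le).ae_eq_add zero_le htT (hJ i htT)
      (hJ i (zero_le (a := T)))
    filter_upwards [ae_all_iff.2 hadd] with ω hω
    simp only [lpPayoff, hω, Real.exp_add, Finset.prod_mul_distrib, mul_assoc]
  -- Versions of the log returns over `[0, t]` and `[t, T]` that are measurable at time `t` and `T`.
  obtain ⟨Z₀, hZ₀m, hZ₀, hZ₀ind, hZ₀law⟩ := hS.exists_gaussian_sum_logReturn hB hw_meas hC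
    (zero_le (a := t)) (v := ⟨_, hvar zero_le⟩) rfl
  obtain ⟨Z, hZm, hZ, hZind, hZlaw⟩ := hS.exists_gaussian_sum_logReturn hB hw_meas hC
    htT (v := ⟨_, hvar htT⟩) rfl
  have hZ₀m' : Measurable Z₀ := hZ₀m.mono (𝓕.le t) le_rfl
  have hZm' : Measurable Z := hZm.mono (𝓕.le T) le_rfl
  have hGt : lpPayoff P 𝓕 G₀ w S t =ᵐ[P] fun ω => G₀ ω * Real.exp (Z₀ ω) := by
    filter_upwards [hZ₀] with ω hω
    rw [lpPayoff, ← Real.exp_sum, hω]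
  have hGtm : Measurable[𝓕 t] fun ω => G₀ ω * Real.exp (Z₀ ω) :=
    (hG₀_meas.mono (𝓕.mono zero_le) le_rfl).mul (Real.measurable_exp.comp hZ₀m)
  have hGti := (condExp_mul_exp_of_gaussian (𝓕.le 0) hG₀_meas hG₀_int hZ₀m' hZ₀ind hZ₀law).1
  obtain ⟨hGTi, hcond⟩ := condExp_mul_exp_of_gaussian (𝓕.le t) hGtm hGti hZm' hZind hZlaw
  have hGT : lpPayoff P 𝓕 G₀ w S T =ᵐ[P] fun ω => G₀ ω * Real.exp (Z₀ ω) * Real.exp (Z ω) := by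
    filter_upwards [hmult, hGt, hZ] with ω h1 h2 h3
    rw [h1, h2, ← Real.exp_sum, h3]
  refine ⟨hmult, hGTi.congr hGT.symm, ?_⟩
  have hη := integral_drift_add_half_variance_eq (vol_mul_vol_mul_rho_eq hB hσ hρ) r hw_meas hC
    hw_sum t T
  have h1 : P[fun ω => Real.exp (-r * ((T : ℝ) - t)) * lpPayoff P 𝓕 G₀ w S T ω | 𝓕 t] =ᵐ[P]
      fun ω => Real.exp (-r * ((T : ℝ) - t)) * (P[lpPayoff P 𝓕 G₀ w S T | 𝓕 t]) ω :=
    condExp_smul (Real.exp (-r * ((T : ℝ) - t))) (lpPayoff P 𝓕 G₀ w S T) (𝓕 t)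
  filter_upwards [h1, condExp_congr_ae (m := 𝓕 t) hGT, hcond, hGt] with ω h1 h2 h3 h4
  rw [h1, h2, h3, h4, mul_left_comm, ← Real.exp_add]
  congr 2
  refine (congrArg (fun y => -r * ((T : ℝ) - t) + y) hη).trans ?_
  ring
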